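/- Let $G$ be a (Hausdorff) locally compact group with left Haar measure, let $p\in(1,\infty)$, and let $p'\in(1,\infty)$ satisfy $\frac1p+\frac1{p'}=1$. Definitions. A representation of $G$ is a pair $(\pi,E)$ with $E$ a complex Banach space and $\pi$ a strongly continuous homomorphism from $G$ into the invertible isometries of $E$. It is cyclic if $\{\int_G a(x)\pi(x)\xi\,dx : a\in L_1(G)\}$ is dense in $E$ for some $\xi\in E$. A $QSL_{q}$-space is a Banach space isometrically isomorphic to a quotient of a closed subspace of some $L_{q}$-space. $B_p(G)$ is the set of all coefficient functions $x\mapsto\langle\pi(x)\xi,\phi\rangle$ ($\xi\in E$, $\phi\in E^*$) of representations $(\pi,E)$ of $G$ on $QSL_{p'}$-spaces, and $\|f\|_{B_p(G)}$ is the infimum of $\sum_{n}\|\xi_n\|\|\phi_n\|<\infty$ over all expansions $f(x)=\sum_{n}\langle\pi_n(x)\xi_n,\phi_n\rangle$ $(x\in G)$ with $(\pi_n,E_n)$ cyclic representations on $QSL_{p'}$-spaces, $\xi_n\in E_n$, $\phi_n\in E_n^*$. $A_p(G)$ is the set of functions of the form $f(x)=\sum_n\int_G\xi_n(x^{-1}y)\phi_n(y)\,dy$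 $(x\in G)$ with $\xi_n\in L_{p'}(G)$, $\phi_n\in L_p(G)$, $\sum_n\|\xi_n\|\|\phi_n\|<\infty$, and $\|f\|_{A_p(G)}$ is the infimum of these sums. $\mathcal M(A_p(G))$ is the set of bounded continuous $f\colon G\to\mathbb C$ with $fA_p(G)\subset A_p(G)$, normed by the operator norm $\|f\|_{\mathcal M(A_p(G))}$ of $g\mapsto fg$ on $A_p(G)$. $G$ is amenable if there is a left invariant mean on the bounded continuous functions on $G$. Theorem. (i) If $f\in A_p(G)$ and $g\in B_p(G)$, then $fg\in A_p(G)$ and $\|fg\|_{A_p(G)}\le\|f\|_{A_p(G)}\|g\|_{B_p(G)}$. (ii) $B_p(G)\subset\mathcal M(A_p(G))$, and $\|f\|_{\mathcal M(A_p(G))}\le\|f\|_{B_p(G)}$ for all $f\in B_p(G)$. (iii) $A_p(G)\subset B_p(G)$, and $\|f\|_{\mathcal M(A_p(G))}\le\|f\|_{B_p(G)}\le\|f\|_{A_p(G)}$ for all $f\in A_p(G)$. (iv) If $G$ is amenable, then $\|f\|_{\mathcal M(A_p(G))}=\|f\|_{B_p(G)}=\|f\|_{A_p(G)}$ for all $f\in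 A_p(G)$. -/

import Mathlib

open MeasureTheory
open scoped ENNReal BoundedContinuousFunction

universe u

/-- A complex Banach space is a `QSL_p`-space if it is isometrically isomorphic to a quotient
(by a closed subspace) of a closed subspace of `L_p(X)` for some measure space `X`. -/
def IsQSL (p : ℝ≥0∞) [Fact (1 ≤ p)] (E : Type u) [NormedAddCommGroup E] [NormedSpace ℂ E] :
    Prop :=
  ∃ (X : Type u) (_ : MeasurableSpace X) (ν : Measure X)
    (M : Submodule ℂ (Lp ℂ p ν)) (N : Submodule ℂ M),
    IsClosed (M : Set (Lp ℂ p ν)) ∧ IsClosed (N : Set M) ∧ Nonempty ((M ⧸ N) ≃ₗᵢ[ℂ] E)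

/-- A representation of a topological group on a complex Banach space: a homomorphism into the
invertible isometries that is continuous for the strong operator topology. -/
structure BanachRep (G : Type u) [Group G] [TopologicalSpace G] where
  /-- the underlying Banach space -/
  carrier : Type u
  [normedAddCommGroup : NormedAddCommGroup carrier]
  [normedSpace : NormedSpace ℂ carrier]
  [completeSpace : CompleteSpace carrier]
  /-- the homomorphism into the invertible linear isometries -/
  hom : G →* (carrier ≃ₗᵢ[ℂ] carrier)
  continuous_hom : ∀ ξ : carrier, Continuous fun x : G => hom x ξ

attribute [instance] BanachRep.normedAddCommGroup BanachRep.normedSpace BanachRep.completeSpace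

/-- `Rep_p(G)`: the representations of `G` on `QSL_p`-spaces. -/
def QSLRep (p : ℝ≥0∞) [Fact (1 ≤ p)] (G : Type u) [Group G] [TopologicalSpace G] :
    Set (BanachRep G) :=
  {π | IsQSL p π.carrier}

/-- The operator `π(a) = ∫ a(x) π(x) dx` applied to the vector `ξ`, for `a` in `L_1(G)`. -/
noncomputable def BanachRep.integrated {G : Type u} [Group G] [TopologicalSpace G]
    [MeasurableSpace G] (μ : Measure G) (π : BanachRep G) (a : Lp ℂ 1 μ) (ξ : π.carrier) :
    π.carrier :=
  ∫ x, a x • π.hom x ξ ∂μ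

/-- `(π, E)` is cyclic: `π(L_1(G)) ξ` is dense in `E` for some vector `ξ`. -/
def BanachRep.IsCyclic {G : Type u} [Group G] [TopologicalSpace G] [MeasurableSpace G]
    (μ : Measure G) (π : BanachRep G) : Prop :=
  ∃ ξ : π.carrier, Dense (Set.range fun a : Lp ℂ 1 μ => π.integrated μ a ξ)

/-- `Cyc_p(G)`: the cyclic representations of `G` on `QSL_p`-spaces. -/
def CycQSLRep (p : ℝ≥0∞) [Fact (1 ≤ p)] {G : Type u} [Group G] [TopologicalSpace G]
    [MeasurableSpace G] (μ : Measure G) : Set (BanachRep G) :=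
  {π | π ∈ QSLRep p G ∧ π.IsCyclic μ}

/-- `B_p(G)`, where `p'` is the exponent dual to `p`: all coefficient functions
`x ↦ ⟨π(x) ξ, φ⟩` of representations of `G` on `QSL_{p'}`-spaces. -/
def BpSpace (p' : ℝ≥0∞) [Fact (1 ≤ p')] (G : Type u) [Group G] [TopologicalSpace G] :
    Set (G → ℂ) :=
  {f | ∃ π ∈ QSLRep p' G, ∃ (ξ : π.carrier) (φ : StrongDual ℂ π.carrier),
    ∀ x, f x = φ (π.hom x ξ)}

/-- The norm of `B_p(G)`, where `p'` is the exponent dual to `p`: the infimum of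
`∑ ‖ξ_n‖ ‖φ_n‖` over all series `f(x) = ∑ ⟨π_n(x) ξ_n, φ_n⟩` with cyclic `π_n`. -/
noncomputable def BpNorm (p' : ℝ≥0∞) [Fact (1 ≤ p')] {G : Type u} [Group G]
    [TopologicalSpace G] [MeasurableSpace G] (μ : Measure G) (f : G → ℂ) : ℝ :=
  sInf {r : ℝ | ∃ π : ℕ → BanachRep G, (∀ n, π n ∈ CycQSLRep p' μ) ∧
    ∃ (ξ : ∀ n, (π n).carrier) (φ : ∀ n, StrongDual ℂ (π n).carrier),
      HasSum (fun n => ‖ξ n‖ * ‖φ n‖) r ∧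
      ∀ x, HasSum (fun n => φ n ((π n).hom x (ξ n))) (f x)}

/-- The total weight of the expansion `f(x) = ∑ ⟨λ_{p'}(x) ξ_n, φ_n⟩` is
`r = ∑ ‖ξ_n‖ ‖φ_n‖ < ∞`. Here `(λ_{p'}(x) ξ)(y) = ξ(x⁻¹ y)`. -/
def IsApExpansion (p p' : ℝ≥0∞) {G : Type u} [Group G] [MeasurableSpace G] (μ : Measure G)
    (f : G → ℂ) (ξ : ℕ → Lp ℂ p' μ) (φ : ℕ → Lp ℂ p μ) (r : ℝ) : Prop :=
  HasSum (fun n => ‖ξ n‖ * ‖φ n‖) r ∧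
    ∀ x, HasSum (fun n => ∫ y, ξ n (x⁻¹ * y) * φ n y ∂μ) (f x)

/-- The Figà-Talamanca–Herz algebra `A_p(G)`, where `p'` is the exponent dual to `p`. -/
def ApSpace (p p' : ℝ≥0∞) {G : Type u} [Group G] [MeasurableSpace G] (μ : Measure G) :
    Set (G → ℂ) :=
  {f | ∃ ξ φ r, IsApExpansion p p' μ f ξ φ r}

/-- The norm of `A_p(G)`. -/
noncomputable def ApNorm (p p' : ℝ≥0∞) {G : Type u} [Group G] [MeasurableSpace G]
    (μ : Measure G) (f : G → ℂ) : ℝ :=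
  sInf {r : ℝ | ∃ ξ φ, IsApExpansion p p' μ f ξ φ r}

/-- The multipliers of `A_p(G)`: the bounded continuous `f` with `f A_p(G) ⊆ A_p(G)`. -/
def ApMultipliers (p p' : ℝ≥0∞) {G : Type u} [Group G] [TopologicalSpace G]
    [MeasurableSpace G] (μ : Measure G) : Set (G → ℂ) :=
  {f | Continuous f ∧ (∃ C : ℝ, ∀ x, ‖f x‖ ≤ C) ∧ ∀ g ∈ ApSpace p p' μ, f * g ∈ ApSpace p p' μ}

/-- The multiplier norm: the operator norm of `g ↦ f g` on `A_p(G)`. -/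
noncomputable def ApMultiplierNorm (p p' : ℝ≥0∞) {G : Type u} [Group G] [MeasurableSpace G]
    (μ : Measure G) (f : G → ℂ) : ℝ :=
  sInf {C : ℝ | 0 ≤ C ∧ ∀ g ∈ ApSpace p p' μ, ApNorm p p' μ (f * g) ≤ C * ApNorm p p' μ g}

/-- A topological group is amenable if there is a left invariant mean on the space of its
bounded continuous functions. -/
def IsAmenableGroup (G : Type u) [Group G] [TopologicalSpace G] [IsTopologicalGroup G] : Prop :=
  ∃ m : (G →ᵇ ℝ) →ₗ[ℝ] ℝ, (∀ f, 0 ≤ f → 0 ≤ m f) ∧ m 1 = 1 ∧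
    ∀ (x : G) (f : G →ᵇ ℝ), m (f.compContinuous (ContinuousMap.mulLeft x)) = m f

/-!
# Multipliers of the Figà-Talamanca–Herz algebra and coefficients on `QSL`-spaces

Both norms are gauges: `A_p(G)` consists of the absolutely convergent series of the coefficients
`⟨λ(x) ξ, φ⟩` of the regular representation on `L_{p'}(G)`, and `B_p(G)` is normed by series of
coefficients of cyclic representations on `QSL_{p'}`-spaces. They are studied as functionals with
values in `[0, ∞]` (`atomicNorm`, `apENorm`, `bpENorm`), for which countable subadditivity is
available; it reduces the estimates to single coefficients.

*Products.* The product of `⟨λ(x) ξ, φ⟩` and `⟨π(x) η, ψ⟩` is the coefficient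
`∫ ⟨F(x⁻¹ y), Φ(y)⟩ dy` of translation on `L_{p'}(G, E)`, with `F(z) = ξ(z) π(z⁻¹) η` and
`Φ(y) = φ(y) π(y)* ψ` (`apAtom_mul_coefficient`); this is the trick of Fell which turns `λ ⊗ π` into
a multiple of `λ`. Such a coefficient has norm at most `‖F‖ ‖Φ‖` in `A_p(G)` whenever `E` is a
`QSL_{p'}`-space (`apENorm_crossCoeff_le`). For finitely many values of `F` and `Φ` this holds
because the values can be replaced, up to a small error, by vectors in finite dimensional `ℓ_{p'}`
and `ℓ_p` with almost the same norms (`IsQSL.isLqApproximable`), and then the coefficient is a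
finite sum of coefficients of `λ` to which Hölder's inequality applies. The general case follows by
density.

*Inclusion.* A function in `A_p(G)` is a single coefficient of translation on `L_{p'}(ℕ × G)`
(`mem_BpSpace_of_apENorm_ne_top`), and every atom of `A_p(G)` is a coefficient of `λ`, hence of its
cyclic subrepresentations.

*Amenability.* An invariant mean, applied to convolutions `a * f`, depends on `a` only through its
integral, by the uniqueness of Haar measure (`exists_mean_convBounded_eq`). With the Hahn–Banach
theorem this yields almost invariant vectors in every closed convex invariant set
(`exists_mem_forall_norm_sub_lt`), in particular almost invariant densities `h` in `L_1(G)`. The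
coefficients `e` of the pairs `h^{1/p'}`, `h^{1/p}` have norm at most `1` in `A_p(G)`, and the
estimate for cross coefficients shows `f e → f` in `A_p(G)` (`exists_approximateUnit`). Hence the
norm of `f` is bounded by the multiplier norm.
-/

set_option linter.unusedSectionVars false

/-! ### Atomic norms -/

section Atomic

open scoped NNReal

variable {ι κ X : Type*}

/-- The gauge on functions `X → ℂ` generated by atoms `v i` of weight `w i`: the infimum of
`∑ w (s n)` over all pointwise expansions `f = ∑ v (s n)`, with value `∞` if there is no expansion
of finite weight. Both `A_p(G)` and `B_p(G)` are normed in this way. -/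
noncomputable def atomicNorm (w : ι → ℝ≥0) (v : ι → X → ℂ) (f : X → ℂ) : ℝ≥0∞ :=
  ⨅ (s : ℕ → ι) (_ : ∀ x, HasSum (fun n => v (s n) x) (f x)), ∑' n, (w (s n) : ℝ≥0∞)

variable {w : ι → ℝ≥0} {v : ι → X → ℂ} {f : X → ℂ}

lemma atomicNorm_le_tsum (s : ℕ → ι) (hs : ∀ x, HasSum (fun n => v (s n) x) (f x)) :
    atomicNorm w v f ≤ ∑' n, (w (s n) : ℝ≥0∞) :=
  iInf₂_le s hs

lemma exists_expansion_of_atomicNorm_lt {r : ℝ≥0∞} (h : atomicNorm w v f < r) :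
    ∃ s : ℕ → ι, (∀ x, HasSum (fun n => v (s n) x) (f x)) ∧ ∑' n, (w (s n) : ℝ≥0∞) < r := by
  simpa only [atomicNorm, iInf_lt_iff, exists_prop] using h

lemma tsum_coe_eq_ofReal_of_hasSum {a : ℕ → ℝ≥0} {r : ℝ} (h : HasSum (fun n => (a n : ℝ)) r) :
    ∑' n, (a n : ℝ≥0∞) = ENNReal.ofReal r := by
  have hr : 0 ≤ r := h.nonneg fun n => (a n).2
  lift r to ℝ≥0 using hr
  rw [ENNReal.ofReal_coe_nnreal, ← (NNReal.hasSum_coe.1 h).tsum_eq,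
    ENNReal.coe_tsum (NNReal.hasSum_coe.1 h).summable]

lemma hasSum_toReal_tsum_coe {a : ℕ → ℝ≥0} (h : ∑' n, (a n : ℝ≥0∞) ≠ ∞) :
    HasSum (fun n => (a n : ℝ)) (∑' n, (a n : ℝ≥0∞)).toReal := by
  have hs : Summable a := ENNReal.tsum_coe_ne_top_iff_summable.1 h
  rw [← ENNReal.coe_tsum hs, ENNReal.coe_toReal]
  exact NNReal.hasSum_coe.2 hs.hasSum

lemma exists_hasSum_expansion_iff :
    (∃ (s : ℕ → ι) (r : ℝ), HasSum (fun n => (w (s n) : ℝ)) r ∧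
      ∀ x, HasSum (fun n => v (s n) x) (f x)) ↔ atomicNorm w v f ≠ ∞ := by
  constructor
  · rintro ⟨s, r, hr, hs⟩
    refine ((atomicNorm_le_tsum s hs).trans_lt ?_).ne
    rw [tsum_coe_eq_ofReal_of_hasSum hr]
    exact ENNReal.ofReal_lt_top
  · intro h
    obtain ⟨s, hs, hlt⟩ := exists_expansion_of_atomicNorm_lt (lt_top_iff_ne_top.2 h)
    exact ⟨s, _, hasSum_toReal_tsum_coe hlt.ne, hs⟩

/-- Both sides are `0` when there is no expansion of finite weight. -/
lemma sInf_expansion_eq_toReal_atomicNorm :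
    sInf {r : ℝ | ∃ s : ℕ → ι, HasSum (fun n => (w (s n) : ℝ)) r ∧
      ∀ x, HasSum (fun n => v (s n) x) (f x)} = (atomicNorm w v f).toReal := by
  set S := {r : ℝ | ∃ s : ℕ → ι, HasSum (fun n => (w (s n) : ℝ)) r ∧
      ∀ x, HasSum (fun n => v (s n) x) (f x)} with hS
  have hbdd : BddBelow S := ⟨0, fun r hr => by
    obtain ⟨s, hr, -⟩ := hr
    exact hr.nonneg fun n => (w (s n)).2⟩
  by_cases h : atomicNorm w v f = ∞
  · have : S = ∅ := by
      by_contra hne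
      obtain ⟨r, s, hr⟩ := Set.nonempty_iff_ne_empty.2 hne
      exact exists_hasSum_expansion_iff.1 ⟨s, r, hr⟩ h
    rw [this, h, Real.sInf_empty, ENNReal.toReal_top]
  · apply le_antisymm
    · refine le_of_forall_gt fun r hr => ?_
      have h1 : atomicNorm w v f < ENNReal.ofReal r := by
        rwa [ENNReal.lt_ofReal_iff_toReal_lt h]
      obtain ⟨s, hs, hlt⟩ := exists_expansion_of_atomicNorm_lt h1
      refine (csInf_le hbdd ⟨s, hasSum_toReal_tsum_coe (hlt.trans ENNReal.ofReal_lt_top).ne,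
        hs⟩).trans_lt ?_
      rwa [← ENNReal.lt_ofReal_iff_toReal_lt (hlt.trans ENNReal.ofReal_lt_top).ne]
    · obtain ⟨s, r, hr⟩ := exists_hasSum_expansion_iff.2 h
      refine le_csInf ⟨r, s, hr⟩ ?_
      rintro r ⟨s, hr, hs⟩
      refine ENNReal.toReal_le_of_le_ofReal (hr.nonneg fun n => (w (s n)).2) ?_
      rw [← tsum_coe_eq_ofReal_of_hasSum hr]
      exact atomicNorm_le_tsum s hs

lemma enorm_le_atomicNorm (hv : ∀ i x, ‖v i x‖₊ ≤ w i) (f : X → ℂ) (x : X) :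
    ‖f x‖ₑ ≤ atomicNorm w v f := by
  refine le_iInf₂ fun s hs => ?_
  rw [← (hs x).tsum_eq]
  exact enorm_tsum_le_tsum_enorm.trans
    (ENNReal.tsum_le_tsum fun n => ENNReal.coe_le_coe.2 (hv _ _))

/-- Countable subadditivity of the atomic norm. -/
lemma atomicNorm_le_tsum_atomicNorm (hv : ∀ i x, ‖v i x‖₊ ≤ w i) {g : ℕ → X → ℂ}
    (hg : ∀ x, HasSum (fun n => g n x) (f x)) :
    atomicNorm w v f ≤ ∑' n, atomicNorm w v (g n) := by
  by_cases htop : ∑' n, atomicNorm w v (g n) = ∞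
  · exact htop ▸ le_top
  refine ENNReal.le_of_forall_pos_le_add fun ε hε _ => ?_
  obtain ⟨δ, hδ, hδsum⟩ := ENNReal.exists_pos_sum_of_countable (ENNReal.coe_pos.2 hε).ne' ℕ
  have hne : ∀ n, atomicNorm w v (g n) ≠ ∞ := fun n => ENNReal.ne_top_of_tsum_ne_top htop n
  have hex : ∀ n, ∃ s : ℕ → ι, (∀ x, HasSum (fun m => v (s m) x) (g n x)) ∧
      ∑' m, (w (s m) : ℝ≥0∞) < atomicNorm w v (g n) + δ n := fun n =>
    exists_expansion_of_atomicNorm_lt (ENNReal.lt_add_right (hne n)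
      (ENNReal.coe_pos.2 (hδ n)).ne')
  choose s hs hlt using hex
  have hle : ∑' n, ∑' m, (w (s n m) : ℝ≥0∞) ≤ ∑' n, atomicNorm w v (g n) + ε := by
    calc ∑' n, ∑' m, (w (s n m) : ℝ≥0∞) ≤ ∑' n, (atomicNorm w v (g n) + δ n) :=
          ENNReal.tsum_le_tsum fun n => (hlt n).le
      _ ≤ ∑' n, atomicNorm w v (g n) + ε := by
          rw [ENNReal.tsum_add]
          exact add_le_add_right hδsum.le _
  have hprod : ∑' q : ℕ × ℕ, (w (s q.1 q.2) : ℝ≥0∞) = ∑' n, ∑' m, (w (s n m) : ℝ≥0∞) :=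
    ENNReal.tsum_prod (f := fun n m => (w (s n m) : ℝ≥0∞))
  have hsw : Summable fun q : ℕ × ℕ => w (s q.1 q.2) := by
    refine ENNReal.tsum_coe_ne_top_iff_summable.1 ?_
    rw [hprod]
    exact (hle.trans_lt (ENNReal.add_lt_top.2 ⟨lt_top_iff_ne_top.2 htop,
      ENNReal.coe_lt_top⟩)).ne
  have hsum : ∀ x, HasSum (fun q : ℕ × ℕ => v (s q.1 q.2) x) (f x) := fun x => by
    have h1 : Summable fun q : ℕ × ℕ => v (s q.1 q.2) x :=
      Summable.of_nnnorm_bounded hsw fun q => hv _ _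
    have h2 := h1.hasSum.prod_fiberwise fun n => hs n x
    rw [(hg x).unique h2]
    exact h1.hasSum
  refine le_trans ?_ (hprod.trans_le hle)
  rw [← Nat.pairEquiv.symm.tsum_eq fun q : ℕ × ℕ => (w (s q.1 q.2) : ℝ≥0∞)]
  exact atomicNorm_le_tsum (fun n => s (Nat.pairEquiv.symm n).1 (Nat.pairEquiv.symm n).2)
    fun x => (Nat.pairEquiv.symm.hasSum_iff (f := fun q : ℕ × ℕ => v (s q.1 q.2) x)).2 (hsum x)

/-- The system of atoms contains an atom `0` of weight `0`, so that finite expansions are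
expansions. -/
def HasZeroAtom (w : ι → ℝ≥0) (v : ι → X → ℂ) : Prop :=
  ∃ i, w i = 0 ∧ v i = 0

lemma atomicNorm_atom_le (h0 : HasZeroAtom w v) (i : ι) : atomicNorm w v (v i) ≤ w i := by
  obtain ⟨j, hwj, hvj⟩ := h0
  refine (atomicNorm_le_tsum (fun n => if n = 0 then i else j) fun x => ?_).trans_eq ?_
  · convert! hasSum_ite_eq (0 : ℕ) (v i x) using 2 with n
    split_ifs <;> simp [hvj]
  · rw [tsum_eq_single 0]
    · simp
    · intro n hn
      simp [hn, hwj]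

lemma atomicNorm_zero (h0 : HasZeroAtom w v) : atomicNorm w v 0 = 0 := by
  obtain ⟨j, hwj, hvj⟩ := id h0
  simpa [hwj, hvj] using atomicNorm_atom_le h0 j

lemma atomicNorm_add_le (hv : ∀ i x, ‖v i x‖₊ ≤ w i) (h0 : HasZeroAtom w v) (f g : X → ℂ) :
    atomicNorm w v (f + g) ≤ atomicNorm w v f + atomicNorm w v g := by
  let s : ℕ → X → ℂ := fun n => if n = 0 then f else if n = 1 then g else 0
  have hs : ∀ n ∉ Finset.range 2, s n = 0 := fun n hn => by
    simp only [Finset.mem_range, not_lt] at hn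
    simp only [s]
    rw [if_neg (by omega), if_neg (by omega)]
  refine (atomicNorm_le_tsum_atomicNorm hv (g := s) fun x => ?_).trans_eq ?_
  · have h := hasSum_sum_of_ne_finset_zero (L := .unconditional ℕ) (s := Finset.range 2)
      (f := fun n => s n x) fun n hn => by simp [hs n hn]
    simpa [Finset.sum_range_succ, s] using h
  · rw [tsum_eq_sum (s := Finset.range 2)]
    · simp [Finset.sum_range_succ, s]
    · intro n hn
      rw [hs n hn, atomicNorm_zero h0]

lemma atomicNorm_sum_le (hv : ∀ i x, ‖v i x‖₊ ≤ w i) (h0 : HasZeroAtom w v)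
    (t : Finset κ) (g : κ → X → ℂ) :
    atomicNorm w v (∑ k ∈ t, g k) ≤ ∑ k ∈ t, atomicNorm w v (g k) :=
  Finset.le_sum_of_subadditive _ (atomicNorm_zero h0).le (atomicNorm_add_le hv h0) t g

/-- An additive map into functions which is bounded by `c` pointwise, and in atomic norm on a dense
subgroup, is bounded by `c` in atomic norm everywhere: an element is the sum of a
series from the subgroup whose norms add up to at most `‖a‖ + ε`. -/
lemma atomicNorm_le_of_dense (hv : ∀ i x, ‖v i x‖₊ ≤ w i) {V : Type*} [NormedAddCommGroup V]
    (D : AddSubgroup V) (hD : Dense (D : Set V)) (B : V → X → ℂ)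
    (hadd : ∀ a b x, B (a + b) x = B a x + B b x) {c : ℝ≥0}
    (hB : ∀ a x, ‖B a x‖ₑ ≤ c * ‖a‖ₑ) (hc : ∀ d ∈ D, atomicNorm w v (B d) ≤ c * ‖d‖ₑ) (a : V) :
    atomicNorm w v (B a) ≤ c * ‖a‖ₑ := by
  suffices H : ∀ ε : ℝ≥0, 0 < ε → atomicNorm w v (B a) ≤ c * (‖a‖ₑ + ε) by
    have h1 : ∀ᶠ ε : ℝ≥0 in nhdsWithin 0 (Set.Ioi 0),
        atomicNorm w v (B a) ≤ c * (‖a‖ₑ + ε) :=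
      Filter.eventually_of_mem self_mem_nhdsWithin H
    refine ge_of_tendsto (f := fun ε : ℝ≥0 => (c : ℝ≥0∞) * (‖a‖ₑ + ε)) ?_ h1
    have h2 : Continuous fun ε : ℝ≥0 => (c : ℝ≥0∞) * (‖a‖ₑ + ε) :=
      (ENNReal.continuous_const_mul ENNReal.coe_ne_top).comp
        (continuous_const.add ENNReal.continuous_coe)
    simpa using (h2.tendsto 0).mono_left nhdsWithin_le_nhds
  intro ε hε
  have hbpos : ∀ n : ℕ, 0 < (ε : ℝ) / 2 / 2 ^ (n + 1) := fun n => by positivity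
  obtain ⟨s, hs, hsD, hs0, hsn⟩ := controlled_sum_of_mem_closure (a := a) (s := D)
    (hD a) hbpos
  have hsum_enn : ∑' n, ‖s n‖ₑ ≤ ‖a‖ₑ + ε := by
    have h1 : ∀ n, ‖s n‖ₑ ≤ (if n = 0 then ‖a‖ₑ else 0) +
        ENNReal.ofReal ((ε : ℝ) / 2 / 2 ^ n) := fun n => by
      rcases Nat.eq_zero_or_pos n with rfl | hn
      · rw [if_pos rfl]
        calc ‖s 0‖ₑ = ‖a + (-a + s 0)‖ₑ := by rw [add_neg_cancel_left]
          _ ≤ ‖a‖ₑ + ‖-a + s 0‖ₑ := enorm_add_le _ _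
          _ ≤ _ := by
            gcongr
            rw [← ofReal_norm]
            rw [← norm_neg, neg_add, neg_neg, add_comm] at hs0
            refine ENNReal.ofReal_le_ofReal (hs0.le.trans ?_)
            gcongr <;> norm_num
      · rw [if_neg hn.ne', zero_add, ← ofReal_norm]
        refine ENNReal.ofReal_le_ofReal ((hsn n hn).le.trans ?_)
        gcongr
        · norm_num
        · omega
    refine (ENNReal.tsum_le_tsum h1).trans ?_
    rw [ENNReal.tsum_add, tsum_ite_eq, ← ENNReal.ofReal_tsum_of_nonneg (fun n => by positivity)
      (summable_geometric_two' (ε : ℝ)), tsum_geometric_two', ENNReal.ofReal_coe_nnreal]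
  have hsumm : ∀ x, HasSum (fun n => B (s n) x) (B a x) := fun x => by
    let Bx : V →+ ℂ := AddMonoidHom.mk' (fun a => B a x) fun a b => hadd a b x
    have h1 : Summable fun n => B (s n) x := by
      refine Summable.of_enorm ((ENNReal.tsum_le_tsum fun n =>
        (enorm_le_atomicNorm hv _ x).trans (hc _ (hsD n))).trans_lt ?_).ne
      rw [ENNReal.tsum_mul_left]
      exact ENNReal.mul_lt_top ENNReal.coe_lt_top
        (hsum_enn.trans_lt (ENNReal.add_lt_top.2 ⟨enorm_lt_top, ENNReal.coe_lt_top⟩))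
    have h2 : Filter.Tendsto (fun n => ∑ i ∈ Finset.range (n + 1), B (s i) x) Filter.atTop
        (nhds (B a x)) := by
      have hcont : Continuous Bx := AddMonoidHomClass.continuous_of_bound Bx c fun a => by
        rw [← ENNReal.ofReal_le_ofReal_iff (by positivity), ofReal_norm,
          ENNReal.ofReal_mul (NNReal.coe_nonneg c), ofReal_norm,
          ENNReal.ofReal_coe_nnreal]
        exact hB a x
      have := (hcont.tendsto a).comp hs
      refine this.congr fun n => ?_
      exact map_sum Bx s _
    have h3 := (Filter.tendsto_add_atTop_iff_nat 1).2 h1.hasSum.tendsto_sum_nat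
    rw [tendsto_nhds_unique h2 h3]
    exact h1.hasSum
  calc atomicNorm w v (B a) ≤ ∑' n, atomicNorm w v (B (s n)) :=
        atomicNorm_le_tsum_atomicNorm hv hsumm
    _ ≤ ∑' n, c * ‖s n‖ₑ := ENNReal.tsum_le_tsum fun n => hc _ (hsD n)
    _ = c * ∑' n, ‖s n‖ₑ := ENNReal.tsum_mul_left
    _ ≤ c * (‖a‖ₑ + ε) := by gcongr

/-- Products of absolutely convergent expansions are estimated by the products of their atoms. -/
lemma atomicNorm_mul_le {κ : Type*} {w' : κ → ℝ≥0} {v' : κ → X → ℂ} {g : X → ℂ}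
    (hv : ∀ i x, ‖v i x‖₊ ≤ w i)
    (hmul : ∀ i j, atomicNorm w v (v i * v' j) ≤ w i * w' j)
    (hf : atomicNorm w v f ≠ ∞) (hg : atomicNorm w' v' g ≠ ∞) :
    atomicNorm w v (f * g) ≤ atomicNorm w v f * atomicNorm w' v' g := by
  refine ENNReal.le_mul_of_forall_lt (Or.inr hg) (Or.inl hf) fun a ha b hb => ?_
  obtain ⟨s, hs, hsw⟩ := exists_expansion_of_atomicNorm_lt ha
  obtain ⟨t, ht, htw⟩ := exists_expansion_of_atomicNorm_lt hb
  have hS : Summable fun n => w (s n) :=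
    ENNReal.tsum_coe_ne_top_iff_summable.1 (hsw.trans_le le_top).ne
  have hT : Summable fun n => w' (t n) :=
    ENNReal.tsum_coe_ne_top_iff_summable.1 (htw.trans_le le_top).ne
  have h1 : atomicNorm w v (f * g) ≤ ∑' n, atomicNorm w v (v (s n) * g) :=
    atomicNorm_le_tsum_atomicNorm hv fun x => (hs x).mul_right (g x)
  have h2 : ∀ n, atomicNorm w v (v (s n) * g) ≤ ∑' m, atomicNorm w v (v (s n) * v' (t m)) :=
    fun n => atomicNorm_le_tsum_atomicNorm hv fun x => (ht x).mul_left (v (s n) x)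
  calc atomicNorm w v (f * g) ≤ ∑' n, ∑' m, (w (s n) : ℝ≥0∞) * w' (t m) :=
        h1.trans <| ENNReal.tsum_le_tsum fun n => (h2 n).trans <|
          ENNReal.tsum_le_tsum fun m => hmul _ _
    _ = (∑' n, (w (s n) : ℝ≥0∞)) * ∑' m, (w' (t m) : ℝ≥0∞) := by
        simp_rw [ENNReal.tsum_mul_left, ENNReal.tsum_mul_right]
    _ ≤ a * b := by gcongr

end Atomic

/-! ### The norm of `A_p(G)` -/

section Ap

open scoped NNReal

variable {G : Type u} [Group G] [MeasurableSpace G] {p p' : ℝ≥0∞}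

/-- The weight `‖ξ‖ ‖φ‖` of an atom of `A_p(G)`. -/
noncomputable def apWeight (μ : Measure G) [Fact (1 ≤ p)] [Fact (1 ≤ p')]
    (i : Lp ℂ p' μ × Lp ℂ p μ) : ℝ≥0 :=
  ‖i.1‖₊ * ‖i.2‖₊

/-- The atom `x ↦ ⟨λ(x) ξ, φ⟩` of `A_p(G)`. -/
noncomputable def apAtom (μ : Measure G) (i : Lp ℂ p' μ × Lp ℂ p μ) (x : G) : ℂ :=
  ∫ y, i.1 (x⁻¹ * y) * i.2 y ∂μ

/-- The norm of `A_p(G)` with values in `[0, ∞]`; it is finite exactly on `A_p(G)`. -/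
noncomputable def apENorm (p p' : ℝ≥0∞) [Fact (1 ≤ p)] [Fact (1 ≤ p')] (μ : Measure G) :
    (G → ℂ) → ℝ≥0∞ :=
  atomicNorm (apWeight (p := p) (p' := p') μ) (apAtom μ)

variable [Fact (1 ≤ p)] [Fact (1 ≤ p')] (μ : Measure G)

lemma mem_ApSpace_iff {f : G → ℂ} : f ∈ ApSpace p p' μ ↔ apENorm p p' μ f ≠ ∞ := by
  rw [apENorm, ← exists_hasSum_expansion_iff]
  constructor
  · rintro ⟨ξ, φ, r, hr, hs⟩
    exact ⟨fun n => (ξ n, φ n), r, hr, hs⟩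
  · rintro ⟨s, r, hr, hs⟩
    exact ⟨fun n => (s n).1, fun n => (s n).2, r, hr, hs⟩

lemma ApNorm_eq (f : G → ℂ) : ApNorm p p' μ f = (apENorm p p' μ f).toReal := by
  rw [apENorm, ← sInf_expansion_eq_toReal_atomicNorm, ApNorm]
  congr 1
  ext r
  constructor
  · rintro ⟨ξ, φ, hr, hs⟩
    exact ⟨fun n => (ξ n, φ n), hr, hs⟩
  · rintro ⟨s, hr, hs⟩
    exact ⟨fun n => (s n).1, fun n => (s n).2, hr, hs⟩

lemma hasZeroAtom_apAtom : HasZeroAtom (apWeight (p := p) (p' := p') μ) (apAtom μ) := by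
  refine ⟨(0, 0), by simp [apWeight], ?_⟩
  ext x
  refine integral_eq_zero_of_ae ?_
  filter_upwards [Lp.coeFn_zero ℂ p μ] with y hy
  exact mul_eq_zero_of_right _ hy

variable [MeasurableMul G] [μ.IsMulLeftInvariant] [p.HolderConjugate p']

lemma enorm_integral_translate_mul_le {f g : G → ℂ} (hf : MemLp f p' μ) (hg : MemLp g p μ)
    (x : G) : ‖∫ y, f (x⁻¹ * y) * g y ∂μ‖ₑ ≤ eLpNorm f p' μ * eLpNorm g p μ := by
  have hx := measurePreserving_mul_left μ x⁻¹
  have h1 : eLpNorm (fun y => f (x⁻¹ * y)) p' μ = eLpNorm f p' μ :=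
    eLpNorm_comp_measurePreserving hf.1 hx
  have h2 := eLpNorm_smul_le_mul_eLpNorm (p := p') (q := p) (r := 1) hg.1
    (φ := fun y => f (x⁻¹ * y)) (hf.1.comp_measurePreserving hx)
  rw [h1, eLpNorm_one_eq_lintegral_enorm] at h2
  exact (enorm_integral_le_lintegral_enorm _).trans h2

lemma nnnorm_apAtom_le (i : Lp ℂ p' μ × Lp ℂ p μ) (x : G) : ‖apAtom μ i x‖₊ ≤ apWeight μ i := by
  have h := enorm_integral_translate_mul_le μ (Lp.memLp i.1) (Lp.memLp i.2) x
  rw [← Lp.enorm_def, ← Lp.enorm_def] at h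
  rw [← ENNReal.coe_le_coe, apWeight, ENNReal.coe_mul]
  exact h

lemma apENorm_integral_translate_mul_le {f g : G → ℂ} (hf : MemLp f p' μ) (hg : MemLp g p μ) :
    apENorm p p' μ (fun x => ∫ y, f (x⁻¹ * y) * g y ∂μ) ≤ eLpNorm f p' μ * eLpNorm g p μ := by
  have h := atomicNorm_atom_le (hasZeroAtom_apAtom (p := p) (p' := p') μ)
    (hf.toLp f, hg.toLp g)
  have h1 : apAtom μ (hf.toLp f, hg.toLp g) = fun x => ∫ y, f (x⁻¹ * y) * g y ∂μ := by
    ext x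
    refine integral_congr_ae ?_
    filter_upwards [(measurePreserving_mul_left μ x⁻¹).quasiMeasurePreserving.ae hf.coeFn_toLp,
      hg.coeFn_toLp] with y hy1 hy2
    simp only [hy1, hy2]
  rw [h1] at h
  refine h.trans_eq ?_
  rw [apWeight, ENNReal.coe_mul, ← enorm_eq_nnnorm, ← enorm_eq_nnnorm, Lp.enorm_toLp,
    Lp.enorm_toLp]

variable {μ}

lemma apENorm_add_le (f g : G → ℂ) :
    apENorm p p' μ (f + g) ≤ apENorm p p' μ f + apENorm p p' μ g :=
  atomicNorm_add_le (nnnorm_apAtom_le μ) (hasZeroAtom_apAtom μ) f g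

lemma apENorm_sum_le {κ : Type*} (t : Finset κ) (g : κ → G → ℂ) :
    apENorm p p' μ (∑ k ∈ t, g k) ≤ ∑ k ∈ t, apENorm p p' μ (g k) :=
  atomicNorm_sum_le (nnnorm_apAtom_le μ) (hasZeroAtom_apAtom μ) t g

/-- Hölder's inequality for sums of atoms of `A_p(G)`: the case of `E = ℓ_{p'}(κ)` of the estimate
for coefficients of `L_{p'}(G, E)`. -/
lemma apENorm_sum_integral_le {κ : Type*} [Fintype κ] (hp : 1 < p) (hp_top : p < ∞)
    {F Φ : κ → G → ℂ} (hF : ∀ k, MemLp (F k) p' μ) (hΦ : ∀ k, MemLp (Φ k) p μ) :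
    apENorm p p' μ (fun x => ∑ k, ∫ y, F k (x⁻¹ * y) * Φ k y ∂μ) ≤
      (∫⁻ y, ∑ k, ‖F k y‖ₑ ^ p'.toReal ∂μ) ^ (1 / p'.toReal) *
        (∫⁻ y, ∑ k, ‖Φ k y‖ₑ ^ p.toReal ∂μ) ^ (1 / p.toReal) := by
  have hp1 : 1 < p.toReal := by
    rw [← ENNReal.toReal_one]
    exact (ENNReal.toReal_lt_toReal ENNReal.one_ne_top hp_top.ne).2 hp
  have hconj : p.toReal.HolderConjugate p'.toReal := ENNReal.HolderConjugate.toReal hp1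
  have hp'0 : p' ≠ 0 := fun h => hconj.symm.pos.ne' (by simp [h])
  have hp't : p' ≠ ∞ := fun h => hconj.symm.pos.ne' (by simp [h])
  have hp0 : p ≠ 0 := (zero_lt_one.trans hp).ne'
  have hrw : ∀ {r : ℝ≥0∞} (_ : 0 < r.toReal) (_ : r ≠ 0) (_ : r ≠ ∞) {H : κ → G → ℂ}
      (_ : ∀ k, MemLp (H k) r μ), ∑ k, eLpNorm (H k) r μ ^ r.toReal =
        ∫⁻ y, ∑ k, ‖H k y‖ₑ ^ r.toReal ∂μ := by
    intro r hr hr0 hrt H hH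
    rw [lintegral_finsetSum' _ fun k _ => (hH k).1.enorm.pow_const _]
    refine Finset.sum_congr rfl fun k _ => ?_
    rw [eLpNorm_eq_lintegral_rpow_enorm_toReal hr0 hrt, ← ENNReal.rpow_mul,
      one_div_mul_cancel hr.ne', ENNReal.rpow_one]
  have h0 : (fun x => ∑ k, ∫ y, F k (x⁻¹ * y) * Φ k y ∂μ) =
      ∑ k, fun x => ∫ y, F k (x⁻¹ * y) * Φ k y ∂μ := by
    ext x
    simp
  rw [h0]
  calc _ ≤ ∑ k, eLpNorm (F k) p' μ * eLpNorm (Φ k) p μ :=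
        (apENorm_sum_le _ _).trans
          (Finset.sum_le_sum fun k _ => apENorm_integral_translate_mul_le μ (hF k) (hΦ k))
    _ ≤ _ := by
        refine (ENNReal.inner_le_Lp_mul_Lq _ _ _ hconj.symm).trans_eq ?_
        rw [hrw hconj.symm.pos hp'0 hp't hF, hrw hconj.pos hp0 hp_top.ne hΦ]

end Ap

/-! ### Finite-dimensional approximation of `QSL`-spaces -/

section Approximable

open scoped NNReal

/-- Duality of `ℓ_p` and `ℓ_q`: if `c ↦ ∑ c k • s k` is contractive on `ℓ_q(κ)`, then the
coefficients `φ (s k)` of a functional `φ` have `ℓ_p`-norm at most `‖φ‖`. -/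
lemma sum_enorm_apply_rpow_le {κ E : Type*} [Fintype κ] [NormedAddCommGroup E] [NormedSpace ℂ E]
    {p q : ℝ} (hpq : p.HolderConjugate q) (s : κ → E)
    (hs : ∀ c : κ → ℂ, ‖∑ k, c k • s k‖ₑ ^ q ≤ ∑ k, ‖c k‖ₑ ^ q) (φ : StrongDual ℂ E) :
    ∑ k, ‖φ (s k)‖ₑ ^ p ≤ ‖φ‖ₑ ^ p := by
  obtain ⟨g, hg, hgf⟩ := (NNReal.isGreatest_Lp Finset.univ (fun k => ‖φ (s k)‖₊) hpq).1
  simp only [Set.mem_ofPred_eq] at hg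
  let c : κ → ℂ := fun k => g k * ((starRingEnd ℂ) (φ (s k)) / ‖φ (s k)‖)
  have hc : ∀ k, ‖c k‖ₑ ≤ g k := fun k => by
    rw [← ofReal_norm, ← ENNReal.ofReal_coe_nnreal]
    refine ENNReal.ofReal_le_ofReal ?_
    simp only [c, norm_mul, norm_div, RCLike.norm_conj, Complex.norm_real, norm_norm]
    rw [Real.norm_of_nonneg (NNReal.coe_nonneg _)]
    exact mul_le_of_le_one_right (g k).2 (div_self_le_one _)
  have hφ : ∀ k, c k * φ (s k) = ((‖φ (s k)‖₊ * g k : ℝ≥0) : ℝ) := fun k => by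
    simp only [c]
    by_cases h : φ (s k) = 0
    · simp [h]
    · have h' : (‖φ (s k)‖ : ℂ) ≠ 0 := by simpa using h
      rw [mul_assoc, div_mul_eq_mul_div, Complex.conj_mul']
      push_cast
      field_simp
  have hsum : φ (∑ k, c k • s k) = (((∑ k, ‖φ (s k)‖₊ ^ p) ^ (1 / p) : ℝ≥0) : ℝ) := by
    rw [← hgf, map_sum]
    simp only [map_smul, smul_eq_mul, hφ]
    push_cast
    rfl
  have hle1 : ‖∑ k, c k • s k‖ₑ ≤ 1 := by
    have h1 : ‖∑ k, c k • s k‖ₑ ^ q ≤ 1 := by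
      refine (hs c).trans ?_
      calc ∑ k, ‖c k‖ₑ ^ q ≤ ∑ k, (g k : ℝ≥0∞) ^ q :=
            Finset.sum_le_sum fun k _ => ENNReal.rpow_le_rpow (hc k) hpq.symm.nonneg
        _ = ((∑ k, g k ^ q : ℝ≥0) : ℝ≥0∞) := by
            push_cast
            exact Finset.sum_congr rfl fun k _ =>
              (ENNReal.coe_rpow_of_nonneg _ hpq.symm.nonneg).symm
        _ ≤ 1 := by exact_mod_cast hg
    have h2 := ENNReal.rpow_le_rpow h1 (z := 1 / q) hpq.symm.one_div_nonneg
    rwa [← ENNReal.rpow_mul, mul_one_div_cancel hpq.symm.ne_zero, ENNReal.rpow_one,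
      ENNReal.one_rpow] at h2
  have hle : (((∑ k, ‖φ (s k)‖₊ ^ p) ^ (1 / p) : ℝ≥0) : ℝ≥0∞) ≤ ‖φ‖ₑ := by
    have h1 := φ.le_opENorm (∑ k, c k • s k)
    rw [hsum] at h1
    refine le_trans (le_of_eq ?_) (h1.trans (mul_le_of_le_one_right' hle1))
    rw [enorm_eq_nnnorm]
    congr 1
    ext
    rw [coe_nnnorm, Complex.norm_real, Real.norm_of_nonneg (NNReal.coe_nonneg _)]
  have h3 := ENNReal.rpow_le_rpow hle hpq.nonneg
  refine le_trans (le_of_eq ?_) h3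
  rw [← ENNReal.coe_rpow_of_nonneg _ hpq.nonneg, ← NNReal.rpow_mul,
    one_div_mul_cancel hpq.ne_zero, NNReal.rpow_one]
  push_cast
  exact Finset.sum_congr rfl fun k _ => (ENNReal.coe_rpow_of_nonneg _ hpq.nonneg).symm

/-- Finitely many elements of `L_q(X)` are approximated, with arbitrarily small relative error, by
step functions over one common finite family of disjoint sets; the normalized indicators `s k` of
these sets span an isometric copy of `ℓ_q(κ)`. -/
lemma exists_step_approx {X : Type*} [MeasurableSpace X] {ν : Measure X} {q : ℝ≥0∞}
    [Fact (1 ≤ q)] (hq : q ≠ ∞) (t : Finset (Lp ℂ q ν)) {δ : ℝ} (hδ : 0 < δ) :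
    ∃ (n : ℕ) (s : Fin n → Lp ℂ q ν) (c : Lp ℂ q ν → Fin n → ℂ),
      (∀ b : Fin n → ℂ, ‖∑ k, b k • s k‖ₑ ^ q.toReal = ∑ k, ‖b k‖ₑ ^ q.toReal) ∧
      ∀ e ∈ t, ‖∑ k, c e k • s k - e‖ ≤ δ * ‖e‖ := by
  have hq0 : q ≠ 0 := (zero_lt_one.trans_le Fact.out).ne'
  have hqr : 0 < q.toReal := ENNReal.toReal_pos hq0 hq
  have hex : ∀ e : Lp ℂ q ν, ∃ (g : SimpleFunc X ℂ) (hg : MemLp g q ν),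
      ‖hg.toLp g - e‖ ≤ δ * ‖e‖ := by
    intro e
    rcases eq_or_ne e 0 with rfl | he
    · refine ⟨0, MemLp.zero, ?_⟩
      have : (MemLp.zero : MemLp (0 : X → ℂ) q ν).toLp (0 : X → ℂ) = 0 := MemLp.toLp_zero _
      simp [this]
    · obtain ⟨g, hg, hge⟩ := Metric.mem_closure_iff.1 (Lp.simpleFunc.dense hq e) (δ * ‖e‖)
        (mul_pos hδ (norm_pos_iff.2 he))
      refine ⟨Lp.simpleFunc.toSimpleFunc ⟨g, hg⟩, Lp.simpleFunc.memLp ⟨g, hg⟩, ?_⟩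
      have h1 : (Lp.simpleFunc.memLp ⟨g, hg⟩).toLp (Lp.simpleFunc.toSimpleFunc ⟨g, hg⟩) = g :=
        congrArg Subtype.val (Lp.simpleFunc.toLp_toSimpleFunc ⟨g, hg⟩)
      rw [h1, ← dist_eq_norm, dist_comm]
      exact hge.le
  choose g hg hge using hex
  let h : X → t → ℂ := fun x e => g e x
  have hh : Measurable h := measurable_pi_iff.2 fun e => (g e).measurable
  have hfin : (Set.range h).Finite := by
    refine (Set.Finite.pi (t := fun e : t => Set.range (g e)) fun e => (g e).finite_range).subset ?_
    rintro _ ⟨x, rfl⟩ e -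
    exact ⟨x, rfl⟩
  let C : (t → ℂ) → Set X := fun v => h ⁻¹' {v}
  have hC : ∀ v, MeasurableSet (C v) := fun v => hh (measurableSet_singleton v)
  have hCfin : ∀ v, v ≠ 0 → ν (C v) ≠ ∞ := fun v hv => by
    obtain ⟨e, he⟩ := Function.ne_iff.1 hv
    refine ((measure_mono ?_).trans_lt ((SimpleFunc.memLp_iff hq0 hq).1 (hg e) (v e) he)).ne
    intro x (hx : h x = v)
    exact congrFun hx e
  classical
  let T : Finset (t → ℂ) := hfin.toFinset.filter fun v => v ≠ 0 ∧ ν (C v) ≠ 0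
  have hT0 : ∀ v : T, (v : t → ℂ) ≠ 0 := fun v => (Finset.mem_filter.1 v.2).2.1
  have hTν : ∀ v : T, ν (C v) ≠ 0 := fun v => (Finset.mem_filter.1 v.2).2.2
  let r : T → ℝ := fun v => (ν (C v)).toReal ^ (-(1 / q.toReal))
  have hν : ∀ v : T, 0 < (ν (C v)).toReal := fun v =>
    ENNReal.toReal_pos (hTν v) (hCfin _ (hT0 v))
  have hr : ∀ v, 0 < r v := fun v => Real.rpow_pos_of_pos (hν v) _
  have hrν : ∀ v, ‖((r v : ℝ) : ℂ)‖ₑ ^ q.toReal * ν (C v) = 1 := fun v => by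
    rw [← ofReal_norm, Complex.norm_real, Real.norm_of_nonneg (hr v).le,
      ← ENNReal.ofReal_toReal (hCfin _ (hT0 v)), ENNReal.ofReal_rpow_of_pos (hr v),
      ← ENNReal.ofReal_mul (Real.rpow_nonneg (hr v).le _), ← Real.rpow_mul (hν v).le,
      neg_mul, one_div_mul_cancel hqr.ne', Real.rpow_neg_one, inv_mul_cancel₀ (hν v).ne',
      ENNReal.ofReal_one]
  let s : T → Lp ℂ q ν := fun v => indicatorConstLp q (hC v) (hCfin _ (hT0 v)) ((r v : ℝ) : ℂ)
  -- The value of a combination of the `s v` at a point of `C v`, and outside all `C v`.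
  have hval : ∀ b : T → ℂ, (∑ v, b v • s v : Lp ℂ q ν) =ᵐ[ν]
      fun x => ∑ v : T, (C v).indicator (fun _ => b v * (r v : ℂ)) x := by
    intro b
    have h1 : (∑ v, b v • s v : Lp ℂ q ν) =ᵐ[ν] ∑ v, (b v • s v : Lp ℂ q ν) :=
      Lp.coeFn_finsetSum _ _
    have h2 : ∀ᵐ x ∂ν, ∀ v : T, (b v • s v : Lp ℂ q ν) x =
        (C v).indicator (fun _ => b v * (r v : ℂ)) x := by
      refine ae_all_iff.2 fun v => ?_
      filter_upwards [Lp.coeFn_smul (b v) (s v), indicatorConstLp_coeFn (p := q) (hs := hC v)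
        (hμs := hCfin _ (hT0 v)) (c := ((r v : ℝ) : ℂ))] with x hx1 hx2
      rw [hx1, Pi.smul_apply, hx2]
      by_cases hx : x ∈ C v <;> simp [hx]
    filter_upwards [h1, h2] with x hx1 hx2
    rw [hx1, Finset.sum_apply]
    exact Finset.sum_congr rfl fun v _ => hx2 v
  have hpt : ∀ (b : T → ℂ) (x : X) (v : T), x ∈ C v →
      ∑ v : T, (C v).indicator (fun _ => b v * (r v : ℂ)) x = b v * (r v : ℂ) := by
    intro b x v hx
    rw [Finset.sum_eq_single v, Set.indicator_of_mem hx]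
    · intro w _ hw
      refine Set.indicator_of_notMem (fun hxw => hw ?_) _
      exact Subtype.ext ((show h x = w from hxw).symm.trans hx)
    · simp
  have hpt0 : ∀ (b : T → ℂ) (x : X), (∀ v : T, x ∉ C v) →
      ∑ v : T, (C v).indicator (fun _ => b v * (r v : ℂ)) x = 0 := fun b x hx =>
    Finset.sum_eq_zero fun v _ => Set.indicator_of_notMem (hx v) _
  have hnorm : ∀ b : T → ℂ, ‖∑ v, b v • s v‖ₑ ^ q.toReal = ∑ v, ‖b v‖ₑ ^ q.toReal := by
    intro b
    have hpow : ∀ x, ‖∑ v : T, (C v).indicator (fun _ => b v * (r v : ℂ)) x‖ₑ ^ q.toReal =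
        ∑ v : T, (C v).indicator (fun _ => ‖b v * (r v : ℂ)‖ₑ ^ q.toReal) x := by
      intro x
      by_cases hx : ∃ v : T, x ∈ C v
      · obtain ⟨v, hv⟩ := hx
        rw [hpt b x v hv, Finset.sum_eq_single v, Set.indicator_of_mem hv]
        · intro w _ hw
          refine Set.indicator_of_notMem (fun hxw => hw ?_) _
          exact Subtype.ext ((show h x = w from hxw).symm.trans hv)
        · simp
      · push Not at hx
        rw [hpt0 b x hx, Finset.sum_eq_zero fun v _ => Set.indicator_of_notMem (hx v) _]
        simp [hqr]
    rw [Lp.enorm_def, eLpNorm_congr_ae (hval b), eLpNorm_eq_lintegral_rpow_enorm_toReal hq0 hq,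
      ← ENNReal.rpow_mul, one_div_mul_cancel hqr.ne', ENNReal.rpow_one]
    simp_rw [hpow]
    rw [lintegral_finsetSum (μ := ν) Finset.univ
      (f := fun (v : T) x => (C v).indicator (fun _ => ‖b v * (r v : ℂ)‖ₑ ^ q.toReal) x)
      fun v _ => measurable_const.indicator (hC v)]
    refine Finset.sum_congr rfl fun v _ => ?_
    rw [lintegral_indicator_const (hC v), enorm_mul, ENNReal.mul_rpow_of_nonneg _ _ hqr.le,
      mul_assoc, hrν, mul_one]
  let c : Lp ℂ q ν → T → ℂ := fun e v => if he : e ∈ t then v.1 ⟨e, he⟩ * (r v : ℂ)⁻¹ else 0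
  have happrox : ∀ e ∈ t, ‖∑ v, c e v • s v - e‖ ≤ δ * ‖e‖ := by
    intro e he
    have h1 : ∑ v, c e v • s v = (hg e).toLp (g e) := by
      refine Lp.ext ?_
      have h2 : ∀ᵐ x ∂ν, ∀ v ∈ Set.range h, h x = v → ν (C v) ≠ 0 := by
        refine (ae_ball_iff hfin.countable).2 fun v _ => ?_
        by_cases h0 : ν (C v) = 0
        · filter_upwards [measure_eq_zero_iff_ae_notMem.1 h0] with x hx hxv
          exact absurd hxv hx
        · exact Filter.Eventually.of_forall fun _ _ => h0
      filter_upwards [hval (c e), (hg e).coeFn_toLp, h2] with x hx1 hx2 hx3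
      rw [hx1, hx2]
      have hν0 := hx3 (h x) ⟨x, rfl⟩ rfl
      by_cases hx0 : h x = 0
      · rw [hpt0]
        · exact (congrFun hx0 ⟨e, he⟩).symm
        · intro v hv
          exact hT0 v ((show h x = v from hv).symm.trans hx0)
      · have hxT : h x ∈ T := by simp [T, hx0, hν0]
        rw [hpt _ x ⟨h x, hxT⟩ rfl]
        simp only [c, he, dif_pos]
        rw [mul_assoc, inv_mul_cancel₀ (by exact_mod_cast (hr _).ne'), mul_one]
    rw [h1]
    exact hge e
  let f : Fin (Fintype.card T) ≃ T := (Fintype.equivFin T).symm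
  refine ⟨_, s ∘ f, fun e => c e ∘ f, fun b => ?_, fun e he => ?_⟩
  · have h1 := hnorm (b ∘ f.symm)
    rw [← f.sum_comp, ← f.sum_comp] at h1
    simpa using h1
  · have h1 := happrox e he
    rw [← f.sum_comp] at h1
    exact h1

end Approximable

/-! ### `QSL`-spaces -/

section QSL

open scoped NNReal

variable {p : ℝ≥0∞} [Fact (1 ≤ p)] {E : Type u} [NormedAddCommGroup E] [NormedSpace ℂ E]

/-- A space is a `QSL_p`-space as soon as it is a metric quotient of a Banach space that embeds
isometrically in some `L_p(X)`. -/
lemma isQSL_of_quotient {X : Type u} [MeasurableSpace X] {ν : Measure X} {Y : Type*}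
    [NormedAddCommGroup Y] [NormedSpace ℂ Y] [CompleteSpace Y] (J : Y →ₗᵢ[ℂ] Lp ℂ p ν)
    (Q : Y →ₗ[ℂ] E) (hQ : ∀ y, ‖Q y‖ ≤ ‖y‖)
    (hQ' : ∀ e, ∀ ε : ℝ, 0 < ε → ∃ y, Q y = e ∧ ‖y‖ ≤ ‖e‖ + ε) : IsQSL p E := by
  let M : Submodule ℂ (Lp ℂ p ν) := LinearMap.range J.toLinearMap
  let Q' : M →ₗ[ℂ] E := Q ∘ₗ J.equivRange.symm.toLinearEquiv.toLinearMap
  have hQ'app : ∀ y, Q' (J.equivRange y) = Q y := fun y => by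
    simp [Q']
  have hQ'norm : ∀ m, ‖Q' m‖ ≤ ‖m‖ := fun m =>
    (hQ _).trans_eq (J.equivRange.symm.norm_map m)
  have hsurj : Function.Surjective Q' := fun e => by
    obtain ⟨y, hy, -⟩ := hQ' e 1 one_pos
    exact ⟨J.equivRange y, (hQ'app y).trans hy⟩
  have hcont : Continuous Q' := (Q'.mkContinuous 1 fun m => by simpa using hQ'norm m).continuous
  refine ⟨X, inferInstance, ν, M, LinearMap.ker Q', ?_, ?_,
    ⟨⟨Q'.quotKerEquivOfSurjective hsurj, ?_⟩⟩⟩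
  · exact J.isometry.isClosedEmbedding.isClosed_range
  · exact isClosed_singleton.preimage hcont
  · intro x
    obtain ⟨m, rfl⟩ := Submodule.Quotient.mk_surjective _ x
    have hm : Q'.quotKerEquivOfSurjective hsurj (Submodule.Quotient.mk m) = Q' m := rfl
    rw [hm]
    refine le_antisymm (le_of_forall_pos_le_add fun ε hε => ?_)
      (le_of_forall_pos_le_add fun ε hε => ?_)
    · obtain ⟨m', hm', hlt⟩ := Submodule.Quotient.norm_mk_lt
        (Submodule.Quotient.mk (p := LinearMap.ker Q') m) hε
      have h1 : Q' m' = Q' m := by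
        have := (Submodule.Quotient.eq _).1 hm'
        rwa [LinearMap.mem_ker, map_sub, sub_eq_zero] at this
      rw [← h1]
      exact (hQ'norm m').trans hlt.le
    · obtain ⟨y, hy, hle⟩ := hQ' (Q' m) ε hε
      have h1 : Submodule.Quotient.mk (p := LinearMap.ker Q') m =
          Submodule.Quotient.mk (J.equivRange y) := by
        rw [Submodule.Quotient.eq, LinearMap.mem_ker, map_sub, hQ'app, hy, sub_self]
      rw [h1]
      exact (Submodule.Quotient.norm_mk_le _ _).trans
        ((J.equivRange.norm_map y).trans_le hle)

lemma IsQSL.exists_quotient (h : IsQSL p E) :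
    ∃ (X : Type u) (_ : MeasurableSpace X) (ν : Measure X) (M : Submodule ℂ (Lp ℂ p ν))
      (Q : M →ₗ[ℂ] E), IsClosed (M : Set (Lp ℂ p ν)) ∧ (∀ y, ‖Q y‖ ≤ ‖y‖) ∧
        ∀ e, ∀ ε : ℝ, 0 < ε → ∃ y, Q y = e ∧ ‖y‖ ≤ ‖e‖ + ε := by
  obtain ⟨X, _, ν, M, N, hM, -, ⟨T⟩⟩ := h
  refine ⟨X, _, ν, M, T.toLinearEquiv.toLinearMap ∘ₗ N.mkQ, hM, fun y => ?_, fun e ε hε => ?_⟩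
  · exact (T.norm_map _).trans_le (Submodule.Quotient.norm_mk_le _ _)
  · obtain ⟨y, hy, hlt⟩ := Submodule.Quotient.norm_mk_lt (T.symm e) hε
    refine ⟨y, ?_, ?_⟩
    · change T (Submodule.Quotient.mk y) = e
      rw [hy, T.apply_symm_apply]
    · rw [T.symm.norm_map] at hlt
      exact hlt.le

lemma isQSL_Lp {X : Type u} [MeasurableSpace X] (ν : Measure X) : IsQSL p (Lp ℂ p ν) :=
  isQSL_of_quotient (Y := Lp ℂ p ν) LinearIsometry.id LinearMap.id (fun _ => le_rfl)
    fun e ε hε => ⟨e, rfl, by simpa using hε.le⟩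

lemma IsQSL.submodule (h : IsQSL p E) {F : Submodule ℂ E} (hF : IsClosed (F : Set E)) :
    IsQSL p F := by
  obtain ⟨X, _, ν, M, Q, hM, hQ, hQ'⟩ := h.exists_quotient
  have hcont : Continuous Q := (Q.mkContinuous 1 fun m => by simpa using hQ m).continuous
  obtain ⟨Y, hYF⟩ : ∃ Y : Submodule ℂ M, ∀ y, y ∈ Y ↔ Q y ∈ F := ⟨F.comap Q, fun _ => Iff.rfl⟩
  have hY : IsClosed (Y : Set M) := by
    rw [show (Y : Set M) = Q ⁻¹' F from Set.ext hYF]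
    exact hF.preimage hcont
  have : CompleteSpace M := hM.completeSpace_coe
  have : CompleteSpace Y := hY.completeSpace_coe
  let QY : Y →ₗ[ℂ] F := (Q ∘ₗ Y.subtype).codRestrict F fun y => (hYF _).1 y.2
  let J : Y →ₗᵢ[ℂ] Lp ℂ p ν := M.subtypeₗᵢ.comp Y.subtypeₗᵢ
  refine @isQSL_of_quotient p _ F _ _ X _ ν Y Y.normedAddCommGroup Y.normedSpace this J QY
    (fun y => hQ y) fun e ε hε => ?_
  obtain ⟨y, hy, hle⟩ := hQ' e ε hε
  exact ⟨⟨y, (hYF y).2 (hy ▸ e.2)⟩, Subtype.ext hy, hle⟩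

lemma exists_lift_le_mul {M : Type*} [NormedAddCommGroup M] [NormedSpace ℂ M]
    {Q : M →ₗ[ℂ] E} (hQ' : ∀ e, ∀ ε : ℝ, 0 < ε → ∃ y, Q y = e ∧ ‖y‖ ≤ ‖e‖ + ε)
    {δ : ℝ} (hδ : 0 < δ) (e : E) : ∃ y, Q y = e ∧ ‖y‖ ≤ (1 + δ) * ‖e‖ := by
  rcases eq_or_ne e 0 with rfl | he
  · exact ⟨0, map_zero Q, by simp⟩
  · obtain ⟨y, hy, hle⟩ := hQ' e (δ * ‖e‖) (mul_pos hδ (norm_pos_iff.2 he))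
    exact ⟨y, hy, by linarith⟩

/-- Any finite subset of the space, together with all functionals, is modelled up to `ε` in some
`ℓ_q^n` paired with `ℓ_p^n`. This is all that is used of a `QSL_q`-space. -/
def IsLqApproximable (p q : ℝ) (E : Type*) [NormedAddCommGroup E] [NormedSpace ℂ E] : Prop :=
  ∀ (t : Finset E) (ε : ℝ), 0 < ε → ∃ (n : ℕ) (a : E → Fin n → ℂ) (d : StrongDual ℂ E → Fin n → ℂ),
    (∀ e ∈ t, ∑ k, ‖a e k‖ₑ ^ q ≤ (ENNReal.ofReal (1 + ε) * ‖e‖ₑ) ^ q) ∧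
    (∀ φ, ∑ k, ‖d φ k‖ₑ ^ p ≤ ‖φ‖ₑ ^ p) ∧
    ∀ e ∈ t, ∀ φ, ‖φ e - ∑ k, a e k * d φ k‖ ≤ ε * (‖φ‖ * ‖e‖)

lemma IsLqApproximable.submodule {p q : ℝ} {E : Type*} [NormedAddCommGroup E] [NormedSpace ℂ E]
    (h : IsLqApproximable p q E) (F : Submodule ℂ E) : IsLqApproximable p q F := by
  classical
  intro t ε hε
  obtain ⟨n, a, d, ha, hd, had⟩ := h (t.image Subtype.val) ε hε
  have hex : ∀ φ : StrongDual ℂ F, ∃ g : StrongDual ℂ E, (∀ x : F, g x = φ x) ∧ ‖g‖ = ‖φ‖ :=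
    exists_extension_norm_eq F
  choose ext hext hnorm using hex
  have hnorm' : ∀ φ, ‖ext φ‖ₑ = ‖φ‖ₑ := fun φ => enorm_eq_iff_norm_eq.2 (hnorm φ)
  refine ⟨n, fun e => a e, fun φ => d (ext φ), fun e he => ha e ?_, fun φ => ?_, fun e he φ => ?_⟩
  · exact Finset.mem_image_of_mem _ he
  · exact (hd _).trans_eq (by rw [hnorm'])
  · have := had e (Finset.mem_image_of_mem _ he) (ext φ)
    rwa [hext, hnorm] at this

/-- A finite subset is lifted to `L_q(X)` and replaced there by step functions, while functionals
are extended to `L_q(X)` by the Hahn–Banach theorem. -/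
lemma IsQSL.isLqApproximable {p q : ℝ≥0∞} [Fact (1 ≤ q)] (hq : q ≠ ∞)
    (hpq : p.toReal.HolderConjugate q.toReal) (h : IsQSL q E) :
    IsLqApproximable p.toReal q.toReal E := by
  classical
  intro t ε hε
  obtain ⟨X, _, ν, M, Q, -, hQ, hQ'⟩ := h.exists_quotient
  obtain ⟨δ, hδ, hδ1, hδε⟩ : ∃ δ : ℝ, 0 < δ ∧ δ ≤ 1 ∧ 3 * δ ≤ ε :=
    ⟨min 1 (ε / 3), by positivity, min_le_left _ _, by
      linarith [min_le_right (1 : ℝ) (ε / 3)]⟩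
  choose l hl hlnorm using exists_lift_le_mul hQ' hδ
  let Qc : M →L[ℂ] E := Q.mkContinuous 1 fun m => by simpa using hQ m
  have hQc : ‖Qc‖ ≤ 1 := LinearMap.mkContinuous_norm_le _ zero_le_one _
  choose ext hext hextn using exists_extension_norm_eq (𝕜 := ℂ) M
  let T : StrongDual ℂ E → StrongDual ℂ (Lp ℂ q ν) := fun φ => ext (φ ∘L Qc)
  have hT : ∀ φ, ‖T φ‖ ≤ ‖φ‖ := fun φ => by
    calc ‖T φ‖ = ‖φ ∘L Qc‖ := hextn _
      _ ≤ ‖φ‖ * ‖Qc‖ := ContinuousLinearMap.opNorm_comp_le _ _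
      _ ≤ ‖φ‖ := mul_le_of_le_one_right (norm_nonneg _) hQc
  have hTl : ∀ φ e, T φ (l e : Lp ℂ q ν) = φ e := fun φ e => by
    rw [hext]
    exact congrArg φ (hl e)
  obtain ⟨n, s, c, hs, hc⟩ := exists_step_approx hq (t.image fun e => (l e : Lp ℂ q ν)) hδ
  have hce : ∀ e ∈ t, ‖∑ k, c (l e) k • s k - l e‖ ≤ δ * ((1 + δ) * ‖e‖) := fun e he =>
    (hc _ (Finset.mem_image_of_mem _ he)).trans (mul_le_mul_of_nonneg_left (hlnorm e) hδ.le)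
  refine ⟨n, fun e => c (l e), fun φ k => T φ (s k), fun e he => ?_, fun φ => ?_,
    fun e he φ => ?_⟩
  · rw [← hs]
    gcongr
    rw [← ofReal_norm, ← ofReal_norm, ← ENNReal.ofReal_mul (by linarith)]
    refine ENNReal.ofReal_le_ofReal ?_
    have h1 : ‖∑ k, c (l e) k • s k‖ ≤
        ‖∑ k, c (l e) k • s k - l e‖ + ‖(l e : Lp ℂ q ν)‖ := by
      simpa using norm_add_le (∑ k, c (l e) k • s k - l e) (l e : Lp ℂ q ν)
    have h2 : ‖(l e : Lp ℂ q ν)‖ ≤ (1 + δ) * ‖e‖ := hlnorm e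
    have h3 := hce e he
    nlinarith [norm_nonneg e, mul_nonneg (sub_nonneg.2 hδ1) (mul_nonneg hδ.le (norm_nonneg e)),
      mul_le_mul_of_nonneg_right hδε (norm_nonneg e)]
  · refine (sum_enorm_apply_rpow_le hpq s (fun b => (hs b).le) (T φ)).trans ?_
    refine ENNReal.rpow_le_rpow ?_ hpq.nonneg
    rw [← ofReal_norm, ← ofReal_norm]
    exact ENNReal.ofReal_le_ofReal (hT φ)
  · have h1 : φ e - ∑ k, c (l e) k * T φ (s k) = -T φ (∑ k, c (l e) k • s k - l e) := by
      rw [map_sub, hTl, map_sum]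
      simp
    rw [h1, norm_neg]
    have h2 := (T φ).le_opNorm (∑ k, c (l e) k • s k - l e)
    have h3 : ‖T φ‖ * ‖∑ k, c (l e) k • s k - l e‖ ≤ ‖φ‖ * (δ * ((1 + δ) * ‖e‖)) :=
      mul_le_mul (hT φ) (hce e he) (norm_nonneg _) (norm_nonneg _)
    have h4 : δ * (1 + δ) ≤ ε := by nlinarith
    have h5 := mul_le_mul_of_nonneg_right h4 (mul_nonneg (norm_nonneg φ) (norm_nonneg e))
    nlinarith

end QSL

/-! ### Coefficients of `L_{p'}(G, E)` for a `QSL`-space `E` -/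

section CrossCoeff

open scoped NNReal

variable {G : Type u} [Group G] [MeasurableSpace G] {p p' : ℝ≥0∞} {E : Type*}
  [NormedAddCommGroup E] [NormedSpace ℂ E]

/-- The coefficient `x ↦ ∫ ⟨F(x⁻¹ y), Φ(y)⟩ dy` of left translation on `E`-valued functions, for
functions `F` with values in `E` and `Φ` with values in its dual. -/
noncomputable def crossCoeff (μ : Measure G) (Φ : G → StrongDual ℂ E) (F : G → E) (x : G) : ℂ :=
  ∫ y, Φ y (F (x⁻¹ * y)) ∂μ

/-- Pointwise evaluation of a weak* measurable function at a strongly measurable one is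
measurable. -/
lemma aestronglyMeasurable_weakStar_apply {X : Type*} [MeasurableSpace X] {μ : Measure X}
    {Φ : X → StrongDual ℂ E}
    (hΦ : ∀ e, AEStronglyMeasurable (fun y => Φ y e) μ) {F : X → E}
    (hF : AEStronglyMeasurable F μ) : AEStronglyMeasurable (fun y => Φ y (F y)) μ := by
  obtain ⟨F', hF', hFF'⟩ := hF
  have h1 : AEStronglyMeasurable (fun y => Φ y (F' y)) μ := by
    refine aestronglyMeasurable_of_tendsto_ae Filter.atTop (f := fun n y => Φ y (hF'.approx n y))
      (fun n => ?_) (Filter.Eventually.of_forall fun y =>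
        ((Φ y).continuous.tendsto _).comp (hF'.tendsto_approx y))
    have h2 : (fun y => Φ y (hF'.approx n y)) = fun y => ∑ e ∈ (hF'.approx n).range,
        ((hF'.approx n) ⁻¹' {e}).indicator (fun y => Φ y e) y := by
      ext y
      rw [Finset.sum_eq_single ((hF'.approx n) y)]
      · simp
      · intro e _ he
        exact Set.indicator_of_notMem (fun h => he h.symm) _
      · intro h
        exact absurd (SimpleFunc.mem_range_self _ y) h
    rw [h2]
    refine Finset.aestronglyMeasurable_fun_sum _ fun e _ => ?_
    exact (hΦ e).indicator ((hF'.approx n).measurableSet_fiber e)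
  refine h1.congr ?_
  filter_upwards [hFF'] with y hy
  rw [hy]

variable [MeasurableMul G] {μ : Measure G} [μ.IsMulLeftInvariant] [p.HolderConjugate p']
  {Φ : G → StrongDual ℂ E} {F : G → E} {k : G → ℝ}

lemma memLp_one_crossCoeff (hΦ : ∀ e, AEStronglyMeasurable (fun y => Φ y e) μ)
    (hk : MemLp k p μ) (hΦk : ∀ y, ‖Φ y‖ ≤ k y) (hF : MemLp F p' μ) (x : G) :
    AEStronglyMeasurable (fun y => Φ y (F (x⁻¹ * y))) μ ∧
      eLpNorm (fun y => Φ y (F (x⁻¹ * y))) 1 μ ≤ eLpNorm F p' μ * eLpNorm k p μ := by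
  have hx := measurePreserving_mul_left μ x⁻¹
  have hFx : AEStronglyMeasurable (fun y => F (x⁻¹ * y)) μ := hF.1.comp_measurePreserving hx
  refine ⟨aestronglyMeasurable_weakStar_apply hΦ hFx, ?_⟩
  have h1 : eLpNorm (fun y => F (x⁻¹ * y)) p' μ = eLpNorm F p' μ :=
    eLpNorm_comp_measurePreserving hF.1 hx
  have h2 := eLpNorm_smul_le_mul_eLpNorm (p := p') (q := p) (r := 1) hk.1
    (φ := fun y => ‖F (x⁻¹ * y)‖) hFx.norm
  rw [eLpNorm_norm, h1] at h2
  refine le_trans (eLpNorm_mono fun y => ?_) h2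
  rw [Pi.smul_apply', smul_eq_mul, norm_mul, norm_norm, mul_comm]
  exact ((Φ y).le_opNorm _).trans
    (mul_le_mul_of_nonneg_right ((hΦk y).trans (le_abs_self _)) (norm_nonneg _))

lemma integrable_crossCoeff (hΦ : ∀ e, AEStronglyMeasurable (fun y => Φ y e) μ)
    (hk : MemLp k p μ) (hΦk : ∀ y, ‖Φ y‖ ≤ k y) (hF : MemLp F p' μ) (x : G) :
    Integrable (fun y => Φ y (F (x⁻¹ * y))) μ := by
  obtain ⟨h1, h2⟩ := memLp_one_crossCoeff hΦ hk hΦk hF x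
  exact memLp_one_iff_integrable.1 ⟨h1, h2.trans_lt (ENNReal.mul_lt_top hF.2 hk.2)⟩

lemma enorm_crossCoeff_le (hΦ : ∀ e, AEStronglyMeasurable (fun y => Φ y e) μ)
    (hk : MemLp k p μ) (hΦk : ∀ y, ‖Φ y‖ ≤ k y) (hF : MemLp F p' μ) (x : G) :
    ‖crossCoeff μ Φ F x‖ₑ ≤ eLpNorm F p' μ * eLpNorm k p μ := by
  have h2 := (memLp_one_crossCoeff hΦ hk hΦk hF x).2
  rw [eLpNorm_one_eq_lintegral_enorm] at h2
  exact (enorm_integral_le_lintegral_enorm _).trans h2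

lemma crossCoeff_congr_ae {F₁ F₂ : G → E} {Φ₁ Φ₂ : G → StrongDual ℂ E} (hF : F₁ =ᵐ[μ] F₂)
    (hΦ : Φ₁ =ᵐ[μ] Φ₂) : crossCoeff μ Φ₁ F₁ = crossCoeff μ Φ₂ F₂ := by
  ext x
  refine integral_congr_ae ?_
  filter_upwards [(measurePreserving_mul_left μ x⁻¹).quasiMeasurePreserving.ae hF, hΦ] with y h1 h2
  rw [h1, h2]

variable [Fact (1 ≤ p)] [Fact (1 ≤ p')]

/-- The case of simple functions, up to an error that is small with `ε`: the finitely many values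
of `F` are modelled in `ℓ_{p'}^n`, where the estimate is Hölder's inequality; the error is a
combination of finitely many atoms. -/
lemma apENorm_crossCoeff_simpleFunc_le_add (hp : 1 < p) (hp_top : p < ∞)
    (hE : IsLqApproximable p.toReal p'.toReal E) (F : SimpleFunc G E)
    (Φ : SimpleFunc G (StrongDual ℂ E)) (hF : MemLp F p' μ) (hΦ : MemLp Φ p μ)
    {ε : ℝ} (hε : 0 < ε) :
    apENorm p p' μ (crossCoeff μ Φ F) ≤ ENNReal.ofReal (1 + ε) * (eLpNorm F p' μ * eLpNorm Φ p μ) +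
      F.range.card * (Φ.range.card * (ENNReal.ofReal ε * (eLpNorm F p' μ * eLpNorm Φ p μ))) := by
  have hp1 : 1 < p.toReal := by
    rw [← ENNReal.toReal_one]
    exact (ENNReal.toReal_lt_toReal ENNReal.one_ne_top hp_top.ne).2 hp
  have hconj : p.toReal.HolderConjugate p'.toReal := ENNReal.HolderConjugate.toReal hp1
  have hp'0 : p' ≠ 0 := fun h => hconj.symm.pos.ne' (by simp [h])
  have hp't : p' ≠ ∞ := fun h => hconj.symm.pos.ne' (by simp [h])
  have hp0 : p ≠ 0 := (zero_lt_one.trans hp).ne'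
  obtain ⟨n, a, d, ha, hd, had⟩ := hE F.range ε hε
  have haF : ∀ y, ∑ k, ‖a (F y) k‖ₑ ^ p'.toReal ≤
      (ENNReal.ofReal (1 + ε) * ‖F y‖ₑ) ^ p'.toReal := fun y => ha _ (F.mem_range_self y)
  have haF1 : ∀ k y, ‖a (F y) k‖ₑ ≤ ENNReal.ofReal (1 + ε) * ‖F y‖ₑ := fun k y =>
    (ENNReal.rpow_le_rpow_iff hconj.symm.pos).1 ((Finset.single_le_sum
      (f := fun k => ‖a (F y) k‖ₑ ^ p'.toReal) (fun _ _ => zero_le)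
        (Finset.mem_univ k)).trans (haF y))
  have hd1 : ∀ k φ, ‖d φ k‖ₑ ≤ ‖φ‖ₑ := fun k φ =>
    (ENNReal.rpow_le_rpow_iff hconj.pos).1 ((Finset.single_le_sum
      (f := fun k => ‖d φ k‖ₑ ^ p.toReal) (fun _ _ => zero_le) (Finset.mem_univ k)).trans (hd φ))
  let A : Fin n → G → ℂ := fun k => F.map fun e => a e k
  let D : Fin n → G → ℂ := fun k => Φ.map fun φ => d φ k
  have hA : ∀ k, MemLp (A k) p' μ := fun k => by
    refine MemLp.of_le_mul (c := 1 + ε) hF (F.map _).aestronglyMeasurable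
      (Filter.Eventually.of_forall fun y => ?_)
    have := haF1 k y
    rw [← ofReal_norm, ← ofReal_norm, ← ENNReal.ofReal_mul (by linarith),
      ENNReal.ofReal_le_ofReal_iff (by positivity)] at this
    exact this
  have hD : ∀ k, MemLp (D k) p μ := fun k => by
    refine MemLp.mono hΦ (Φ.map _).aestronglyMeasurable (Filter.Eventually.of_forall fun y => ?_)
    have := hd1 k (Φ y)
    rw [← ofReal_norm, ← ofReal_norm, ENNReal.ofReal_le_ofReal_iff (norm_nonneg _)] at this
    exact this
  -- The relative error of the model, with the junk value `0` for `e = 0` or `φ = 0`.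
  let ρ : E → StrongDual ℂ E → ℂ := fun e φ => (φ e - ∑ k, a e k * d φ k) / (‖φ‖ * ‖e‖ : ℝ)
  have hρ : ∀ e ∈ F.range, ∀ φ, ‖ρ e φ‖ ≤ ε := fun e he φ => by
    simp only [ρ, norm_div, Complex.norm_real]
    rw [Real.norm_of_nonneg (by positivity)]
    exact div_le_of_le_mul₀ (by positivity) hε.le (had e he φ)
  have hρ' : ∀ e ∈ F.range, ∀ φ, φ e - ∑ k, a e k * d φ k = ρ e φ * ‖e‖ * ‖φ‖ := fun e he φ => by
    by_cases h : ‖φ‖ * ‖e‖ = 0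
    · have h1 := had e he φ
      rw [h, mul_zero] at h1
      rw [norm_le_zero_iff.1 h1, mul_assoc, ← Complex.ofReal_mul, mul_comm ‖e‖, h]
      simp
    · have h' : ((‖φ‖ * ‖e‖ : ℝ) : ℂ) ≠ 0 := by exact_mod_cast h
      simp only [ρ]
      rw [mul_assoc, ← Complex.ofReal_mul, mul_comm ‖e‖, div_mul_cancel₀ _ h']
  let f : E → StrongDual ℂ E → G → ℂ := fun e φ => (F ⁻¹' {e}).indicator fun _ => ρ e φ * ‖e‖
  let g : StrongDual ℂ E → G → ℂ := fun φ => (Φ ⁻¹' {φ}).indicator fun _ => (‖φ‖ : ℂ)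
  have hfle : ∀ e ∈ F.range, ∀ φ y, ‖f e φ y‖ ≤ ε * ‖F y‖ := fun e he φ y => by
    by_cases hy : F y = e
    · have : y ∈ F ⁻¹' {e} := hy
      simp only [f, Set.indicator_of_mem this, norm_mul, Complex.norm_real, norm_norm, hy]
      exact mul_le_mul_of_nonneg_right (hρ e he φ) (norm_nonneg _)
    · have : y ∉ F ⁻¹' {e} := hy
      simp only [f, Set.indicator_of_notMem this, norm_zero]
      positivity
  have hgle : ∀ φ y, ‖g φ y‖ ≤ ‖Φ y‖ := fun φ y => by
    by_cases hy : Φ y = φ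
    · simp [g, hy]
    · have : y ∉ Φ ⁻¹' {φ} := hy
      simp [g, Set.indicator_of_notMem this]
  have hf : ∀ e ∈ F.range, ∀ φ, MemLp (f e φ) p' μ := fun e he φ =>
    MemLp.of_le_mul hF ((stronglyMeasurable_const.indicator
      (F.measurableSet_fiber e)).aestronglyMeasurable) (Filter.Eventually.of_forall (hfle e he φ))
  have hg : ∀ φ, MemLp (g φ) p μ := fun φ =>
    MemLp.mono hΦ ((stronglyMeasurable_const.indicator
      (Φ.measurableSet_fiber φ)).aestronglyMeasurable) (Filter.Eventually.of_forall (hgle φ))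
  have hint : ∀ {f g : G → ℂ}, MemLp f p' μ → MemLp g p μ → ∀ x,
      Integrable (fun y => f (x⁻¹ * y) * g y) μ := fun hf hg x =>
    (hf.comp_measurePreserving (measurePreserving_mul_left μ x⁻¹)).integrable_mul hg
  have hpt : ∀ z y, Φ y (F z) = ∑ k, A k z * D k y +
      ∑ e ∈ F.range, ∑ φ ∈ Φ.range, f e φ z * g φ y := by
    intro z y
    rw [Finset.sum_eq_single (F z), Finset.sum_eq_single (Φ y)]
    · simp only [f, g, Set.indicator_of_mem (show z ∈ F ⁻¹' {F z} from rfl),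
        Set.indicator_of_mem (show y ∈ Φ ⁻¹' {Φ y} from rfl)]
      rw [← hρ' _ (F.mem_range_self z)]
      simp [A, D]
    · intro φ _ hφ
      simp only [g, Set.indicator_of_notMem (show y ∉ Φ ⁻¹' {φ} from fun h => hφ h.symm), mul_zero]
    · exact fun h => absurd (Φ.mem_range_self y) h
    · intro e _ he
      simp only [f, Set.indicator_of_notMem (show z ∉ F ⁻¹' {e} from fun h => he h.symm), zero_mul,
        Finset.sum_const_zero]
    · exact fun h => absurd (F.mem_range_self z) h
  have hdecomp : crossCoeff μ Φ F = (fun x => ∑ k, ∫ y, A k (x⁻¹ * y) * D k y ∂μ) +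
      ∑ e ∈ F.range, ∑ φ ∈ Φ.range, fun x => ∫ y, f e φ (x⁻¹ * y) * g φ y ∂μ := by
    ext x
    simp only [crossCoeff, hpt, Pi.add_apply, Finset.sum_apply]
    rw [integral_add (integrable_finsetSum _ fun k _ => hint (hA k) (hD k) x)
      (integrable_finsetSum _ fun e he => integrable_finsetSum _ fun φ _ =>
        hint (hf e he φ) (hg φ) x), integral_finsetSum _ fun k _ => hint (hA k) (hD k) x,
      integral_finsetSum _ fun e he => integrable_finsetSum _ fun φ _ =>
        hint (hf e he φ) (hg φ) x]
    congr 1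
    refine Finset.sum_congr rfl fun e he => ?_
    exact integral_finsetSum _ fun φ _ => hint (hf e he φ) (hg φ) x
  rw [hdecomp]
  refine (apENorm_add_le _ _).trans (add_le_add ?_ ?_)
  · refine (apENorm_sum_integral_le hp hp_top hA hD).trans ?_
    rw [← mul_assoc]
    refine mul_le_mul' ?_ ?_
    · calc (∫⁻ y, ∑ k, ‖A k y‖ₑ ^ p'.toReal ∂μ) ^ (1 / p'.toReal)
          ≤ (∫⁻ y, ENNReal.ofReal (1 + ε) ^ p'.toReal * ‖F y‖ₑ ^ p'.toReal ∂μ) ^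
              (1 / p'.toReal) := by
            refine ENNReal.rpow_le_rpow (lintegral_mono fun y => ?_) hconj.symm.one_div_nonneg
            rw [← ENNReal.mul_rpow_of_nonneg _ _ hconj.symm.nonneg]
            exact haF y
        _ = _ := by
            rw [lintegral_const_mul' _ _ (by simp [ENNReal.rpow_eq_top_iff, hconj.symm.pos.le]),
              ENNReal.mul_rpow_of_nonneg _ _ hconj.symm.one_div_nonneg, ← ENNReal.rpow_mul,
              mul_one_div_cancel hconj.symm.ne_zero, ENNReal.rpow_one,
              eLpNorm_eq_lintegral_rpow_enorm_toReal hp'0 hp't]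
    · rw [eLpNorm_eq_lintegral_rpow_enorm_toReal hp0 hp_top.ne]
      exact ENNReal.rpow_le_rpow (lintegral_mono fun y => hd (Φ y)) hconj.one_div_nonneg
  · refine (apENorm_sum_le _ _).trans ((Finset.sum_le_card_nsmul _ _ _ fun e he => ?_).trans_eq
      (nsmul_eq_mul _ _))
    refine (apENorm_sum_le _ _).trans ((Finset.sum_le_card_nsmul _ _ _ fun φ _ => ?_).trans_eq
      (nsmul_eq_mul _ _))
    refine (apENorm_integral_translate_mul_le μ (hf e he φ) (hg φ)).trans ?_
    rw [← mul_assoc]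
    refine mul_le_mul' ?_ (eLpNorm_mono (hgle φ))
    exact eLpNorm_le_mul_eLpNorm_of_ae_le_mul (Filter.Eventually.of_forall (hfle e he φ)) _

lemma apENorm_crossCoeff_simpleFunc_le (hp : 1 < p) (hp_top : p < ∞)
    (hE : IsLqApproximable p.toReal p'.toReal E) (F : SimpleFunc G E)
    (Φ : SimpleFunc G (StrongDual ℂ E)) (hF : MemLp F p' μ) (hΦ : MemLp Φ p μ) :
    apENorm p p' μ (crossCoeff μ Φ F) ≤ eLpNorm F p' μ * eLpNorm Φ p μ := by
  set c := eLpNorm F p' μ * eLpNorm Φ p μ with hc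
  have hct : c ≠ ∞ := (ENNReal.mul_lt_top hF.2 hΦ.2).ne
  have h1 : ∀ᶠ ε : ℝ in nhdsWithin 0 (Set.Ioi 0), apENorm p p' μ (crossCoeff μ Φ F) ≤
      ENNReal.ofReal (1 + ε) * c + F.range.card * (Φ.range.card * (ENNReal.ofReal ε * c)) :=
    Filter.eventually_of_mem self_mem_nhdsWithin fun ε hε =>
      apENorm_crossCoeff_simpleFunc_le_add hp hp_top hE F Φ hF hΦ hε
  have h2 : Continuous fun ε : ℝ => ENNReal.ofReal (1 + ε) * c +
      F.range.card * (Φ.range.card * (ENNReal.ofReal ε * c)) := by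
    refine ((ENNReal.continuous_mul_const hct).comp
      (ENNReal.continuous_ofReal.comp (by fun_prop))).add ?_
    exact (ENNReal.continuous_const_mul (ENNReal.natCast_ne_top _)).comp
      ((ENNReal.continuous_const_mul (ENNReal.natCast_ne_top _)).comp
        ((ENNReal.continuous_mul_const hct).comp ENNReal.continuous_ofReal))
  exact ge_of_tendsto (by simpa using (h2.tendsto 0).mono_left nhdsWithin_le_nhds) h1

/-- On a finite-dimensional space a weak* measurable function `Φ` is strongly measurable, hence
approximable by simple functions. -/
lemma apENorm_crossCoeff_le_of_finiteDimensional [FiniteDimensional ℂ E] (hp : 1 < p)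
    (hp_top : p < ∞) (hE : IsLqApproximable p.toReal p'.toReal E) (F : SimpleFunc G E)
    (hF : MemLp F p' μ) (hΦ : ∀ e, AEStronglyMeasurable (fun y => Φ y e) μ) (hk : MemLp k p μ)
    (hΦk : ∀ y, ‖Φ y‖ ≤ k y) :
    apENorm p p' μ (crossCoeff μ Φ F) ≤ eLpNorm F p' μ * eLpNorm k p μ := by
  have hΦm : AEStronglyMeasurable Φ μ := by
    let b := Module.finBasis ℂ E
    have h1 : Φ = fun y => ∑ i, Φ y (b i) • LinearMap.toContinuousLinearMap (b.coord i) := by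
      ext y e
      rw [sum_apply]
      conv_lhs => rw [← b.sum_repr e, map_sum]
      refine Finset.sum_congr rfl fun i _ => ?_
      rw [map_smul, smul_eq_mul, mul_comm]
      rfl
    rw [h1]
    exact Finset.aestronglyMeasurable_fun_sum _ fun i _ => (hΦ (b i)).smul_const _
  have hΦL : MemLp Φ p μ :=
    ⟨hΦm, (eLpNorm_mono fun y => (hΦk y).trans (le_abs_self _)).trans_lt hk.2⟩
  have hcoe : ∀ Ψ : Lp (StrongDual ℂ E) p μ, ∀ e, AEStronglyMeasurable (fun y => Ψ y e) μ :=
    fun Ψ e => (ContinuousLinearMap.apply ℂ ℂ e).continuous.comp_aestronglyMeasurable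
      (Lp.aestronglyMeasurable Ψ)
  have hFt : eLpNorm F p' μ ≠ ∞ := hF.2.ne
  have key := atomicNorm_le_of_dense (nnnorm_apAtom_le (p := p) (p' := p') μ)
    (Lp.simpleFunc (StrongDual ℂ E) p μ) (Lp.simpleFunc.dense hp_top.ne)
    (fun Ψ => crossCoeff μ (Ψ : G → StrongDual ℂ E) F) (fun Ψ₁ Ψ₂ x => ?_)
    (c := (eLpNorm F p' μ).toNNReal) (fun Ψ x => ?_) (fun Ψ hΨ => ?_) (hΦL.toLp Φ)
  · rw [crossCoeff_congr_ae (Filter.EventuallyEq.refl _ _) hΦL.coeFn_toLp,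
      ENNReal.coe_toNNReal hFt, Lp.enorm_toLp] at key
    refine key.trans (mul_le_mul' le_rfl (eLpNorm_mono fun y => ?_))
    exact (hΦk y).trans (le_abs_self _)
  · simp only [crossCoeff]
    rw [← integral_add (integrable_crossCoeff (hcoe Ψ₁) (Lp.memLp Ψ₁).norm (fun _ => le_rfl) hF x)
      (integrable_crossCoeff (hcoe Ψ₂) (Lp.memLp Ψ₂).norm (fun _ => le_rfl) hF x)]
    refine integral_congr_ae ?_
    filter_upwards [Lp.coeFn_add Ψ₁ Ψ₂] with y hy
    rw [hy]
    rfl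
  · have h1 := enorm_crossCoeff_le (hcoe Ψ) (Lp.memLp Ψ).norm (fun _ => le_rfl) hF x
    rwa [eLpNorm_norm, ← Lp.enorm_def, ← ENNReal.coe_toNNReal hFt] at h1
  · have h1 := apENorm_crossCoeff_simpleFunc_le hp hp_top hE F
      (Lp.simpleFunc.toSimpleFunc ⟨Ψ, hΨ⟩) hF (Lp.simpleFunc.memLp ⟨Ψ, hΨ⟩)
    have h2 := Lp.simpleFunc.toSimpleFunc_eq_toFun ⟨Ψ, hΨ⟩
    rw [crossCoeff_congr_ae (Filter.EventuallyEq.refl _ _) h2, eLpNorm_congr_ae h2,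
      ← ENNReal.coe_toNNReal hFt] at h1
    rw [Lp.enorm_def]
    exact h1

/-- Only the finite-dimensional span of the values of `F` matters. -/
lemma apENorm_crossCoeff_le_of_simpleFunc (hp : 1 < p) (hp_top : p < ∞)
    (hE : IsLqApproximable p.toReal p'.toReal E) (F : SimpleFunc G E) (hF : MemLp F p' μ)
    (hΦ : ∀ e, AEStronglyMeasurable (fun y => Φ y e) μ) (hk : MemLp k p μ)
    (hΦk : ∀ y, ‖Φ y‖ ≤ k y) :
    apENorm p p' μ (crossCoeff μ Φ F) ≤ eLpNorm F p' μ * eLpNorm k p μ := by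
  classical
  obtain ⟨E₀, hfin, hE₀⟩ : ∃ E₀ : Submodule ℂ E, FiniteDimensional ℂ E₀ ∧ ∀ y, F y ∈ E₀ :=
    ⟨Submodule.span ℂ (Set.range F), FiniteDimensional.span_of_finite ℂ F.finite_range,
      fun y => Submodule.subset_span ⟨y, rfl⟩⟩
  obtain ⟨F₀, hF₀⟩ : ∃ F₀ : SimpleFunc G E₀, ∀ y, (F₀ y : E) = F y :=
    ⟨F.map fun e => if h : e ∈ E₀ then ⟨e, h⟩ else 0, fun y => by simp [hE₀ y]⟩
  have hF₀norm : ∀ y, ‖F₀ y‖ = ‖F y‖ := fun y => by rw [← hF₀ y]; rfl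
  have hF₀e : eLpNorm F₀ p' μ = eLpNorm F p' μ :=
    eLpNorm_congr_norm_ae (Filter.Eventually.of_forall hF₀norm)
  have hF₀L : MemLp F₀ p' μ := ⟨F₀.aestronglyMeasurable, hF₀e.trans_lt hF.2⟩
  have h1 := apENorm_crossCoeff_le_of_finiteDimensional (Φ := fun y => (Φ y).comp E₀.subtypeL)
    hp hp_top (hE.submodule E₀) F₀ hF₀L (fun e => hΦ e) hk fun y =>
      (ContinuousLinearMap.opNorm_le_bound ((Φ y).comp E₀.subtypeL) (norm_nonneg (Φ y))
        fun e => (Φ y).le_opNorm (e : E)).trans (hΦk y)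
  have h2 : crossCoeff μ (fun y => (Φ y).comp E₀.subtypeL) F₀ = crossCoeff μ Φ F := by
    ext x
    refine integral_congr_ae (Filter.Eventually.of_forall fun y => ?_)
    simp only [← hF₀]
    rfl
  rwa [h2, hF₀e] at h1

/-- Coefficients of left translation on `L_{p'}(G, E)`, for a `QSL_{p'}`-space `E`, lie in
`A_p(G)`, with the expected bound of the norm. -/
theorem apENorm_crossCoeff_le (hp : 1 < p) (hp_top : p < ∞)
    (hE : IsLqApproximable p.toReal p'.toReal E) (hp' : p' ≠ ∞) (hF : MemLp F p' μ)
    (hΦ : ∀ e, AEStronglyMeasurable (fun y => Φ y e) μ) (hk : MemLp k p μ)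
    (hΦk : ∀ y, ‖Φ y‖ ≤ k y) :
    apENorm p p' μ (crossCoeff μ Φ F) ≤ eLpNorm F p' μ * eLpNorm k p μ := by
  have hkt : eLpNorm k p μ ≠ ∞ := hk.2.ne
  have key := atomicNorm_le_of_dense (nnnorm_apAtom_le (p := p) (p' := p') μ)
    (Lp.simpleFunc E p' μ) (Lp.simpleFunc.dense hp') (fun a => crossCoeff μ Φ (a : G → E))
    (fun a₁ a₂ x => ?_) (c := (eLpNorm k p μ).toNNReal) (fun a x => ?_) (fun a ha => ?_)
    (hF.toLp F)
  · rwa [crossCoeff_congr_ae hF.coeFn_toLp (Filter.EventuallyEq.refl _ _),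
      ENNReal.coe_toNNReal hkt, Lp.enorm_toLp, mul_comm] at key
  · simp only [crossCoeff]
    rw [← integral_add (integrable_crossCoeff hΦ hk hΦk (Lp.memLp a₁) x)
      (integrable_crossCoeff hΦ hk hΦk (Lp.memLp a₂) x)]
    refine integral_congr_ae ?_
    filter_upwards [(measurePreserving_mul_left μ x⁻¹).quasiMeasurePreserving.ae
      (Lp.coeFn_add a₁ a₂)] with y hy
    rw [hy, Pi.add_apply, map_add]
  · rw [ENNReal.coe_toNNReal hkt, mul_comm, Lp.enorm_def]
    exact enorm_crossCoeff_le hΦ hk hΦk (Lp.memLp a) x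
  · have h1 := apENorm_crossCoeff_le_of_simpleFunc hp hp_top hE
      (Lp.simpleFunc.toSimpleFunc ⟨a, ha⟩) (Lp.simpleFunc.memLp ⟨a, ha⟩) hΦ hk hΦk
    have h2 := Lp.simpleFunc.toSimpleFunc_eq_toFun ⟨a, ha⟩
    rw [crossCoeff_congr_ae h2 (Filter.EventuallyEq.refl _ _), eLpNorm_congr_ae h2] at h1
    rw [ENNReal.coe_toNNReal hkt, mul_comm, Lp.enorm_def]
    exact h1

end CrossCoeff

/-! ### Translation representations on `L_q`-spaces -/

section Translation

variable {G : Type u} [Group G] [TopologicalSpace G]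
  {X : Type u} [TopologicalSpace X] [MeasurableSpace X] [BorelSpace X] {ν : Measure X}

/-- The action of `G` on `L_q(X)` by isometries that comes from a measure preserving action `T` of
`G` on `X`, namely `(x ξ)(y) = ξ(x⁻¹ y)`. -/
noncomputable def lpTranslation (𝕜 : Type*) [RCLike 𝕜] (q : ℝ≥0∞) [Fact (1 ≤ q)]
    (T : G →* (X ≃ₜ X)) (hT : ∀ x, MeasurePreserving (T x) ν ν) :
    G →* (Lp 𝕜 q ν ≃ₗᵢ[𝕜] Lp 𝕜 q ν) where
  toFun x := LinearIsometryEquiv.ofLinearIsometry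
    (Lp.compMeasurePreservingₗᵢ 𝕜 (T x⁻¹) (hT x⁻¹))
    (Lp.compMeasurePreservingₗᵢ 𝕜 (T x) (hT x)).toLinearMap
    (by
      ext1 f
      refine Lp.ext ?_
      refine (Lp.coeFn_compMeasurePreserving _ (hT x⁻¹)).trans ?_
      filter_upwards [(hT x⁻¹).quasiMeasurePreserving.ae
        (Lp.coeFn_compMeasurePreserving f (hT x))] with y hy
      refine hy.trans ?_
      simp)
    (by
      ext1 f
      refine Lp.ext ?_
      refine (Lp.coeFn_compMeasurePreserving _ (hT x)).trans ?_
      filter_upwards [(hT x).quasiMeasurePreserving.ae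
        (Lp.coeFn_compMeasurePreserving f (hT x⁻¹))] with y hy
      refine hy.trans ?_
      simp)
  map_one' := by
    ext1 f
    refine Lp.ext ((Lp.coeFn_compMeasurePreserving _ (hT 1⁻¹)).trans ?_)
    refine Filter.Eventually.of_forall fun y => ?_
    simp
  map_mul' x x' := by
    ext1 f
    refine Lp.ext ((Lp.coeFn_compMeasurePreserving _ (hT (x * x')⁻¹)).trans ?_)
    refine Filter.EventuallyEq.symm ((Lp.coeFn_compMeasurePreserving _ (hT x⁻¹)).trans ?_)
    filter_upwards [(hT x⁻¹).quasiMeasurePreserving.ae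
      (Lp.coeFn_compMeasurePreserving f (hT x'⁻¹))] with y hy
    refine hy.trans ?_
    simp

variable {𝕜 : Type*} [RCLike 𝕜] {q : ℝ≥0∞} [Fact (1 ≤ q)]
    {T : G →* (X ≃ₜ X)} {hT : ∀ x, MeasurePreserving (T x) ν ν}

lemma coeFn_lpTranslation (x : G) (f : Lp 𝕜 q ν) :
    lpTranslation 𝕜 q T hT x f =ᵐ[ν] fun y => f (T x⁻¹ y) :=
  Lp.coeFn_compMeasurePreserving f (hT x⁻¹)

lemma continuous_lpTranslation [R1Space X] [ν.InnerRegularCompactLTTop]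
    [IsLocallyFiniteMeasure ν] [ContinuousInv G] (hq : q ≠ ∞)
    (hcont : Continuous fun z : G × X => T z.1 z.2) (f : Lp 𝕜 q ν) :
    Continuous fun x => lpTranslation 𝕜 q T hT x f := by
  have hc : Continuous fun x : G => (⟨T x⁻¹, (T x⁻¹).continuous⟩ : C(X, X)) :=
    ContinuousMap.continuous_of_continuous_uncurry _
      (hcont.comp (continuous_fst.inv.prodMk continuous_snd))
  exact Continuous.compMeasurePreservingLp (f := fun _ : G => f) continuous_const hc
    (fun x => hT x⁻¹) hq

end Translation

section Regular

variable {G : Type u} [Group G] [TopologicalSpace G] [IsTopologicalGroup G]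

/-- The action of `G` on itself by left multiplication. -/
def mulLeftHom (G : Type u) [Group G] [TopologicalSpace G] [IsTopologicalGroup G] :
    G →* (G ≃ₜ G) where
  toFun := Homeomorph.mulLeft
  map_one' := by ext; simp
  map_mul' x y := by ext; simp [mul_assoc]

variable [MeasurableSpace G] [BorelSpace G] (μ : Measure G) [μ.IsMulLeftInvariant]
  (𝕜 : Type*) [RCLike 𝕜] (q : ℝ≥0∞) [Fact (1 ≤ q)]

/-- The left regular representation on `L_q(G)`. -/
noncomputable def leftTranslation : G →* (Lp 𝕜 q μ ≃ₗᵢ[𝕜] Lp 𝕜 q μ) :=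
  lpTranslation 𝕜 q (mulLeftHom G) fun x => measurePreserving_mul_left μ x

variable {μ 𝕜 q}

lemma coeFn_leftTranslation (x : G) (f : Lp 𝕜 q μ) :
    leftTranslation μ 𝕜 q x f =ᵐ[μ] fun y => f (x⁻¹ * y) :=
  coeFn_lpTranslation x f

lemma continuous_leftTranslation [LocallyCompactSpace G] [μ.Regular] (hq : q ≠ ∞) (f : Lp 𝕜 q μ) :
    Continuous fun x => leftTranslation μ 𝕜 q x f :=
  continuous_lpTranslation hq continuous_mul f

/-- The left regular representation on `L_q(G)`, as a representation on a Banach space. -/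
noncomputable def leftRegularRep [LocallyCompactSpace G] (μ : Measure G) [μ.IsMulLeftInvariant]
    [μ.Regular] {q : ℝ≥0∞} [Fact (1 ≤ q)] (hq : q ≠ ∞) : BanachRep G where
  carrier := Lp ℂ q μ
  hom := leftTranslation μ ℂ q
  continuous_hom := continuous_leftTranslation hq

end Regular

/-! ### The pairing of `L_{p'}` and `L_p` -/

section Pairing

variable {X : Type*} [MeasurableSpace X] {ν : Measure X} {p p' : ℝ≥0∞} [Fact (1 ≤ p)]
  [Fact (1 ≤ p')] [p.HolderConjugate p']

/-- The functional on `L_{p'}(X)` that is given by an element of `L_p(X)`. -/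
noncomputable def lpFunctional (φ : Lp ℂ p ν) : StrongDual ℂ (Lp ℂ p' ν) :=
  (ContinuousLinearMap.mul ℂ ℂ).lpPairing ν p p' φ

lemma lpFunctional_apply (φ : Lp ℂ p ν) (ξ : Lp ℂ p' ν) :
    lpFunctional φ ξ = ∫ y, ξ y * φ y ∂ν := by
  rw [lpFunctional, ContinuousLinearMap.lpPairing_eq_integral]
  simp_rw [ContinuousLinearMap.mul_apply', mul_comm]

lemma lpFunctional_sub (φ φ' : Lp ℂ p ν) :
    (lpFunctional (φ - φ') : StrongDual ℂ (Lp ℂ p' ν)) = lpFunctional φ - lpFunctional φ' :=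
  map_sub _ φ φ'

lemma norm_lpFunctional_le (φ : Lp ℂ p ν) :
    ‖(lpFunctional φ : StrongDual ℂ (Lp ℂ p' ν))‖ ≤ ‖φ‖ := by
  refine ContinuousLinearMap.opNorm_le_bound _ (norm_nonneg _) fun ξ => ?_
  rw [lpFunctional_apply]
  have h := eLpNorm_smul_le_mul_eLpNorm (p := p) (q := p') (r := 1) (Lp.aestronglyMeasurable ξ)
    (Lp.aestronglyMeasurable φ)
  rw [eLpNorm_one_eq_lintegral_enorm, ← Lp.enorm_def, ← Lp.enorm_def] at h
  have h2 : ‖∫ y, ξ y * φ y ∂ν‖ₑ ≤ ‖φ‖ₑ * ‖ξ‖ₑ := by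
    refine (enorm_integral_le_lintegral_enorm _).trans (le_trans (le_of_eq ?_) h)
    refine lintegral_congr fun y => ?_
    rw [Pi.smul_apply', smul_eq_mul, mul_comm]
  rwa [← ofReal_norm, ← ofReal_norm, ← ofReal_norm, ← ENNReal.ofReal_mul (norm_nonneg _),
    ENNReal.ofReal_le_ofReal_iff (by positivity)] at h2

end Pairing

/-! ### Cyclic subrepresentations -/

section Cyclic

variable {G : Type u} [Group G] [TopologicalSpace G]

lemma BanachRep.hom_mul_apply (π : BanachRep G) (x y : G) (v : π.carrier) :
    π.hom (x * y) v = π.hom x (π.hom y v) := by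
  rw [map_mul]
  rfl

lemma BanachRep.hom_one_apply (π : BanachRep G) (v : π.carrier) : π.hom 1 v = v := by
  rw [map_one]
  rfl

/-- The restriction of a representation to a closed invariant subspace. -/
noncomputable def BanachRep.restrict (π : BanachRep G) (F : Submodule ℂ π.carrier)
    (hF : IsClosed (F : Set π.carrier)) (hinv : ∀ x, ∀ v ∈ F, π.hom x v ∈ F) : BanachRep G where
  carrier := F
  completeSpace := hF.completeSpace_coe
  hom :=
    { toFun := fun x => LinearIsometryEquiv.ofLinearIsometry
        ⟨(π.hom x).toLinearEquiv.toLinearMap.restrict (hinv x), fun v => (π.hom x).norm_map v⟩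
        ((π.hom x⁻¹).toLinearEquiv.toLinearMap.restrict (hinv x⁻¹))
        (by
          ext v
          change π.hom x (π.hom x⁻¹ v) = v
          rw [← π.hom_mul_apply, mul_inv_cancel, π.hom_one_apply])
        (by
          ext v
          change π.hom x⁻¹ (π.hom x v) = v
          rw [← π.hom_mul_apply, inv_mul_cancel, π.hom_one_apply])
      map_one' := by
        ext v
        exact π.hom_one_apply v
      map_mul' := fun x y => by
        ext v
        exact π.hom_mul_apply x y v }
  continuous_hom := fun ξ => (π.continuous_hom ξ).subtype_mk _

variable [IsTopologicalGroup G] [LocallyCompactSpace G] [MeasurableSpace G] [BorelSpace G]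

lemma exists_bump (μ : Measure G) [IsFiniteMeasureOnCompacts μ] [μ.IsOpenPosMeasure] (x : G)
    {U : Set G} (hU : U ∈ nhds x) :
    ∃ k : G → ℝ, Continuous k ∧ HasCompactSupport k ∧ (∀ y, 0 ≤ k y) ∧
      (∀ y ∉ U, k y = 0) ∧ ∫ y, k y ∂μ = 1 := by
  obtain ⟨V, hVU, hV, hxV⟩ := mem_nhds_iff.1 hU
  obtain ⟨f, hf1, hf0, hfc, hf01⟩ := exists_continuous_one_zero_of_isCompact
    (isCompact_singleton (x := x)) hV.isClosed_compl
    (Set.disjoint_singleton_left.2 fun h => h hxV)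
  have hfx : f x ≠ 0 := by
    rw [hf1 rfl]
    exact one_ne_zero
  have hpos : 0 < ∫ y, f y ∂μ := f.continuous.integral_pos_of_hasCompactSupport_nonneg_nonzero hfc
    (fun y => (hf01 y).1) hfx
  refine ⟨fun y => (∫ z, f z ∂μ)⁻¹ * f y, by fun_prop, hfc.mul_left, fun y =>
    mul_nonneg (inv_nonneg.2 hpos.le) (hf01 y).1, fun y hy => ?_, ?_⟩
  · exact mul_eq_zero_of_right _ (hf0 fun h => hy (hVU h))
  · rw [integral_const_mul, inv_mul_cancel₀ hpos.ne']

/-- A vector whose orbit spans a dense subspace is cyclic for the integrated representation: an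
approximate identity at `x` maps it to vectors that approximate its translate by `x`. -/
lemma BanachRep.isCyclic_of_dense_span (μ : Measure G) [IsFiniteMeasureOnCompacts μ]
    [μ.IsOpenPosMeasure] (π : BanachRep G) (ξ : π.carrier)
    (h : Dense (Submodule.span ℂ (Set.range fun x => π.hom x ξ) : Set π.carrier)) :
    π.IsCyclic μ := by
  let S : Submodule ℂ π.carrier :=
    { carrier := {v | ∃ a : G → ℂ, Continuous a ∧ HasCompactSupport a ∧
        v = ∫ x, a x • π.hom x ξ ∂μ}
      zero_mem' := ⟨0, continuous_zero, HasCompactSupport.zero, by simp⟩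
      add_mem' := by
        rintro _ _ ⟨a, ha, hac, rfl⟩ ⟨b, hb, hbc, rfl⟩
        refine ⟨a + b, ha.add hb, hac.add hbc, ?_⟩
        have hai : Integrable (fun x => a x • π.hom x ξ) μ :=
          (ha.smul (π.continuous_hom ξ)).integrable_of_hasCompactSupport hac.smul_right
        have hbi : Integrable (fun x => b x • π.hom x ξ) μ :=
          (hb.smul (π.continuous_hom ξ)).integrable_of_hasCompactSupport hbc.smul_right
        rw [← integral_add hai hbi]
        simp only [Pi.add_apply, add_smul]
      smul_mem' := by
        rintro c _ ⟨a, ha, hac, rfl⟩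
        refine ⟨c • a, ha.const_smul c, hac.smul_left, ?_⟩
        rw [← integral_smul]
        simp only [Pi.smul_apply, smul_assoc] }
  have hS : (S : Set π.carrier) ⊆ Set.range fun a : Lp ℂ 1 μ => π.integrated μ a ξ := by
    rintro _ ⟨a, ha, hac, rfl⟩
    have hL : MemLp a 1 μ := memLp_one_iff_integrable.2 (ha.integrable_of_hasCompactSupport hac)
    refine ⟨hL.toLp a, integral_congr_ae ?_⟩
    filter_upwards [hL.coeFn_toLp] with x hx
    rw [hx]
  refine ⟨ξ, Dense.mono hS ?_⟩
  have hspan : Submodule.span ℂ (Set.range fun x => π.hom x ξ) ≤ S.topologicalClosure := by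
    rw [Submodule.span_le]
    rintro _ ⟨x, rfl⟩
    refine Metric.mem_closure_iff.2 fun ε hε => ?_
    obtain ⟨k, hk, hkc, hk0, hkU, hk1⟩ := exists_bump μ x
      ((π.continuous_hom ξ).continuousAt.preimage_mem_nhds
        (Metric.ball_mem_nhds (π.hom x ξ) (half_pos hε)))
    have hka : Continuous fun y => (k y : ℂ) := Complex.continuous_ofReal.comp hk
    have hkac : HasCompactSupport fun y => (k y : ℂ) := hkc.comp_left (g := Complex.ofReal) rfl
    refine ⟨_, ⟨fun y => k y, hka, hkac, rfl⟩, ?_⟩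
    have hi1 : Integrable (fun y => (k y : ℂ) • π.hom y ξ) μ :=
      (hka.smul (π.continuous_hom ξ)).integrable_of_hasCompactSupport hkac.smul_right
    have hki : Integrable k μ := hk.integrable_of_hasCompactSupport hkc
    have h2 : π.hom x ξ = ∫ y, (k y : ℂ) • π.hom x ξ ∂μ := by
      rw [integral_smul_const, integral_complex_ofReal, hk1]
      simp
    have hi2 : Integrable (fun y => (k y : ℂ) • π.hom x ξ) μ := (hki.ofReal).smul_const _
    rw [dist_eq_norm]
    change ‖π.hom x ξ - ∫ y, (k y : ℂ) • π.hom y ξ ∂μ‖ < ε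
    nth_rewrite 1 [h2]
    rw [← integral_sub hi2 hi1]
    calc ‖∫ y, (k y : ℂ) • π.hom x ξ - (k y : ℂ) • π.hom y ξ ∂μ‖
        ≤ ∫ y, k y * (ε / 2) ∂μ := by
          refine norm_integral_le_of_norm_le (hki.mul_const _)
            (Filter.Eventually.of_forall fun y => ?_)
          rw [← smul_sub, norm_smul, Complex.norm_real, Real.norm_of_nonneg (hk0 y)]
          by_cases hy : y ∈ (fun x => π.hom x ξ) ⁻¹' Metric.ball (π.hom x ξ) (ε / 2)
          · refine mul_le_mul_of_nonneg_left ?_ (hk0 y)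
            rw [norm_sub_rev, ← dist_eq_norm]
            exact (Metric.mem_ball.1 hy).le
          · rw [hkU y hy]
            simp
      _ = ε / 2 := by rw [integral_mul_const, hk1, one_mul]
      _ < ε := half_lt_self hε
  have h3 := h.mono (show _ ⊆ (S.topologicalClosure : Set π.carrier) from hspan)
  rw [Submodule.topologicalClosure_coe] at h3
  exact dense_closure.1 h3

end Cyclic

/-! ### The norm of `B_p(G)` -/

section Bp

open scoped NNReal

variable {G : Type u} [Group G] [TopologicalSpace G] [MeasurableSpace G] (p' : ℝ≥0∞)
  [Fact (1 ≤ p')] (μ : Measure G)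

/-- The data of a coefficient of a cyclic representation on a `QSL`-space. -/
def BpIndex : Type (u + 1) :=
  Σ π : {π : BanachRep G // π ∈ CycQSLRep p' μ}, π.1.carrier × StrongDual ℂ π.1.carrier

variable {p' μ}

/-- The weight `‖ξ‖ ‖φ‖` of an atom of `B_p(G)`. -/
noncomputable def bpWeight (i : BpIndex p' μ) : ℝ≥0 :=
  ‖i.2.1‖₊ * ‖i.2.2‖₊

/-- The atom `x ↦ ⟨π(x) ξ, φ⟩` of `B_p(G)`. -/
noncomputable def bpAtom (i : BpIndex p' μ) (x : G) : ℂ :=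
  i.2.2 (i.1.1.hom x i.2.1)

variable (p' μ) in
/-- The norm of `B_p(G)` with values in `[0, ∞]`. -/
noncomputable def bpENorm : (G → ℂ) → ℝ≥0∞ :=
  atomicNorm (bpWeight (p' := p') (μ := μ)) bpAtom

lemma BpNorm_eq (f : G → ℂ) : BpNorm p' μ f = (bpENorm p' μ f).toReal := by
  rw [bpENorm, ← sInf_expansion_eq_toReal_atomicNorm, BpNorm]
  congr 1
  ext r
  constructor
  · rintro ⟨π, hπ, ξ, φ, hr, hs⟩
    exact ⟨fun n => ⟨⟨π n, hπ n⟩, ξ n, φ n⟩, hr, hs⟩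
  · rintro ⟨s, hr, hs⟩
    exact ⟨fun n => (s n).1.1, fun n => (s n).1.2, fun n => (s n).2.1, fun n => (s n).2.2, hr, hs⟩

lemma nnnorm_bpAtom_le (i : BpIndex p' μ) (x : G) : ‖bpAtom i x‖₊ ≤ bpWeight i := by
  have h := i.2.2.le_opNorm (i.1.1.hom x i.2.1)
  rw [LinearIsometryEquiv.norm_map, mul_comm] at h
  exact h

variable [IsTopologicalGroup G] [LocallyCompactSpace G] [BorelSpace G]
  [IsFiniteMeasureOnCompacts μ] [μ.IsOpenPosMeasure]

/-- A vector generates a cyclic subrepresentation, which again acts on a `QSL`-space. -/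
lemma bpENorm_coefficient_le {π : BanachRep G} (hπ : π ∈ QSLRep p' G) (ξ : π.carrier)
    (φ : StrongDual ℂ π.carrier) :
    bpENorm p' μ (fun x => φ (π.hom x ξ)) ≤ ‖ξ‖ₑ * ‖φ‖ₑ := by
  let S : Submodule ℂ π.carrier := Submodule.span ℂ (Set.range fun x => π.hom x ξ)
  have hinvS : ∀ x, ∀ v ∈ S, π.hom x v ∈ S := fun x v hv => by
    have h1 : S ≤ S.comap (π.hom x).toLinearEquiv.toLinearMap := by
      refine Submodule.span_le.2 ?_
      rintro _ ⟨y, rfl⟩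
      exact Submodule.subset_span ⟨x * y, π.hom_mul_apply x y ξ⟩
    exact h1 hv
  have hinv : ∀ x, ∀ v ∈ S.topologicalClosure, π.hom x v ∈ S.topologicalClosure := fun x v hv =>
    map_mem_closure (π.hom x).continuous hv (hinvS x)
  have hcl : IsClosed (S.topologicalClosure : Set π.carrier) := S.isClosed_topologicalClosure
  let ρ : BanachRep G := π.restrict S.topologicalClosure hcl hinv
  have hξ : ξ ∈ S.topologicalClosure :=
    S.le_topologicalClosure (Submodule.subset_span ⟨1, π.hom_one_apply ξ⟩)
  let ξ' : ρ.carrier := ⟨ξ, hξ⟩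
  let φ' : StrongDual ℂ ρ.carrier := φ.comp S.topologicalClosure.subtypeL
  have hρ : ρ ∈ CycQSLRep p' μ := by
    refine ⟨IsQSL.submodule hπ hcl, ρ.isCyclic_of_dense_span μ ξ' ?_⟩
    have h1 : ∀ v ∈ S, ∀ hv : v ∈ S.topologicalClosure, (⟨v, hv⟩ : S.topologicalClosure) ∈
        Submodule.span ℂ (Set.range fun x => ρ.hom x ξ') := by
      intro v hv
      refine Submodule.span_induction (p := fun v _ => ∀ hv : v ∈ S.topologicalClosure,
        (⟨v, hv⟩ : S.topologicalClosure) ∈ Submodule.span ℂ (Set.range fun x => ρ.hom x ξ'))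
        ?_ ?_ ?_ ?_ hv
      · rintro _ ⟨x, rfl⟩ hx
        exact Submodule.subset_span ⟨x, rfl⟩
      · exact fun _ => Submodule.zero_mem _
      · intro v w hv hw ihv ihw _
        exact Submodule.add_mem _ (ihv (S.le_topologicalClosure hv))
          (ihw (S.le_topologicalClosure hw))
      · intro c v hv ihv _
        exact Submodule.smul_mem _ c (ihv (S.le_topologicalClosure hv))
    intro v
    refine closure_subtype.2 ?_
    refine closure_mono (fun w hw => ?_) v.2
    exact ⟨⟨w, S.le_topologicalClosure hw⟩, h1 w hw _, rfl⟩
  have h0 : HasZeroAtom (bpWeight (p' := p') (μ := μ)) bpAtom := by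
    refine ⟨⟨⟨ρ, hρ⟩, 0, 0⟩, by simp [bpWeight], ?_⟩
    ext x
    rfl
  refine (atomicNorm_atom_le h0 ⟨⟨ρ, hρ⟩, ξ', φ'⟩).trans ?_
  change ((‖ξ'‖₊ * ‖φ'‖₊ : ℝ≥0) : ℝ≥0∞) ≤ _
  rw [ENNReal.coe_mul, ← enorm_eq_nnnorm, ← enorm_eq_nnnorm]
  refine mul_le_mul' le_rfl ?_
  rw [← ofReal_norm, ← ofReal_norm]
  refine ENNReal.ofReal_le_ofReal ?_
  exact ContinuousLinearMap.opNorm_le_bound φ' (norm_nonneg φ) fun e => φ.le_opNorm _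

lemma bpENorm_ne_top {f : G → ℂ} (hf : f ∈ BpSpace p' G) : bpENorm p' μ f ≠ ∞ := by
  obtain ⟨π, hπ, ξ, φ, h⟩ := hf
  rw [funext h]
  exact ((bpENorm_coefficient_le hπ ξ φ).trans_lt
    (ENNReal.mul_lt_top enorm_lt_top enorm_lt_top)).ne

end Bp

/-! ### Multiplication by coefficients -/

section Multiplication

open scoped NNReal

variable {G : Type u} [Group G] [TopologicalSpace G] [IsTopologicalGroup G]
  [LocallyCompactSpace G] [T2Space G] [MeasurableSpace G] [BorelSpace G]

/-- The elements of `L_q(G)` that vanish off a compact set. -/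
def compactlySupportedLp (q : ℝ≥0∞) (μ : Measure G) : AddSubgroup (Lp ℂ q μ) where
  carrier := {f | ∃ K : Set G, IsCompact K ∧ ∀ᵐ x ∂μ, x ∉ K → f x = 0}
  zero_mem' := ⟨∅, isCompact_empty, (Lp.coeFn_zero ℂ q μ).mono fun x hx _ => hx⟩
  add_mem' := by
    rintro f g ⟨K, hK, hf⟩ ⟨L, hL, hg⟩
    refine ⟨K ∪ L, hK.union hL, ?_⟩
    filter_upwards [hf, hg, Lp.coeFn_add f g] with x h1 h2 h3 hx
    rw [h3, Pi.add_apply, h1 (fun h => hx (Or.inl h)), h2 (fun h => hx (Or.inr h)), add_zero]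
  neg_mem' := by
    rintro f ⟨K, hK, hf⟩
    refine ⟨K, hK, ?_⟩
    filter_upwards [hf, Lp.coeFn_neg f] with x h1 h2 hx
    rw [h2, Pi.neg_apply, h1 hx, neg_zero]

/-- This holds for indicator functions by inner regularity. The density of continuous functions with
compact support in Mathlib is not available, as it assumes a normal space. -/
lemma dense_compactlySupportedLp {q : ℝ≥0∞} [Fact (1 ≤ q)] (hq : q ≠ ∞) (μ : Measure G)
    [μ.Regular] : Dense (compactlySupportedLp q μ : Set (Lp ℂ q μ)) := by
  intro f
  rw [EMetric.mem_closure_iff]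
  intro ε hε
  obtain ⟨δ, hδ, hδε⟩ := exists_between hε
  obtain ⟨g, hfg, hgm, K, hK, hgK⟩ := (Lp.memLp f).induction_dense hq
    (P := fun g => MemLp g q μ ∧ ∃ K : Set G, IsCompact K ∧ ∀ x ∉ K, g x = 0)
    (fun c t ht htμ η hη => by
      obtain ⟨κ, hκ, hκη⟩ := exists_eLpNorm_indicator_le (μ := μ) hq c hη
      obtain ⟨K, hKt, hK, hKcl, hμK⟩ :=
        ht.exists_isCompact_isClosed_sdiff_lt htμ.ne (ENNReal.coe_pos.2 hκ).ne'
      refine ⟨K.indicator fun _ => c, ?_, memLp_indicator_const q hKcl.measurableSet c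
        (Or.inr ((measure_mono hKt).trans_lt htμ).ne), K, hK,
        fun x hx => Set.indicator_of_notMem hx _⟩
      rw [← eLpNorm_neg, neg_sub, ← Set.indicator_sdiff hKt]
      exact hκη _ hμK.le)
    (by
      rintro f g ⟨hf, K, hK, hfK⟩ ⟨hg, L, hL, hgL⟩
      refine ⟨hf.add hg, K ∪ L, hK.union hL, fun x hx => ?_⟩
      rw [Pi.add_apply, hfK x fun h => hx (Or.inl h), hgL x fun h => hx (Or.inr h), add_zero])
    (fun f hf => hf.1.1) hδ.ne'
  refine ⟨hgm.toLp g, ⟨K, hK, ?_⟩, ?_⟩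
  · filter_upwards [hgm.coeFn_toLp] with x hx hxK
    rw [hx, hgK x hxK]
  · rw [Lp.edist_def]
    refine lt_of_le_of_lt (le_trans (le_of_eq (eLpNorm_congr_ae ?_)) hfg) hδε
    filter_upwards [hgm.coeFn_toLp] with x hx
    rw [Pi.sub_apply, Pi.sub_apply, hx]

/-- A function that vanishes off a compact set stays strongly measurable when multiplied by a
continuous vector-valued function, although the latter need not be strongly measurable. -/
lemma aestronglyMeasurable_smul_of_compact {E : Type*} [NormedAddCommGroup E] [NormedSpace ℂ E]
    {μ : Measure G} {ξ : G → ℂ} (hξ : AEStronglyMeasurable ξ μ) {K : Set G} (hK : IsCompact K)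
    (hξK : ∀ᵐ x ∂μ, x ∉ K → ξ x = 0) {c : G → E} (hc : Continuous c) :
    AEStronglyMeasurable (fun x => ξ x • c x) μ := by
  have h1 : AEStronglyMeasurable c (μ.restrict K) :=
    hc.continuousOn.aestronglyMeasurable_of_isCompact hK hK.measurableSet
  have h2 : AEStronglyMeasurable (K.indicator fun x => ξ x • c x) μ :=
    (aestronglyMeasurable_indicator_iff hK.measurableSet).2 (hξ.restrict.smul h1)
  refine h2.congr ?_
  filter_upwards [hξK] with x hx
  by_cases h : x ∈ K
  · rw [Set.indicator_of_mem h]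
  · rw [Set.indicator_of_notMem h, hx h, zero_smul]

variable {p p' : ℝ≥0∞} [Fact (1 ≤ p)] [Fact (1 ≤ p')] {μ : Measure G} [μ.IsMulLeftInvariant]
  [μ.Regular] [p.HolderConjugate p']

lemma apAtom_eq_lpFunctional (ξ : Lp ℂ p' μ) (φ : Lp ℂ p μ) (x : G) :
    apAtom μ (ξ, φ) x = lpFunctional φ (leftTranslation μ ℂ p' x ξ) := by
  rw [lpFunctional_apply, apAtom]
  refine integral_congr_ae ?_
  filter_upwards [coeFn_leftTranslation x ξ] with y hy
  rw [hy]

/-- Fell's trick: the product of a coefficient `⟨λ(x) ξ, φ⟩` of the regular representation and a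
coefficient `⟨π(x) η, ψ⟩` is the coefficient `∫ ⟨F(x⁻¹ y), Φ(y)⟩ dy` of translation on `L_{p'}(G,
E)`, where `F(z) = ξ(z) π(z⁻¹) η` and `Φ(y) = φ(y) π(y)* ψ`. -/
lemma apAtom_mul_coefficient (π : BanachRep G) (η : π.carrier)
    (ψ : StrongDual ℂ π.carrier) (ξ : Lp ℂ p' μ) (φ : Lp ℂ p μ) :
    (fun x => apAtom μ (ξ, φ) x * ψ (π.hom x η)) =
      crossCoeff μ (fun y => φ y • ψ.comp (π.hom y).toContinuousLinearEquiv.toContinuousLinearMap)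
        (fun z => ξ z • π.hom z⁻¹ η) := by
  ext x
  rw [apAtom, crossCoeff, ← integral_mul_const]
  refine integral_congr_ae (Filter.Eventually.of_forall fun y => ?_)
  have h : π.hom y (π.hom (x⁻¹ * y)⁻¹ η) = π.hom x η := by
    rw [← π.hom_mul_apply]
    simp
  change ξ (x⁻¹ * y) * φ y * ψ (π.hom x η) = φ y * ψ (π.hom y (ξ (x⁻¹ * y) • π.hom (x⁻¹ * y)⁻¹ η))
  rw [map_smul, map_smul, h, smul_eq_mul]
  ring

/-- The estimate for products of single coefficients. It suffices to treat `ξ` vanishing off a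
compact set, which makes `z ↦ ξ(z) π(z⁻¹) η` strongly measurable. -/
lemma apENorm_apAtom_mul_coefficient_le (hp : 1 < p) (hp_top : p < ∞) (hp' : p' ≠ ∞)
    {π : BanachRep G} (hπ : π ∈ QSLRep p' G) (η : π.carrier) (ψ : StrongDual ℂ π.carrier)
    (i : Lp ℂ p' μ × Lp ℂ p μ) :
    apENorm p p' μ (apAtom μ i * fun x => ψ (π.hom x η)) ≤ apWeight μ i * (‖η‖ₑ * ‖ψ‖ₑ) := by
  obtain ⟨ξ, φ⟩ := i
  have hE : IsLqApproximable p.toReal p'.toReal π.carrier := by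
    refine IsQSL.isLqApproximable hp' ?_ hπ
    refine ENNReal.HolderConjugate.toReal ?_
    rw [← ENNReal.toReal_one]
    exact (ENNReal.toReal_lt_toReal ENNReal.one_ne_top hp_top.ne).2 hp
  have hη : Continuous fun z => π.hom z⁻¹ η := (π.continuous_hom η).comp continuous_inv
  have key := atomicNorm_le_of_dense (nnnorm_apAtom_le (p := p) (p' := p') μ)
    (compactlySupportedLp p' μ) (dense_compactlySupportedLp hp' μ)
    (fun ξ x => apAtom μ (ξ, φ) x * ψ (π.hom x η)) (fun a b x => by
      simp only [apAtom_eq_lpFunctional, map_add, add_mul])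
    (c := ‖φ‖₊ * (‖η‖₊ * ‖ψ‖₊)) (fun a x => ?_) ?_ ξ
  · refine key.trans_eq ?_
    simp only [apWeight, ENNReal.coe_mul, enorm_eq_nnnorm]
    ring
  · rw [enorm_mul]
    have h1 : ‖apAtom μ (a, φ) x‖ₑ ≤ ‖a‖ₑ * ‖φ‖ₑ := by
      have := ENNReal.coe_le_coe.2 (nnnorm_apAtom_le μ (a, φ) x)
      rwa [apWeight, ENNReal.coe_mul] at this
    have h2 : ‖ψ (π.hom x η)‖ₑ ≤ ‖ψ‖ₑ * ‖η‖ₑ := by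
      have := ψ.le_opENorm (π.hom x η)
      rwa [← ofReal_norm (π.hom x η), LinearIsometryEquiv.norm_map, ofReal_norm] at this
    refine (mul_le_mul' h1 h2).trans_eq ?_
    simp only [ENNReal.coe_mul, enorm_eq_nnnorm]
    ring
  · rintro a ⟨K, hK, haK⟩
    rw [apAtom_mul_coefficient]
    have hFm := aestronglyMeasurable_smul_of_compact (Lp.aestronglyMeasurable a) hK haK hη
    have hFn : eLpNorm (fun z => a z • π.hom z⁻¹ η) p' μ ≤ ‖η‖ₑ * ‖a‖ₑ := by
      rw [Lp.enorm_def, ← ofReal_norm]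
      refine eLpNorm_le_mul_eLpNorm_of_ae_le_mul (Filter.Eventually.of_forall fun z => ?_) _
      rw [norm_smul, LinearIsometryEquiv.norm_map, mul_comm]
    have hF : MemLp (fun z => a z • π.hom z⁻¹ η) p' μ :=
      ⟨hFm, hFn.trans_lt (ENNReal.mul_lt_top enorm_lt_top enorm_lt_top)⟩
    have hk : MemLp (fun y => ‖ψ‖ * ‖φ y‖) p μ := (Lp.memLp φ).norm.const_mul _
    refine (apENorm_crossCoeff_le hp hp_top hE hp' hF (fun e => ?_) hk fun y => ?_).trans ?_
    · refine (Lp.aestronglyMeasurable φ).mul ?_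
      exact (ψ.continuous.comp (π.continuous_hom e)).aestronglyMeasurable
    · rw [norm_smul, mul_comm]
      refine mul_le_mul_of_nonneg_right ?_ (norm_nonneg _)
      refine ContinuousLinearMap.opNorm_le_bound _ (norm_nonneg _) fun e => ?_
      refine (ψ.le_opNorm _).trans_eq ?_
      exact congrArg _ ((π.hom y).norm_map e)
    · have h1 : eLpNorm (fun y => ‖ψ‖ * ‖φ y‖) p μ ≤ ‖ψ‖ₑ * ‖φ‖ₑ := by
        rw [Lp.enorm_def, ← ofReal_norm]
        refine eLpNorm_le_mul_eLpNorm_of_ae_le_mul (Filter.Eventually.of_forall fun z => ?_) _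
        simp
      refine (mul_le_mul' hFn h1).trans_eq ?_
      simp only [ENNReal.coe_mul, enorm_eq_nnnorm]
      ring

theorem apENorm_mul_le (hp : 1 < p) (hp_top : p < ∞) (hp' : p' ≠ ∞) {f g : G → ℂ}
    (hf : apENorm p p' μ f ≠ ∞) (hg : bpENorm p' μ g ≠ ∞) :
    apENorm p p' μ (f * g) ≤ apENorm p p' μ f * bpENorm p' μ g := by
  refine atomicNorm_mul_le (nnnorm_apAtom_le μ) (fun i j => ?_) hf hg
  refine (apENorm_apAtom_mul_coefficient_le hp hp_top hp' j.1.2.1 j.2.1 j.2.2 i).trans_eq ?_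
  rw [bpWeight, ENNReal.coe_mul]
  rfl

end Multiplication

/-! ### Countably many copies of a measure -/

section Copies

open scoped NNReal

/-- On a set of finite measure, the measures are inner regular, and so is their sum. -/
lemma innerRegularCompactLTTop_sum {X : Type*} [TopologicalSpace X] [MeasurableSpace X]
    [BorelSpace X] [R1Space X] (ν : ℕ → Measure X) [∀ n, (ν n).InnerRegularCompactLTTop] :
    (Measure.sum ν).InnerRegularCompactLTTop := by
  constructor
  rintro s ⟨hs, hνs⟩ r hr
  have hfin : ∀ n, IsFiniteMeasure ((ν n).restrict s) := fun n =>
    ⟨by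
      rw [Measure.restrict_apply_univ]
      exact (Measure.le_sum_apply ν s |>.trans' (ENNReal.le_tsum n)).trans_lt hνs.lt_top⟩
  rw [← Measure.restrict_apply_self, Measure.restrict_sum _ hs] at hr
  obtain ⟨K, hKs, hK, hrK⟩ := hs.exists_lt_isCompact hr
  refine ⟨K, hKs, hK, hrK.trans_le ?_⟩
  rw [← Measure.restrict_sum _ hs]
  exact Measure.restrict_apply_le _ _

variable {G : Type u} [MeasurableSpace G]

/-- The measure on `ℕ × G` that restricts to `μ` on each copy `{n} × G`. It is used instead of the
product of the counting measure and `μ` because `μ` need not be `σ`-finite. -/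
noncomputable def copies (μ : Measure G) : Measure (ℕ × G) :=
  Measure.sum fun n => μ.map (Prod.mk n)

variable {μ : Measure G}

lemma aestronglyMeasurable_copies {f : ℕ → G → ℂ} (hf : ∀ n, AEStronglyMeasurable (f n) μ) :
    AEStronglyMeasurable (fun z : ℕ × G => f z.1 z.2) (copies μ) := by
  rw [copies, aestronglyMeasurable_sum_measure_iff]
  exact fun n => ((measurableEmbedding_prodMk_left n).aestronglyMeasurable_map_iff).2 (hf n)

lemma lintegral_copies (f : ℕ × G → ℝ≥0∞) :
    ∫⁻ z, f z ∂(copies μ) = ∑' n, ∫⁻ y, f (n, y) ∂μ := by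
  rw [copies, lintegral_sum_measure]
  exact tsum_congr fun n => (measurableEmbedding_prodMk_left n).lintegral_map f

lemma eLpNorm_rpow_toReal {X E : Type*} [MeasurableSpace X] [NormedAddCommGroup E] {ν : Measure X}
    {q : ℝ≥0∞} (hq0 : q ≠ 0) (hq : q ≠ ∞) (f : X → E) :
    eLpNorm f q ν ^ q.toReal = ∫⁻ x, ‖f x‖ₑ ^ q.toReal ∂ν := by
  rw [eLpNorm_eq_lintegral_rpow_enorm_toReal hq0 hq, ← ENNReal.rpow_mul,
    one_div_mul_cancel (ENNReal.toReal_pos hq0 hq).ne', ENNReal.rpow_one]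

lemma memLp_copies {q : ℝ≥0∞} (hq0 : q ≠ 0) (hq : q ≠ ∞) (f : ℕ → Lp ℂ q μ)
    (hsum : ∑' n, ‖f n‖ₑ ^ q.toReal ≠ ∞) : MemLp (fun z : ℕ × G => f z.1 z.2) q (copies μ) := by
  refine ⟨aestronglyMeasurable_copies (f := fun n y => f n y) fun n =>
    Lp.aestronglyMeasurable (f n), ?_⟩
  rw [eLpNorm_lt_top_iff_lintegral_rpow_enorm_lt_top hq0 hq, lintegral_copies]
  simp_rw [Lp.enorm_def, eLpNorm_rpow_toReal hq0 hq] at hsum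
  exact hsum.lt_top

lemma hasSum_integral_copies {f : ℕ × G → ℂ} (hf : Integrable f (copies μ)) :
    HasSum (fun n => ∫ y, f (n, y) ∂μ) (∫ z, f z ∂(copies μ)) := by
  refine (hasSum_integral_measure hf).congr_fun fun n => ?_
  exact ((measurableEmbedding_prodMk_left n).integral_map f).symm

variable [Group G] [TopologicalSpace G] [IsTopologicalGroup G] [BorelSpace G]

/-- The action of `G` by left multiplication on each copy in `ℕ × G`. -/
def copiesHom (G : Type u) [Group G] [TopologicalSpace G] [IsTopologicalGroup G] :
    G →* (ℕ × G ≃ₜ ℕ × G) where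
  toFun x := (Homeomorph.refl ℕ).prodCongr (Homeomorph.mulLeft x)
  map_one' := by ext z <;> simp
  map_mul' x y := by ext z <;> simp [mul_assoc]

lemma measurePreserving_copiesHom [μ.IsMulLeftInvariant] (x : G) :
    MeasurePreserving (copiesHom G x) (copies μ) (copies μ) := by
  refine ⟨(copiesHom G x).continuous.measurable, ?_⟩
  have hm : Measurable (copiesHom G x) := (copiesHom G x).continuous.measurable
  ext s hs
  rw [Measure.map_apply hm hs, copies, Measure.sum_apply _ (hm hs), Measure.sum_apply _ hs]
  refine tsum_congr fun n => ?_
  rw [Measure.map_apply measurable_prodMk_left (hm hs), Measure.map_apply measurable_prodMk_left hs,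
    
    ← measure_preimage_mul μ x (Prod.mk n ⁻¹' s)]
  rfl

lemma isLocallyFiniteMeasure_copies [IsLocallyFiniteMeasure μ] :
    IsLocallyFiniteMeasure (copies μ) := by
  refine ⟨fun z => ?_⟩
  obtain ⟨U, hU, hUo, hμU⟩ := μ.exists_isOpen_measure_lt_top z.2
  refine ⟨{z.1} ×ˢ U, (isOpen_discrete _ |>.prod hUo).mem_nhds ⟨rfl, hU⟩, ?_⟩
  have hs : MeasurableSet ({z.1} ×ˢ U : Set (ℕ × G)) :=
    (measurableSet_singleton _).prod hUo.measurableSet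
  rw [copies, Measure.sum_apply _ hs, tsum_eq_single z.1]
  · rw [Measure.map_apply measurable_prodMk_left hs]
    refine (measure_mono ?_).trans_lt hμU
    exact fun y hy => hy.2
  · intro n hn
    rw [Measure.map_apply measurable_prodMk_left hs]
    refine measure_mono_null (t := ∅) (fun y hy => hn hy.1) measure_empty

lemma innerRegularCompactLTTop_copies [T2Space G] [μ.InnerRegularCompactLTTop] :
    (copies μ).InnerRegularCompactLTTop := by
  have h (n : ℕ) : (μ.map (Prod.mk n)).InnerRegularCompactLTTop :=
    Measure.InnerRegularCompactLTTop.map_of_continuous (by fun_prop)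
  exact innerRegularCompactLTTop_sum _

end Copies

/-! ### The inclusion of `A_p(G)` in `B_p(G)` -/

section Inclusion

open scoped NNReal

variable {G : Type u} [Group G] [TopologicalSpace G] [IsTopologicalGroup G]
  [LocallyCompactSpace G] [T2Space G] [MeasurableSpace G] [BorelSpace G]
  {p p' : ℝ≥0∞} [Fact (1 ≤ p)] [Fact (1 ≤ p')] {μ : Measure G} [μ.IsMulLeftInvariant]
  [μ.Regular] [p.HolderConjugate p']

lemma leftRegularRep_mem_QSLRep (hp' : p' ≠ ∞) : leftRegularRep μ hp' ∈ QSLRep p' G :=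
  isQSL_Lp μ

lemma bpENorm_apAtom_le [μ.IsOpenPosMeasure] (hp' : p' ≠ ∞) (i : Lp ℂ p' μ × Lp ℂ p μ) :
    bpENorm p' μ (apAtom μ i) ≤ apWeight μ i := by
  have h := bpENorm_coefficient_le (μ := μ) (leftRegularRep_mem_QSLRep (μ := μ) hp')
    (show (leftRegularRep μ hp').carrier from i.1) (lpFunctional i.2)
  have h2 : apAtom μ i = fun x => lpFunctional i.2 (leftTranslation μ ℂ p' x i.1) :=
    funext fun x => apAtom_eq_lpFunctional i.1 i.2 x
  have h3 : ‖i.1‖ₑ * ‖(lpFunctional i.2 : StrongDual ℂ (Lp ℂ p' μ))‖ₑ ≤ apWeight μ i := by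
    rw [apWeight, ENNReal.coe_mul, ← enorm_eq_nnnorm, ← enorm_eq_nnnorm]
    refine mul_le_mul' le_rfl ?_
    rw [← ofReal_norm, ← ofReal_norm]
    exact ENNReal.ofReal_le_ofReal (norm_lpFunctional_le i.2)
  rw [h2]
  exact h.trans h3

theorem bpENorm_le_apENorm [μ.IsOpenPosMeasure] (hp' : p' ≠ ∞) (f : G → ℂ) :
    bpENorm p' μ f ≤ apENorm p p' μ f := by
  refine le_of_forall_gt fun r hr => ?_
  obtain ⟨s, hs, hsr⟩ := exists_expansion_of_atomicNorm_lt hr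
  refine lt_of_le_of_lt ?_ hsr
  refine (atomicNorm_le_tsum_atomicNorm nnnorm_bpAtom_le hs).trans ?_
  exact ENNReal.tsum_le_tsum fun n => bpENorm_apAtom_le hp' (s n)

/-- The two vectors of an atom can be rescaled such that the powers of their norms are bounded by
the weight of the atom. -/
lemma exists_apAtom_eq_norm_rpow_le (hp : 1 < p) (hp_top : p < ∞)
    (i : Lp ℂ p' μ × Lp ℂ p μ) :
    ∃ j : Lp ℂ p' μ × Lp ℂ p μ, apAtom μ j = apAtom μ i ∧
      ‖j.1‖ₑ ^ p'.toReal ≤ apWeight μ i ∧ ‖j.2‖ₑ ^ p.toReal ≤ apWeight μ i := by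
  obtain ⟨ξ, φ⟩ := i
  have hpp : p.toReal.HolderConjugate p'.toReal := by
    refine ENNReal.HolderConjugate.toReal ?_
    rw [← ENNReal.toReal_one]
    exact (ENNReal.toReal_lt_toReal ENNReal.one_ne_top hp_top.ne).2 hp
  set w : ℝ := ‖ξ‖ * ‖φ‖ with hw
  have hw0 : 0 ≤ w := by positivity
  have key : ∀ {V : Type u} [NormedAddCommGroup V] [NormedSpace ℂ V] (v : V) (r : ℝ), 0 < r →
      ‖((w ^ r⁻¹ / ‖v‖ : ℝ) : ℂ) • v‖ₑ ^ r ≤ apWeight μ (ξ, φ) := by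
    intro V _ _ v r hr
    have h1 : ‖((w ^ r⁻¹ / ‖v‖ : ℝ) : ℂ) • v‖ ≤ w ^ r⁻¹ := by
      rw [norm_smul, Complex.norm_real, Real.norm_of_nonneg (by positivity)]
      rcases eq_or_ne ‖v‖ 0 with h | h
      · rw [h, mul_zero]
        positivity
      · exact (div_mul_cancel₀ _ h).le
    have h2 : (apWeight μ (ξ, φ) : ℝ≥0∞) = ENNReal.ofReal w := by
      rw [apWeight, hw, ENNReal.ofReal_mul (norm_nonneg _), ofReal_norm, ofReal_norm,
        ENNReal.coe_mul, enorm_eq_nnnorm, enorm_eq_nnnorm]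
    rw [h2, ← ofReal_norm, ENNReal.ofReal_rpow_of_nonneg (norm_nonneg _) hr.le]
    refine ENNReal.ofReal_le_ofReal ((Real.rpow_le_rpow (norm_nonneg _) h1 hr.le).trans_eq ?_)
    rw [← Real.rpow_mul hw0, inv_mul_cancel₀ hr.ne', Real.rpow_one]
  refine ⟨(((w ^ p'.toReal⁻¹ / ‖ξ‖ : ℝ) : ℂ) • ξ, ((w ^ p.toReal⁻¹ / ‖φ‖ : ℝ) : ℂ) • φ), ?_,
    key ξ _ hpp.symm.pos, key φ _ hpp.pos⟩
  ext x
  rcases hw0.eq_or_lt with h0 | h0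
  · -- both atoms vanish
    have h1 : apAtom μ (ξ, φ) x = 0 := by
      have h := nnnorm_apAtom_le μ (ξ, φ) x
      have h2 : apWeight μ (ξ, φ) = 0 := by
        rw [← NNReal.coe_eq_zero]
        exact h0.symm
      rw [h2] at h
      exact nnnorm_eq_zero.1 (le_antisymm h zero_le)
    rw [h1, ← h0, Real.zero_rpow (inv_ne_zero hpp.symm.ne_zero), zero_div, Complex.ofReal_zero,
      zero_smul, apAtom_eq_lpFunctional, map_zero, map_zero]
  · have h1 : ((w ^ p'.toReal⁻¹ / ‖ξ‖ : ℝ) : ℂ) * ((w ^ p.toReal⁻¹ / ‖φ‖ : ℝ) : ℂ) = 1 := by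
      rw [← Complex.ofReal_mul, div_mul_div_comm, ← Real.rpow_add h0, add_comm,
        hpp.inv_add_inv_eq_one, Real.rpow_one, ← hw, div_self h0.ne', Complex.ofReal_one]
    rw [apAtom_eq_lpFunctional, apAtom_eq_lpFunctional, map_smul, map_smul, lpFunctional,
      map_smul, smul_apply, smul_smul, h1, one_smul]
    rfl

/-- Every function in `A_p(G)` is a coefficient of the representation by translations on
`L_{p'}(ℕ × G)`, the `ℓ_{p'}`-sum of countably many copies of the regular representation. -/
theorem mem_BpSpace_of_apENorm_ne_top (hp : 1 < p) (hp_top : p < ∞) (hp' : p' ≠ ∞) {f : G → ℂ}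
    (hf : apENorm p p' μ f ≠ ∞) : f ∈ BpSpace p' G := by
  obtain ⟨s, hs, hsf⟩ := exists_expansion_of_atomicNorm_lt hf.lt_top
  choose j hj hj1 hj2 using fun n => exists_apAtom_eq_norm_rpow_le (μ := μ) hp hp_top (s n)
  have hξ : MemLp (fun z : ℕ × G => (j z.1).1 z.2) p' (copies μ) :=
    memLp_copies (zero_lt_one.trans_le Fact.out).ne' hp' (fun n => (j n).1)
      ((ENNReal.tsum_le_tsum hj1).trans_lt hsf).ne
  have hφ : MemLp (fun z : ℕ × G => (j z.1).2 z.2) p (copies μ) :=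
    memLp_copies (zero_lt_one.trans hp).ne' hp_top.ne (fun n => (j n).2)
      ((ENNReal.tsum_le_tsum hj2).trans_lt hsf).ne
  have := isLocallyFiniteMeasure_copies (μ := μ)
  have := innerRegularCompactLTTop_copies (μ := μ)
  let π : BanachRep G :=
    { carrier := Lp ℂ p' (copies μ)
      hom := lpTranslation ℂ p' (copiesHom G) measurePreserving_copiesHom
      continuous_hom := continuous_lpTranslation hp'
        ((continuous_fst.comp continuous_snd).prodMk
          (continuous_fst.mul (continuous_snd.comp continuous_snd))) }
  refine ⟨π, isQSL_Lp _, hξ.toLp _, lpFunctional (hφ.toLp _), fun x => ?_⟩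
  change f x = lpFunctional (hφ.toLp _) (lpTranslation ℂ p' (copiesHom G)
    measurePreserving_copiesHom x (hξ.toLp _))
  have hT := measurePreserving_copiesHom (μ := μ) x⁻¹
  have h1 : lpFunctional (hφ.toLp _) (lpTranslation ℂ p' (copiesHom G)
      measurePreserving_copiesHom x (hξ.toLp _)) =
      ∫ z : ℕ × G, (j z.1).1 (x⁻¹ * z.2) * (j z.1).2 z.2 ∂(copies μ) := by
    rw [lpFunctional_apply]
    refine integral_congr_ae ?_
    filter_upwards [coeFn_lpTranslation (hT := measurePreserving_copiesHom) x (hξ.toLp _),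
      hT.quasiMeasurePreserving.ae hξ.coeFn_toLp, hφ.coeFn_toLp] with z h1 h2 h3
    rw [h1, h2, h3]
    rfl
  have hint : Integrable (fun z : ℕ × G => (j z.1).1 (x⁻¹ * z.2) * (j z.1).2 z.2) (copies μ) :=
    (hξ.comp_measurePreserving hT).integrable_mul hφ
  rw [h1]
  refine (hs x).unique ?_
  refine (hasSum_integral_copies hint).congr_fun fun n => ?_
  rw [← hj n]
  rfl

end Inclusion

/-! ### Invariant means and convolution -/

section InvariantMean

open scoped CompactlySupported NNReal Pointwise

variable {G : Type u} [Group G] [TopologicalSpace G] [IsTopologicalGroup G]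
  [LocallyCompactSpace G] [MeasurableSpace G] [BorelSpace G]
  (μ : Measure G) [μ.IsHaarMeasure]

lemma integrable_compactlySupported_mul (a : C_c(G, ℝ)) {g : G → ℝ} (hg : Continuous g) :
    Integrable (fun x => a x * g x) μ :=
  (a.continuous.mul hg).integrable_of_hasCompactSupport a.hasCompactSupport.mul_right

/-- The convolution `z ↦ ∫ a(x) f(x⁻¹ z) dx` of a compactly supported function and a bounded
continuous one. -/
noncomputable def convBounded (a : C_c(G, ℝ)) (f : G →ᵇ ℝ) : G →ᵇ ℝ :=
  BoundedContinuousFunction.ofNormedAddCommGroup (fun z => ∫ x, a x * f (x⁻¹ * z) ∂μ)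
    (by
      rw [← continuousOn_univ]
      refine continuousOn_integral_of_compact_support (k := tsupport a) a.hasCompactSupport
        (Continuous.continuousOn ?_) fun z x _ hx => ?_
      · exact (a.continuous.comp continuous_snd).mul
          (f.continuous.comp (continuous_snd.inv.mul continuous_fst))
      · rw [image_eq_zero_of_notMem_tsupport hx, zero_mul])
    ((∫ x, |a x| ∂μ) * ‖f‖)
    (fun z => by
      refine (norm_integral_le_integral_norm _).trans ?_
      rw [← integral_mul_const]
      refine integral_mono_of_nonneg (Filter.Eventually.of_forall fun x => norm_nonneg _) ?_
        (Filter.Eventually.of_forall fun x => ?_)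
      · exact (a.continuous.abs.integrable_of_hasCompactSupport
          (a.hasCompactSupport.comp_left (g := abs) abs_zero)).mul_const _
      · change ‖a x * f (x⁻¹ * z)‖ ≤ |a x| * ‖f‖
        rw [norm_mul]
        exact mul_le_mul_of_nonneg_left (f.norm_coe_le_norm _) (abs_nonneg _))

variable {μ}

lemma convBounded_apply (a : C_c(G, ℝ)) (f : G →ᵇ ℝ) (z : G) :
    convBounded μ a f z = ∫ x, a x * f (x⁻¹ * z) ∂μ := rfl

lemma continuous_comp_inv_mul (f : G →ᵇ ℝ) (z : G) : Continuous fun x => f (x⁻¹ * z) :=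
  f.continuous.comp (continuous_inv.mul continuous_const)

/-- The case of a nonnegative function `f`, for which `a ↦ m(a * f)` is a positive functional. It is
left invariant because translating `a` translates `a * f`. -/
lemma exists_mean_convBounded_eq_of_nonneg [T2Space G]
    {m : (G →ᵇ ℝ) →ₗ[ℝ] ℝ} (hm : ∀ f, 0 ≤ f → 0 ≤ m f)
    (hinv : ∀ (x : G) (f : G →ᵇ ℝ), m (f.compContinuous (ContinuousMap.mulLeft x)) = m f)
    {f : G →ᵇ ℝ} (hf : 0 ≤ f) :
    ∃ c : ℝ, ∀ a : C_c(G, ℝ), m (convBounded μ a f) = c * ∫ x, a x ∂μ := by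
  let L : C_c(G, ℝ) →ₗ[ℝ] ℝ :=
    { toFun := fun a => m (convBounded μ a f)
      map_add' := fun a b => by
        rw [← map_add]
        congr 1
        ext z
        rw [BoundedContinuousFunction.add_apply, convBounded_apply, convBounded_apply,
          convBounded_apply, ← integral_add
            (integrable_compactlySupported_mul μ a (continuous_comp_inv_mul f z))
            (integrable_compactlySupported_mul μ b (continuous_comp_inv_mul f z))]
        exact integral_congr_ae (Filter.Eventually.of_forall fun x => add_mul _ _ _)
      map_smul' := fun c a => by
        rw [← map_smul]
        congr 1
        ext z
        rw [BoundedContinuousFunction.smul_apply, convBounded_apply, convBounded_apply,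
          smul_eq_mul, ← integral_const_mul]
        exact integral_congr_ae (Filter.Eventually.of_forall fun x => mul_assoc _ _ _) }
  let Λ : C_c(G, ℝ) →ₚ[ℝ] ℝ := PositiveLinearMap.mk₀ L fun a ha =>
    hm _ fun z => integral_nonneg fun x => mul_nonneg (ha x) (hf _)
  let ν := RealRMK.rieszMeasure Λ
  have hν : ∀ a : C_c(G, ℝ), ∫ x, a x ∂ν = m (convBounded μ a f) :=
    RealRMK.integral_rieszMeasure Λ
  have : ν.Regular := RealRMK.regular_rieszMeasure Λ
  have : ν.IsMulLeftInvariant := by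
    refine ⟨fun y => ?_⟩
    have : (ν.map (y * ·)).Regular := Measure.Regular.map (Homeomorph.mulLeft y)
    refine Measure.ext_of_integral_eq_on_compactlySupported fun a => ?_
    let b : C_c(G, ℝ) :=
      ⟨⟨fun x => a (y * x), a.continuous.comp (continuous_const.mul continuous_id)⟩,
        a.hasCompactSupport.comp_homeomorph (Homeomorph.mulLeft y)⟩
    refine ((Homeomorph.mulLeft y).measurableEmbedding.integral_map a).trans ?_
    change ∫ x, b x ∂ν = _
    rw [hν, hν, ← hinv y (convBounded μ a f)]
    congr 1
    ext z
    change ∫ x, a (y * x) * f (x⁻¹ * z) ∂μ = ∫ x, a x * f (x⁻¹ * (y * z)) ∂μ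
    rw [← integral_mul_left_eq_self (fun x => a x * f (x⁻¹ * (y * z))) y]
    refine integral_congr_ae (Filter.Eventually.of_forall fun x => ?_)
    change a (y * x) * f (x⁻¹ * z) = a (y * x) * f ((y * x)⁻¹ * (y * z))
    congr 2
    group
  refine ⟨ν.haarScalarFactor μ, fun a => ?_⟩
  rw [← hν]
  refine (Measure.integral_isMulLeftInvariant_eq_smul_of_hasCompactSupport ν μ a.continuous
    a.hasCompactSupport).trans ?_
  rw [integral_smul_nnreal_measure, NNReal.smul_def, smul_eq_mul]
  rfl

/-- An invariant mean, applied to the convolution of `a` with a fixed bounded continuous function,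
depends on `a` only through its integral: the Riesz representation theorem provides a measure with
this functional as its integral, and this measure is a multiple of Haar measure by uniqueness. -/
lemma exists_mean_convBounded_eq [T2Space G]
    {m : (G →ᵇ ℝ) →ₗ[ℝ] ℝ} (hm : ∀ f, 0 ≤ f → 0 ≤ m f)
    (hinv : ∀ (x : G) (f : G →ᵇ ℝ), m (f.compContinuous (ContinuousMap.mulLeft x)) = m f)
    (f : G →ᵇ ℝ) : ∃ c : ℝ, ∀ a : C_c(G, ℝ), m (convBounded μ a f) = c * ∫ x, a x ∂μ := by
  have hf : 0 ≤ f + BoundedContinuousFunction.const G ‖f‖ := fun z => by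
    have := neg_le_of_abs_le (f.norm_coe_le_norm z)
    change 0 ≤ f z + ‖f‖
    linarith
  obtain ⟨c, hc⟩ := exists_mean_convBounded_eq_of_nonneg (μ := μ) hm hinv hf
  refine ⟨c - ‖f‖ * m 1, fun a => ?_⟩
  have h : convBounded μ a f = convBounded μ a (f + BoundedContinuousFunction.const G ‖f‖) -
      ((∫ x, a x ∂μ) * ‖f‖) • (1 : G →ᵇ ℝ) := by
    ext z
    change ∫ x, a x * f (x⁻¹ * z) ∂μ = ∫ x, a x * (f (x⁻¹ * z) + ‖f‖) ∂μ -
      (∫ x, a x ∂μ) * ‖f‖ * 1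
    have h1 := integrable_compactlySupported_mul μ a (continuous_comp_inv_mul f z)
    have h2 := integrable_compactlySupported_mul μ a (continuous_const (y := ‖f‖))
    simp only [mul_add]
    rw [integral_add h1 h2, integral_mul_const, mul_one, add_sub_cancel_right]
  rw [h, map_sub, map_smul, hc, smul_eq_mul]
  ring

end InvariantMean

/-! ### Almost invariant vectors in invariant convex sets -/

section AlmostInvariant

open scoped CompactlySupported NNReal Pointwise

variable {G : Type u} [Group G] [TopologicalSpace G] [IsTopologicalGroup G]
  [LocallyCompactSpace G] [MeasurableSpace G] [BorelSpace G]
  {μ : Measure G} [μ.IsHaarMeasure]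

/-- The right translate of a density by `y`, normalized to have the same integral. -/
noncomputable def rightTranslate (μ : Measure G) (k : C_c(G, ℝ)) (y : G) : C_c(G, ℝ) :=
  ⟨⟨fun x => k (x * y) / ∫ t, k (t * y) ∂μ,
      (k.continuous.comp (continuous_id.mul continuous_const)).div_const _⟩, by
    simp_rw [div_eq_mul_inv]
    exact (k.hasCompactSupport.comp_homeomorph (Homeomorph.mulRight y)).mul_right⟩

lemma rightTranslate_apply (k : C_c(G, ℝ)) (y x : G) :
    rightTranslate μ k y x = k (x * y) / ∫ t, k (t * y) ∂μ := rfl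

variable [μ.Regular] [T2Space G]

/-- Right translations multiply Haar measure by constants. -/
lemma exists_map_mul_right_eq_smul (μ : Measure G) [μ.IsHaarMeasure] [μ.Regular] (y : G) :
    ∃ c : ℝ≥0, c ≠ 0 ∧ μ.map (· * y) = c • μ := by
  have : (μ.map (· * y)).Regular := Measure.Regular.map (Homeomorph.mulRight y)
  exact ⟨(μ.map (· * y)).haarScalarFactor μ,
    (Measure.haarScalarFactor_pos_of_isHaarMeasure _ _).ne',
    Measure.isMulLeftInvariant_eq_smul_of_regular (μ.map (· * y)) μ⟩

lemma integral_mul_right_eq_smul {V : Type*} [NormedAddCommGroup V] [NormedSpace ℝ V] {y : G}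
    {c : ℝ≥0} (hc : μ.map (· * y) = c • μ) (g : G → V) :
    ∫ x, g (x * y) ∂μ = c • ∫ x, g x ∂μ := by
  rw [← integral_smul_nnreal_measure, ← hc]
  exact ((Homeomorph.mulRight y).measurableEmbedding.integral_map (μ := μ) g).symm

lemma integral_rightTranslate {k : C_c(G, ℝ)} (hk : ∫ x, k x ∂μ = 1) (y : G) :
    ∫ x, rightTranslate μ k y x ∂μ = 1 := by
  obtain ⟨c, hc0, hc⟩ := exists_map_mul_right_eq_smul μ y
  simp_rw [rightTranslate_apply]
  rw [integral_div, integral_mul_right_eq_smul hc k, hk, NNReal.smul_def, smul_eq_mul, mul_one,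
    div_self (NNReal.coe_ne_zero.2 hc0)]

/-- Right translation is continuous at the identity in the `L_1`-norm. -/
lemma eventually_integral_abs_rightTranslate_sub_lt {k : C_c(G, ℝ)} (hk : ∫ x, k x ∂μ = 1)
    {ε : ℝ} (hε : 0 < ε) :
    ∀ᶠ y in nhds (1 : G), ∫ x, |rightTranslate μ k y x - k x| ∂μ < ε := by
  obtain ⟨W, hW, hW1⟩ := exists_compact_mem_nhds (1 : G)
  have hS : IsCompact (tsupport k * W⁻¹ ∪ tsupport k) :=
    (k.hasCompactSupport.isCompact.mul hW.inv).union k.hasCompactSupport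
  have hzero : ∀ y ∈ W, ∀ x ∉ tsupport k * W⁻¹, k (x * y) = 0 := fun y hy x hx => by
    refine image_eq_zero_of_notMem_tsupport fun h => hx ?_
    exact ⟨x * y, h, y⁻¹, Set.inv_mem_inv.2 hy, by group⟩
  have hkc : Continuous fun z : G × G => k (z.2 * z.1) :=
    k.continuous.comp (continuous_snd.mul continuous_fst)
  have h1 : ContinuousOn (fun y => ∫ x, k (x * y) ∂μ) W :=
    continuousOn_integral_of_compact_support hS hkc.continuousOn
      fun y x hy hx => hzero y hy x fun h => hx (Or.inl h)
  have hne : ∀ y, ∫ x, k (x * y) ∂μ ≠ 0 := fun y => by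
    obtain ⟨c, hc0, hc⟩ := exists_map_mul_right_eq_smul μ y
    rw [integral_mul_right_eq_smul hc k, hk, NNReal.smul_def, smul_eq_mul, mul_one]
    exact NNReal.coe_ne_zero.2 hc0
  have h2 : ContinuousOn (fun y => ∫ x, |rightTranslate μ k y x - k x| ∂μ) W := by
    refine continuousOn_integral_of_compact_support hS ?_ fun y x hy hx => ?_
    · refine (ContinuousOn.sub ?_ (k.continuous.comp continuous_snd).continuousOn).abs
      exact hkc.continuousOn.div (h1.comp continuousOn_fst fun z hz => hz.1) fun z _ => hne z.1
    · rw [rightTranslate_apply, hzero y hy x fun h => hx (Or.inl h),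
        image_eq_zero_of_notMem_tsupport fun h => hx (Or.inr h), zero_div, sub_zero, abs_zero]
  have h3 : ∫ x, |rightTranslate μ k 1 x - k x| ∂μ = 0 := by
    simp [rightTranslate_apply, hk]
  have h4 := (h2 1 (mem_of_mem_nhds hW1)).continuousAt hW1
  have h5 := h4.tendsto
  rw [h3] at h5
  exact h5.eventually_lt_const hε

variable {V : Type*} [NormedAddCommGroup V] [NormedSpace ℝ V]
  {ρ : G →* (V ≃ₗᵢ[ℝ] V)}

lemma isometryHom_mul_apply (x y : G) (w : V) : ρ (x * y) w = ρ x (ρ y w) := by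
  rw [map_mul]
  rfl

/-- The vector `∫ k(x) ρ(x⁻¹) w dx`. With the inverse, translating it by `y` amounts to a right
translation of `k`, and its pairing with a functional along an orbit is a convolution with `k`. -/
noncomputable def smear (μ : Measure G) (ρ : G →* (V ≃ₗᵢ[ℝ] V)) (k : C_c(G, ℝ)) (w : V) : V :=
  ∫ x, k x • ρ x⁻¹ w ∂μ

lemma integrable_smear (hρ : ∀ w, Continuous fun x => ρ x w) (k : C_c(G, ℝ)) (w : V) :
    Integrable (fun x => k x • ρ x⁻¹ w) μ :=
  (k.continuous.smul ((hρ w).comp continuous_inv)).integrable_of_hasCompactSupport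
    k.hasCompactSupport.smul_right

lemma smear_add (hρ : ∀ w, Continuous fun x => ρ x w) (k : C_c(G, ℝ)) (v w : V) :
    smear μ ρ k (v + w) = smear μ ρ k v + smear μ ρ k w := by
  simp_rw [smear, map_add, smul_add]
  exact integral_add (integrable_smear hρ k v) (integrable_smear hρ k w)

lemma smear_smul (k : C_c(G, ℝ)) (c : ℝ) (w : V) :
    smear μ ρ k (c • w) = c • smear μ ρ k w := by
  simp_rw [smear, map_smul, smul_comm _ c]
  exact integral_smul c _

lemma norm_smear_sub_smear_le (hρ : ∀ w, Continuous fun x => ρ x w) (a b : C_c(G, ℝ)) (w : V) :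
    ‖smear μ ρ a w - smear μ ρ b w‖ ≤ (∫ x, |a x - b x| ∂μ) * ‖w‖ := by
  rw [smear, smear, ← integral_sub (integrable_smear hρ a w) (integrable_smear hρ b w),
    ← integral_mul_const]
  refine (norm_integral_le_integral_norm _).trans_eq ?_
  refine integral_congr_ae (Filter.Eventually.of_forall fun x => ?_)
  change ‖a x • ρ x⁻¹ w - b x • ρ x⁻¹ w‖ = |a x - b x| * ‖w‖
  rw [← sub_smul, norm_smul, LinearIsometryEquiv.norm_map, Real.norm_eq_abs]

variable [CompleteSpace V]

lemma map_smear {k : C_c(G, ℝ)} (hk : ∫ x, k x ∂μ = 1) (y : G) (w : V) :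
    ρ y (smear μ ρ k w) = smear μ ρ (rightTranslate μ k y) w := by
  obtain ⟨c, hc0, hc⟩ := exists_map_mul_right_eq_smul μ y
  have h1 : ρ y (smear μ ρ k w) = ∫ x, k x • ρ y (ρ x⁻¹ w) ∂μ := by
    rw [smear]
    refine ((ρ y).toContinuousLinearEquiv.integral_comp_comm _).symm.trans ?_
    exact integral_congr_ae (Filter.Eventually.of_forall fun x => map_smul (ρ y) _ _)
  have h2 := integral_mul_right_eq_smul hc fun x => k x • ρ y (ρ x⁻¹ w)
  have h3 := integral_mul_right_eq_smul hc k
  rw [hk, NNReal.smul_def, smul_eq_mul, mul_one] at h3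
  rw [← h1] at h2
  have h4 : smear μ ρ (rightTranslate μ k y) w =
      (c : ℝ)⁻¹ • ∫ x, k (x * y) • ρ y (ρ (x * y)⁻¹ w) ∂μ := by
    rw [smear, ← integral_smul]
    refine integral_congr_ae (Filter.Eventually.of_forall fun x => ?_)
    have h5 : ρ y (ρ (x * y)⁻¹ w) = ρ x⁻¹ w := by
      rw [← isometryHom_mul_apply, mul_inv_rev, mul_inv_cancel_left]
    change rightTranslate μ k y x • ρ x⁻¹ w = (c : ℝ)⁻¹ • k (x * y) • ρ y (ρ (x * y)⁻¹ w)
    rw [h5, rightTranslate_apply, h3, smul_smul, div_eq_inv_mul]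
  rw [h4, h2, NNReal.smul_def, inv_smul_smul₀ (NNReal.coe_ne_zero.2 hc0)]

/-- A closed convex invariant set contains the averages of its elements. -/
lemma smear_mem (hρ : ∀ w, Continuous fun x => ρ x w) {k : C_c(G, ℝ)} (hk0 : ∀ x, 0 ≤ k x)
    (hk : ∫ x, k x ∂μ = 1) {C : Set V} (hC : Convex ℝ C) (hCc : IsClosed C)
    (hCρ : ∀ x, ∀ w ∈ C, ρ x w ∈ C) {w : V} (hw : w ∈ C) : smear μ ρ k w ∈ C := by
  by_contra hn
  obtain ⟨ψ, u, hψC, hψ⟩ := geometric_hahn_banach_closed_point hC hCc hn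
  refine hψ.not_ge ?_
  rw [smear, ← ψ.integral_comp_comm (integrable_smear hρ k w)]
  have hki : Integrable k μ := k.continuous.integrable_of_hasCompactSupport k.hasCompactSupport
  have h : ∫ x, k x * u ∂μ = u := by rw [integral_mul_const, hk, one_mul]
  rw [← h]
  refine integral_mono (ψ.integrable_comp (integrable_smear hρ k w)) (hki.mul_const u) fun x => ?_
  change ψ (k x • ρ x⁻¹ w) ≤ k x * u
  rw [map_smul, smul_eq_mul]
  exact mul_le_mul_of_nonneg_left (hψC _ (hCρ _ w hw)).le (hk0 x)

/-- For a density `k`, finitely many translations of `k` act almost like `k` on some convex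
combination of the orbit of `u`. Otherwise a functional separates, and evaluating an invariant mean
on the resulting bounded continuous functions gives a contradiction. -/
lemma exists_mem_convexHull_norm_smear_sub_lt (hG : IsAmenableGroup G)
    (hρ : ∀ w, Continuous fun x => ρ x w) {k : C_c(G, ℝ)} (hk : ∫ x, k x ∂μ = 1) (u : V)
    {T : Type*} [Fintype T] (t : T → G) {ε : ℝ} (hε : 0 < ε) :
    ∃ w ∈ convexHull ℝ (Set.range fun z => ρ z u), ∀ j,
      ‖ρ (t j) (smear μ ρ k w) - smear μ ρ k w‖ < ε := by
  classical
  obtain ⟨m, hm, hm1, hinv⟩ := hG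
  let D : V →ₗ[ℝ] (T → V) := LinearMap.pi fun j =>
    { toFun := fun w => smear μ ρ (rightTranslate μ k (t j)) w - smear μ ρ k w
      map_add' := fun v w => by
        rw [smear_add hρ, smear_add hρ]
        abel
      map_smul' := fun c w => by
        rw [smear_smul, smear_smul, ← smul_sub]
        rfl }
  have hD : ∀ w j, D w j = smear μ ρ (rightTranslate μ k (t j)) w - smear μ ρ k w :=
    fun w j => rfl
  -- the differences of the averages, as a linear map of `w`, come close to `0` on the convex hull
  have key : (0 : T → V) ∈ closure (D '' convexHull ℝ (Set.range fun z => ρ z u)) := by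
    by_contra hn
    obtain ⟨Ψ, r, hr0, hr⟩ := geometric_hahn_banach_point_closed
      (((convex_convexHull ℝ _).linear_image D).closure) isClosed_closure hn
    rw [map_zero] at hr0
    let ψ : T → StrongDual ℝ V := fun j => Ψ.comp (ContinuousLinearMap.single ℝ (fun _ => V) j)
    have hψ : ∀ v, Ψ v = ∑ j, ψ j (v j) := fun v => by
      conv_lhs => rw [← Finset.univ_sum_single v]
      rw [map_sum]
      rfl
    let f : T → G →ᵇ ℝ := fun j => BoundedContinuousFunction.ofNormedAddCommGroup
      (fun z => ψ j (ρ z u)) ((ψ j).continuous.comp (hρ u)) (‖ψ j‖ * ‖u‖) fun z =>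
        ((ψ j).le_opNorm _).trans_eq (by rw [LinearIsometryEquiv.norm_map])
    have hf : ∀ (a : C_c(G, ℝ)) j z, ψ j (smear μ ρ a (ρ z u)) = convBounded μ a (f j) z := by
      intro a j z
      rw [smear, ← (ψ j).integral_comp_comm (integrable_smear hρ a _), convBounded_apply]
      refine integral_congr_ae (Filter.Eventually.of_forall fun x => ?_)
      change ψ j (a x • ρ x⁻¹ (ρ z u)) = a x * ψ j (ρ (x⁻¹ * z) u)
      rw [map_smul, map_mul]
      rfl
    let F : G →ᵇ ℝ := ∑ j, (convBounded μ (rightTranslate μ k (t j)) (f j) - convBounded μ k (f j))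
    have hF0 : m F = 0 := by
      rw [map_sum]
      refine Finset.sum_eq_zero fun j _ => ?_
      obtain ⟨c, hc⟩ := exists_mean_convBounded_eq (μ := μ) hm hinv (f j)
      rw [map_sub, hc, hc, integral_rightTranslate hk, hk, sub_self]
    have hFr : 0 ≤ F - r • (1 : G →ᵇ ℝ) := fun z => by
      have h1 := hr (D (ρ z u)) (subset_closure ⟨_, subset_convexHull ℝ _ ⟨z, rfl⟩, rfl⟩)
      have h2 : F z = Ψ (D (ρ z u)) := by
        rw [hψ, BoundedContinuousFunction.sum_apply]
        refine Finset.sum_congr rfl fun j _ => ?_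
        rw [hD, map_sub, hf, hf]
        rfl
      change 0 ≤ F z - r * 1
      linarith
    have := hm _ hFr
    rw [map_sub, hF0, map_smul, hm1, smul_eq_mul, mul_one] at this
    linarith
  obtain ⟨_, ⟨w, hw, rfl⟩, hwε⟩ := Metric.mem_closure_iff.1 key ε hε
  refine ⟨w, hw, fun j => ?_⟩
  rw [map_smear hk, ← hD]
  rw [dist_comm, dist_zero_right] at hwε
  exact (norm_le_pi_norm (D w) j).trans_lt hwε

/-- An amenable group has almost invariant vectors in every nonempty closed convex invariant set,
uniformly on compact sets of translations. -/
theorem exists_mem_forall_norm_sub_lt (hG : IsAmenableGroup G)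
    (hρ : ∀ w, Continuous fun x => ρ x w) {C : Set V} (hC : Convex ℝ C) (hCc : IsClosed C)
    (hCρ : ∀ x, ∀ w ∈ C, ρ x w ∈ C) (hCn : C.Nonempty) {K : Set G} (hK : IsCompact K) {ε : ℝ}
    (hε : 0 < ε) : ∃ h ∈ C, ∀ y ∈ K, ‖ρ y h - h‖ < ε := by
  obtain ⟨u, hu⟩ := hCn
  let μ : Measure G := Measure.haar
  obtain ⟨k', hk'c, hk's, hk0, -, hk⟩ := exists_bump μ (1 : G) Filter.univ_mem
  let k : C_c(G, ℝ) := ⟨⟨k', hk'c⟩, hk's⟩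
  have hk : ∫ x, k x ∂μ = 1 := hk
  -- the elements of the convex hull of the orbit of `u` have norm at most `‖u‖`
  set δ : ℝ := ε / 2 / (‖u‖ + 1) with hδ
  have hu1 : 0 < ‖u‖ + 1 := by positivity
  have hδ0 : 0 < δ := by positivity
  have hU := eventually_integral_abs_rightTranslate_sub_lt hk hδ0
  obtain ⟨t, -, ht⟩ := hK.elim_nhds_subcover
    (fun y => {x | ∫ z, |rightTranslate μ k (y⁻¹ * x) z - k z| ∂μ < δ}) fun y _ => by
      have hy : Filter.Tendsto (fun x => y⁻¹ * x) (nhds y) (nhds 1) := by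
        simpa using (continuous_const_mul y⁻¹).tendsto y
      exact hy.eventually hU
  obtain ⟨w, hw, hwt⟩ := exists_mem_convexHull_norm_smear_sub_lt (μ := μ) hG hρ hk u
    (fun j : t => (j : G)) (half_pos hε)
  have hwC : w ∈ C := convexHull_min (by rintro _ ⟨z, rfl⟩; exact hCρ z u hu) hC hw
  have hwu : ‖w‖ ≤ ‖u‖ := by
    have h : convexHull ℝ (Set.range fun z => ρ z u) ⊆ Metric.closedBall 0 ‖u‖ := by
      refine convexHull_min ?_ (convex_closedBall _ _)
      rintro _ ⟨z, rfl⟩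
      rw [mem_closedBall_zero_iff, LinearIsometryEquiv.norm_map]
    exact mem_closedBall_zero_iff.1 (h hw)
  refine ⟨smear μ ρ k w, smear_mem hρ hk0 hk hC hCc hCρ hwC, fun y hy => ?_⟩
  obtain ⟨j, hj, hyj⟩ := Set.mem_iUnion₂.1 (ht hy)
  have h1 : ‖ρ y (smear μ ρ k w) - ρ j (smear μ ρ k w)‖ < ε / 2 := by
    have h2 : ρ y (smear μ ρ k w) = ρ j (ρ (j⁻¹ * y) (smear μ ρ k w)) := by
      rw [← isometryHom_mul_apply, mul_inv_cancel_left]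
    rw [h2, ← map_sub, LinearIsometryEquiv.norm_map, map_smear hk]
    refine (norm_smear_sub_smear_le hρ _ _ w).trans_lt ?_
    calc _ ≤ δ * ‖w‖ := mul_le_mul_of_nonneg_right (le_of_lt hyj) (norm_nonneg _)
      _ < δ * (‖u‖ + 1) := mul_lt_mul_of_pos_left (by linarith) hδ0
      _ = ε / 2 := div_mul_cancel₀ _ hu1.ne'
  calc _ = ‖(ρ y (smear μ ρ k w) - ρ j (smear μ ρ k w)) +
        (ρ j (smear μ ρ k w) - smear μ ρ k w)‖ := by rw [sub_add_sub_cancel]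
    _ ≤ _ := norm_add_le _ _
    _ < ε / 2 + ε / 2 := add_lt_add h1 (hwt ⟨j, hj⟩)
    _ = ε := add_halves ε

end AlmostInvariant

/-! ### Almost invariant vectors in `L_q(G)` -/

section Roots

open scoped NNReal

lemma abs_rpow_sub_rpow_le {a b r : ℝ} (ha : 0 ≤ a) (hb : 0 ≤ b) (hr : 0 ≤ r) (hr1 : r ≤ 1) :
    |a ^ r - b ^ r| ≤ |a - b| ^ r := by
  have key : ∀ {a b : ℝ}, 0 ≤ b → b ≤ a → |a ^ r - b ^ r| ≤ |a - b| ^ r := by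
    intro a b hb hba
    have h1 := Real.rpow_add_le_add_rpow (sub_nonneg.2 hba) hb hr hr1
    rw [sub_add_cancel] at h1
    rw [abs_of_nonneg (sub_nonneg.2 (Real.rpow_le_rpow hb hba hr)),
      abs_of_nonneg (sub_nonneg.2 hba)]
    linarith
  rcases le_total b a with h | h
  · exact key hb h
  · rw [abs_sub_comm, abs_sub_comm a]
    exact key ha h

variable {X : Type*} [MeasurableSpace X] {ν : Measure X} {q : ℝ≥0∞}

/-- The pointwise `q`-th root `|h|^{1/q}`. -/
noncomputable def rootFun (q : ℝ≥0∞) (h : X → ℝ) (y : X) : ℂ :=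
  ((|h y| ^ q.toReal⁻¹ : ℝ) : ℂ)

lemma enorm_rootFun_rpow (hq0 : q ≠ 0) (hq : q ≠ ∞) (h : X → ℝ) (y : X) :
    ‖rootFun q h y‖ₑ ^ q.toReal = ‖h y‖ₑ := by
  have hq' := ENNReal.toReal_pos hq0 hq
  rw [← ofReal_norm, ← ofReal_norm, ENNReal.ofReal_rpow_of_nonneg (norm_nonneg _) hq'.le, rootFun,
    Complex.norm_real, Real.norm_of_nonneg (by positivity), ← Real.rpow_mul (abs_nonneg _),
    inv_mul_cancel₀ hq'.ne', Real.rpow_one, Real.norm_eq_abs]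

lemma enorm_rootFun_sub_rpow_le (hq1 : 1 ≤ q) (hq : q ≠ ∞) (f g : X → ℝ) (y : X) :
    ‖rootFun q f y - rootFun q g y‖ₑ ^ q.toReal ≤ ‖f y - g y‖ₑ := by
  have hq' := ENNReal.toReal_pos (zero_lt_one.trans_le hq1).ne' hq
  have hq1' : 1 ≤ q.toReal := by
    rw [← ENNReal.toReal_one]
    exact ENNReal.toReal_mono hq hq1
  rw [← ofReal_norm, ← ofReal_norm, ENNReal.ofReal_rpow_of_nonneg (norm_nonneg _) hq'.le, rootFun,
    rootFun, ← Complex.ofReal_sub, Complex.norm_real, Real.norm_eq_abs, Real.norm_eq_abs]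
  refine ENNReal.ofReal_le_ofReal ?_
  calc |(|f y| ^ q.toReal⁻¹ - |g y| ^ q.toReal⁻¹)| ^ q.toReal
      ≤ (|f y - g y| ^ q.toReal⁻¹) ^ q.toReal := by
        refine Real.rpow_le_rpow (abs_nonneg _) ?_ hq'.le
        refine (abs_rpow_sub_rpow_le (abs_nonneg _) (abs_nonneg _) (inv_nonneg.2 hq'.le)
          (inv_le_one_of_one_le₀ hq1')).trans ?_
        exact Real.rpow_le_rpow (abs_nonneg _) (abs_abs_sub_abs_le _ _) (inv_nonneg.2 hq'.le)
    _ = |f y - g y| := by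
        rw [← Real.rpow_mul (abs_nonneg _), inv_mul_cancel₀ hq'.ne', Real.rpow_one]

variable [hq1 : Fact (1 ≤ q)]

lemma memLp_rootFun (hq : q ≠ ∞) (h : Lp ℝ 1 ν) : MemLp (rootFun q h) q ν := by
  have hq0 : q ≠ 0 := (zero_lt_one.trans_le hq1.out).ne'
  have hr : Continuous fun t : ℝ => ((|t| ^ q.toReal⁻¹ : ℝ) : ℂ) :=
    Complex.continuous_ofReal.comp
      (continuous_abs.rpow_const fun t => Or.inr (inv_nonneg.2 ENNReal.toReal_nonneg))
  refine ⟨hr.comp_aestronglyMeasurable (Lp.aestronglyMeasurable h), ?_⟩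
  rw [eLpNorm_lt_top_iff_lintegral_rpow_enorm_lt_top hq0 hq]
  simp_rw [enorm_rootFun_rpow hq0 hq]
  rw [← eLpNorm_one_eq_lintegral_enorm]
  exact (Lp.memLp h).2

/-- The root `|h|^{1/q}` of an integrable function, as an element of `L_q`. -/
noncomputable def lpRoot (hq : q ≠ ∞) (h : Lp ℝ 1 ν) : Lp ℂ q ν :=
  (memLp_rootFun hq h).toLp

lemma coeFn_lpRoot (hq : q ≠ ∞) (h : Lp ℝ 1 ν) : lpRoot hq h =ᵐ[ν] rootFun q h :=
  (memLp_rootFun hq h).coeFn_toLp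

lemma enorm_lpRoot_rpow (hq : q ≠ ∞) (h : Lp ℝ 1 ν) : ‖lpRoot hq h‖ₑ ^ q.toReal = ‖h‖ₑ := by
  have hq0 : q ≠ 0 := (zero_lt_one.trans_le hq1.out).ne'
  rw [Lp.enorm_def, Lp.enorm_def, eLpNorm_congr_ae (coeFn_lpRoot hq h), eLpNorm_rpow_toReal hq0 hq,
    eLpNorm_one_eq_lintegral_enorm]
  simp_rw [enorm_rootFun_rpow hq0 hq]

lemma enorm_lpRoot_sub_rpow_le (hq : q ≠ ∞) (f g : Lp ℝ 1 ν) :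
    ‖lpRoot hq f - lpRoot hq g‖ₑ ^ q.toReal ≤ ‖f - g‖ₑ := by
  have hq0 : q ≠ 0 := (zero_lt_one.trans_le hq1.out).ne'
  rw [Lp.enorm_def, Lp.enorm_def, eLpNorm_rpow_toReal hq0 hq, eLpNorm_one_eq_lintegral_enorm]
  refine lintegral_mono_ae ?_
  filter_upwards [Lp.coeFn_sub (lpRoot hq f) (lpRoot hq g), Lp.coeFn_sub f g, coeFn_lpRoot hq f,
    coeFn_lpRoot hq g] with y h1 h2 h3 h4
  rw [h1, h2, Pi.sub_apply, Pi.sub_apply, h3, h4]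
  exact enorm_rootFun_sub_rpow_le hq1.out hq f g y

lemma lpFunctional_lpRoot {p p' : ℝ≥0∞} [Fact (1 ≤ p)] [Fact (1 ≤ p')] [p.HolderConjugate p']
    (hp : 1 < p) (hp_top : p ≠ ∞) (hp' : p' ≠ ∞) {h : Lp ℝ 1 ν} (h0 : 0 ≤ h) :
    lpFunctional (lpRoot hp_top h) (lpRoot hp' h) = ((∫ y, h y ∂ν : ℝ) : ℂ) := by
  have hpp : p.toReal.HolderConjugate p'.toReal := by
    refine ENNReal.HolderConjugate.toReal ?_
    rw [← ENNReal.toReal_one]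
    exact (ENNReal.toReal_lt_toReal ENNReal.one_ne_top hp_top).2 hp
  rw [lpFunctional_apply, ← integral_complex_ofReal]
  refine integral_congr_ae ?_
  filter_upwards [coeFn_lpRoot hp_top h, coeFn_lpRoot hp' h, (Lp.coeFn_nonneg h).2 h0]
    with y h1 h2 h3
  rw [h1, h2, rootFun, rootFun, ← Complex.ofReal_mul]
  congr 1
  change 0 ≤ h y at h3
  have h4 : p'.toReal⁻¹ + p.toReal⁻¹ = 1 := by rw [add_comm, hpp.inv_add_inv_eq_one]
  rw [abs_of_nonneg h3, ← Real.rpow_add_of_nonneg h3 (inv_nonneg.2 ENNReal.toReal_nonneg)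
    (inv_nonneg.2 ENNReal.toReal_nonneg), h4, Real.rpow_one]

end Roots

section AlmostInvariantLp

variable {G : Type u} [Group G] [TopologicalSpace G] [IsTopologicalGroup G]
  [LocallyCompactSpace G] [T2Space G] [MeasurableSpace G] [BorelSpace G]
  {μ : Measure G} [μ.IsHaarMeasure] [μ.Regular]

lemma leftTranslation_lpRoot {q : ℝ≥0∞} [Fact (1 ≤ q)] (hq : q ≠ ∞) (h : Lp ℝ 1 μ) (x : G) :
    leftTranslation μ ℂ q x (lpRoot hq h) = lpRoot hq (leftTranslation μ ℝ 1 x h) := by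
  refine Lp.ext ?_
  filter_upwards [coeFn_leftTranslation x (lpRoot hq h),
    coeFn_lpRoot hq (leftTranslation μ ℝ 1 x h),
    (measurePreserving_mul_left μ x⁻¹).quasiMeasurePreserving.ae (coeFn_lpRoot hq h),
    coeFn_leftTranslation x h] with y h1 h2 h3 h4
  rw [h1, h2, h3, rootFun, rootFun, h4]

/-- Reiter's property: the densities in `L_1(G)` form a closed convex translation invariant set. -/
lemma exists_density_norm_leftTranslation_sub_lt (hG : IsAmenableGroup G) {K : Set G}
    (hK : IsCompact K) {ε : ℝ} (hε : 0 < ε) : ∃ h : Lp ℝ 1 μ, 0 ≤ h ∧ ∫ y, h y ∂μ = 1 ∧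
      ∀ y ∈ K, ‖leftTranslation μ ℝ 1 y h - h‖ < ε := by
  suffices h : ∃ h ∈ {h : Lp ℝ 1 μ | 0 ≤ h ∧ ∫ y, h y ∂μ = 1},
      ∀ y ∈ K, ‖leftTranslation μ ℝ 1 y h - h‖ < ε by
    obtain ⟨h, ⟨h0, h1⟩, h2⟩ := h
    exact ⟨h, h0, h1, h2⟩
  refine exists_mem_forall_norm_sub_lt (ρ := leftTranslation μ ℝ 1) hG
    (continuous_leftTranslation ENNReal.one_ne_top) ?_ ?_ ?_ ?_ hK hε
  · rintro f ⟨hf0, hf1⟩ g ⟨hg0, hg1⟩ a b ha hb hab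
    have h : ∀ᵐ y ∂μ, (a • f + b • g) y = a * f y + b * g y := by
      filter_upwards [Lp.coeFn_add (a • f) (b • g), Lp.coeFn_smul a f, Lp.coeFn_smul b g]
        with y h1 h2 h3
      rw [h1, Pi.add_apply, h2, h3]
      rfl
    constructor
    · rw [← Lp.coeFn_nonneg]
      filter_upwards [h, (Lp.coeFn_nonneg f).2 hf0, (Lp.coeFn_nonneg g).2 hg0] with y h1 h2 h3
      rw [h1]
      exact add_nonneg (mul_nonneg ha h2) (mul_nonneg hb h3)
    rw [integral_congr_ae h, integral_add ((L1.integrable_coeFn f).const_mul a)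
      ((L1.integrable_coeFn g).const_mul b), integral_const_mul, integral_const_mul, hf1, hg1,
      mul_one, mul_one, hab]
  · exact (isClosed_Ici (a := (0 : Lp ℝ 1 μ))).inter
      (isClosed_eq continuous_integral continuous_const)
  · rintro x f ⟨hf0, hf1⟩
    constructor
    · rw [← Lp.coeFn_nonneg]
      filter_upwards [coeFn_leftTranslation x f,
        (measurePreserving_mul_left μ x⁻¹).quasiMeasurePreserving.ae ((Lp.coeFn_nonneg f).2 hf0)]
        with y h1 h2
      rw [h1]
      exact h2
    · rw [integral_congr_ae (coeFn_leftTranslation x f), integral_mul_left_eq_self, hf1]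
  · obtain ⟨k, hk, hkc, hk0, -, hk1⟩ := exists_bump μ (1 : G) Filter.univ_mem
    have hki : MemLp k 1 μ := memLp_one_iff_integrable.2 (hk.integrable_of_hasCompactSupport hkc)
    refine ⟨hki.toLp k, ?_, ?_⟩
    · rw [← Lp.coeFn_nonneg]
      filter_upwards [hki.coeFn_toLp] with y h1
      rw [h1]
      exact hk0 y
    · rw [integral_congr_ae hki.coeFn_toLp, hk1]

/-- Roots of almost invariant densities are almost invariant unit vectors in `L_{p'}(G)` and
`L_p(G)` with pairing `1`. -/
lemma exists_almostInvariant_pair {p p' : ℝ≥0∞} [Fact (1 ≤ p)] [Fact (1 ≤ p')]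
    [p.HolderConjugate p'] (hp : 1 < p) (hp_top : p ≠ ∞) (hp' : p' ≠ ∞) (hG : IsAmenableGroup G)
    {K : Set G} (hK : IsCompact K) {ε : ℝ} (hε : 0 < ε) :
    ∃ (ξ : Lp ℂ p' μ) (φ : Lp ℂ p μ), ‖ξ‖ₑ = 1 ∧ ‖φ‖ₑ = 1 ∧ lpFunctional φ ξ = 1 ∧
      (∀ y ∈ K, ‖leftTranslation μ ℂ p' y ξ - ξ‖ ≤ ε) ∧
      ∀ y ∈ K, ‖leftTranslation μ ℂ p y φ - φ‖ ≤ ε := by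
  obtain ⟨δ, hδ, hδp, hδp'⟩ : ∃ δ : ℝ, 0 < δ ∧ δ ≤ ε ^ p.toReal ∧ δ ≤ ε ^ p'.toReal :=
    ⟨min (ε ^ p.toReal) (ε ^ p'.toReal), lt_min (by positivity) (by positivity),
      min_le_left _ _, min_le_right _ _⟩
  obtain ⟨h, h0, h1, hK⟩ := exists_density_norm_leftTranslation_sub_lt (μ := μ) hG hK hδ
  have hn : ‖h‖ₑ = 1 := by
    have h2 : ‖h‖ = ∫ y, h y ∂μ := by
      rw [L1.norm_eq_integral_norm]
      refine integral_congr_ae ?_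
      filter_upwards [(Lp.coeFn_nonneg h).2 h0] with y hy
      exact Real.norm_of_nonneg hy
    rw [← ofReal_norm, h2, h1, ENNReal.ofReal_one]
  have hunit : ∀ {q : ℝ≥0∞} [Fact (1 ≤ q)] (hq : q ≠ ∞), ‖lpRoot hq h‖ₑ = 1 := by
    intro q hq1 hq
    have h2 := enorm_lpRoot_rpow hq h
    rw [hn] at h2
    have hq' := ENNReal.toReal_pos (zero_lt_one.trans_le hq1.out).ne' hq
    rw [← ENNReal.rpow_one ‖lpRoot hq h‖ₑ, ← mul_inv_cancel₀ hq'.ne', ENNReal.rpow_mul, h2,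
      ENNReal.one_rpow]
  have hinv : ∀ {q : ℝ≥0∞} [Fact (1 ≤ q)] (hq : q ≠ ∞), δ ≤ ε ^ q.toReal → ∀ y ∈ K,
      ‖leftTranslation μ ℂ q y (lpRoot hq h) - lpRoot hq h‖ ≤ ε := by
    intro q hq1 hq hδq y hy
    have hq' := ENNReal.toReal_pos (zero_lt_one.trans_le hq1.out).ne' hq
    have h2 := enorm_lpRoot_sub_rpow_le hq (leftTranslation μ ℝ 1 y h) h
    rw [← leftTranslation_lpRoot, ← ofReal_norm, ← ofReal_norm,
      ENNReal.ofReal_rpow_of_nonneg (norm_nonneg _) hq'.le,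
      ENNReal.ofReal_le_ofReal_iff (norm_nonneg _)] at h2
    exact (Real.rpow_le_rpow_iff (norm_nonneg _) hε.le hq').1
      (h2.trans ((hK y hy).le.trans hδq))
  refine ⟨lpRoot hp' h, lpRoot hp_top h, hunit hp', hunit hp_top, ?_, hinv hp' hδp',
    hinv hp_top hδp⟩
  rw [lpFunctional_lpRoot hp hp_top hp' h0, h1, Complex.ofReal_one]

end AlmostInvariantLp

/-! ### Approximate units of `A_p(G)` for amenable groups -/

section ApproximateUnit

open scoped NNReal Topology

variable {G : Type u} [Group G] [TopologicalSpace G] [IsTopologicalGroup G]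
  [LocallyCompactSpace G] [T2Space G] [MeasurableSpace G] [BorelSpace G]
  {p p' : ℝ≥0∞} [Fact (1 ≤ p)] [Fact (1 ≤ p')] {μ : Measure G} [μ.IsHaarMeasure]
  [μ.Regular] [p.HolderConjugate p']

lemma lpFunctional_leftTranslation (ξ : Lp ℂ p' μ) (φ : Lp ℂ p μ) (y : G) :
    lpFunctional φ (leftTranslation μ ℂ p' y ξ) =
      lpFunctional (leftTranslation μ ℂ p y⁻¹ φ) ξ := by
  rw [lpFunctional_apply, lpFunctional_apply,
    ← integral_mul_left_eq_self (fun z => leftTranslation μ ℂ p' y ξ z * φ z) y]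
  refine integral_congr_ae ?_
  filter_upwards [coeFn_leftTranslation y⁻¹ φ,
    (measurePreserving_mul_left μ y).quasiMeasurePreserving.ae (coeFn_leftTranslation y ξ)]
    with z h1 h2
  rw [h1, h2, inv_inv, inv_mul_cancel_left]

/-- If `⟨λ(x) ξ, φ⟩` comes from vectors that are almost invariant under the translations by the
points where `ξ₀` and `φ₀` live, multiplication by it hardly changes `⟨λ(x) ξ₀, φ₀⟩`. -/
lemma apENorm_apAtom_sub_mul_le (hp : 1 < p) (hp_top : p < ∞) (hp' : p' ≠ ∞)
    {ξ₀ : Lp ℂ p' μ} {φ₀ : Lp ℂ p μ} {K : Set G} (hξ₀ : ∀ᵐ y ∂μ, y ∉ K → ξ₀ y = 0)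
    (hφ₀ : ∀ᵐ y ∂μ, y ∉ K → φ₀ y = 0) (hK : IsCompact K) {ξ : Lp ℂ p' μ} {φ : Lp ℂ p μ}
    (hξ : ‖ξ‖ₑ = 1) (hφ : ‖φ‖ₑ = 1) (h1 : lpFunctional φ ξ = 1) {δ : ℝ}
    (hξδ : ∀ y ∈ K, ‖leftTranslation μ ℂ p' y⁻¹ ξ - ξ‖ ≤ δ)
    (hφδ : ∀ y ∈ K, ‖leftTranslation μ ℂ p y⁻¹ φ - φ‖ ≤ δ) :
    apENorm p p' μ (apAtom μ (ξ₀, φ₀) - apAtom μ (ξ₀, φ₀) * apAtom μ (ξ, φ)) ≤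
      2 * ENNReal.ofReal δ * (‖ξ₀‖ₑ * ‖φ₀‖ₑ) := by
  have hξ' : ‖ξ‖ = 1 := by rw [← toReal_enorm, hξ, ENNReal.toReal_one]
  have hφ' : ‖φ‖ = 1 := by rw [← toReal_enorm, hφ, ENNReal.toReal_one]
  have hE : IsLqApproximable p.toReal p'.toReal (Lp ℂ p' μ) := by
    refine IsQSL.isLqApproximable hp' ?_ (isQSL_Lp μ)
    refine ENNReal.HolderConjugate.toReal ?_
    rw [← ENNReal.toReal_one]
    exact (ENNReal.toReal_lt_toReal ENNReal.one_ne_top hp_top.ne).2 hp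
  set ψ : StrongDual ℂ (Lp ℂ p' μ) := lpFunctional φ with hψ
  let Ψ : G → StrongDual ℂ (Lp ℂ p' μ) := fun y => lpFunctional (leftTranslation μ ℂ p y⁻¹ φ)
  have hcξ : Continuous fun z => leftTranslation μ ℂ p' z⁻¹ ξ :=
    (continuous_leftTranslation hp' ξ).comp continuous_inv
  have hcφ : Continuous fun z => leftTranslation μ ℂ p z⁻¹ φ :=
    (continuous_leftTranslation hp_top.ne φ).comp continuous_inv
  have hΨ : ∀ e, Continuous fun y => Ψ y e := fun e => by
    have : (fun y => Ψ y e) = fun y => ψ (leftTranslation μ ℂ p' y e) :=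
      funext fun y => (lpFunctional_leftTranslation e φ y).symm
    rw [this]
    exact ψ.continuous.comp (continuous_leftTranslation hp' e)
  let F : G → Lp ℂ p' μ := fun z => ξ₀ z • leftTranslation μ ℂ p' z⁻¹ ξ
  let F' : G → Lp ℂ p' μ := fun z => ξ₀ z • ξ
  let Φ : G → StrongDual ℂ (Lp ℂ p' μ) := fun y => φ₀ y • Ψ y
  let Φ' : G → StrongDual ℂ (Lp ℂ p' μ) := fun y => φ₀ y • ψ
  have hprod : apAtom μ (ξ₀, φ₀) * apAtom μ (ξ, φ) = crossCoeff μ Φ F := by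
    ext x
    rw [Pi.mul_apply, apAtom_eq_lpFunctional ξ φ]
    refine (congrFun (apAtom_mul_coefficient (leftRegularRep μ hp') ξ ψ ξ₀ φ₀) x).trans ?_
    refine integral_congr_ae (Filter.Eventually.of_forall fun y => ?_)
    exact congrArg (φ₀ y * ·) (lpFunctional_leftTranslation (F (x⁻¹ * y)) φ y)
  have hone : apAtom μ (ξ₀, φ₀) = crossCoeff μ Φ' F' := by
    ext x
    refine integral_congr_ae (Filter.Eventually.of_forall fun y => ?_)
    change ξ₀ (x⁻¹ * y) * φ₀ y = φ₀ y * ψ (ξ₀ (x⁻¹ * y) • ξ)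
    rw [map_smul, h1, smul_eq_mul, mul_one, mul_comm]
  have hFm := aestronglyMeasurable_smul_of_compact (Lp.aestronglyMeasurable ξ₀) hK hξ₀ hcξ
  have hFn : eLpNorm F p' μ ≤ ‖ξ₀‖ₑ := by
    rw [Lp.enorm_def]
    refine eLpNorm_mono fun z => ?_
    rw [norm_smul, LinearIsometryEquiv.norm_map, hξ', mul_one]
  have hF : MemLp F p' μ := ⟨hFm, hFn.trans_lt enorm_lt_top⟩
  have hDm : AEStronglyMeasurable (F' - F) μ := by
    refine AEStronglyMeasurable.sub ?_ hFm
    exact (Lp.aestronglyMeasurable ξ₀).smul aestronglyMeasurable_const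
  have hDn : eLpNorm (F' - F) p' μ ≤ ENNReal.ofReal δ * ‖ξ₀‖ₑ := by
    rw [Lp.enorm_def]
    refine eLpNorm_le_mul_eLpNorm_of_ae_le_mul ?_ _
    filter_upwards [hξ₀] with z hz
    change ‖ξ₀ z • ξ - ξ₀ z • leftTranslation μ ℂ p' z⁻¹ ξ‖ ≤ δ * ‖ξ₀ z‖
    rw [← smul_sub, norm_smul, mul_comm]
    by_cases hzK : z ∈ K
    · rw [norm_sub_rev]
      exact mul_le_mul_of_nonneg_right (hξδ z hzK) (norm_nonneg _)
    · rw [hz hzK, norm_zero, mul_zero, mul_zero]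
  have hD : MemLp (F' - F) p' μ :=
    ⟨hDm, hDn.trans_lt (ENNReal.mul_lt_top ENNReal.ofReal_lt_top enorm_lt_top)⟩
  have hF' : MemLp F' p' μ := by
    have := hD.add hF
    rwa [sub_add_cancel] at this
  have hΦ'm : ∀ e, AEStronglyMeasurable (fun y => Φ' y e) μ := fun e =>
    (Lp.aestronglyMeasurable φ₀).mul aestronglyMeasurable_const
  have hΦm : ∀ e, AEStronglyMeasurable (fun y => Φ y e) μ := fun e =>
    (Lp.aestronglyMeasurable φ₀).mul (hΨ e).aestronglyMeasurable
  have hφ₀m : MemLp (fun y => ‖φ₀ y‖) p μ := (Lp.memLp φ₀).norm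
  have hle : ∀ χ : Lp ℂ p μ, ‖χ‖ = 1 → ∀ y,
      ‖φ₀ y • (lpFunctional χ : StrongDual ℂ (Lp ℂ p' μ))‖ ≤ ‖φ₀ y‖ := fun χ hχ y => by
    rw [norm_smul]
    refine mul_le_of_le_one_right (norm_nonneg _) ?_
    exact (norm_lpFunctional_le χ).trans_eq hχ
  have hΦ'k : ∀ y, ‖Φ' y‖ ≤ ‖φ₀ y‖ := hle φ hφ'
  have hΦk : ∀ y, ‖Φ y‖ ≤ ‖φ₀ y‖ := fun y =>
    hle _ ((LinearIsometryEquiv.norm_map _ _).trans hφ') y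
  let k : G → ℝ := fun y => ‖φ₀ y‖ * ‖leftTranslation μ ℂ p y⁻¹ φ - φ‖
  have hkn : eLpNorm k p μ ≤ ENNReal.ofReal δ * ‖φ₀‖ₑ := by
    rw [Lp.enorm_def]
    refine eLpNorm_le_mul_eLpNorm_of_ae_le_mul ?_ _
    filter_upwards [hφ₀] with y hy
    change ‖‖φ₀ y‖ * ‖leftTranslation μ ℂ p y⁻¹ φ - φ‖‖ ≤ δ * ‖φ₀ y‖
    rw [norm_mul, norm_norm, norm_norm, mul_comm]
    by_cases hyK : y ∈ K
    · exact mul_le_mul_of_nonneg_right (hφδ y hyK) (norm_nonneg _)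
    · rw [hy hyK, norm_zero, mul_zero, mul_zero]
  have hk : MemLp k p μ := by
    refine ⟨(Lp.aestronglyMeasurable φ₀).norm.mul
      (hcφ.sub continuous_const).norm.aestronglyMeasurable, ?_⟩
    exact hkn.trans_lt (ENNReal.mul_lt_top ENNReal.ofReal_lt_top enorm_lt_top)
  have hΔk : ∀ y, ‖(Φ' - Φ) y‖ ≤ k y := fun y => by
    have h : (Φ' - Φ) y = φ₀ y • (ψ - Ψ y) := (smul_sub (φ₀ y) ψ (Ψ y)).symm
    rw [h, norm_smul, norm_sub_rev, hψ, ← lpFunctional_sub]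
    exact mul_le_mul_of_nonneg_left (norm_lpFunctional_le _) (norm_nonneg _)
  have hΔm : ∀ e, AEStronglyMeasurable (fun y => (Φ' - Φ) y e) μ := fun e =>
    (hΦ'm e).sub (hΦm e)
  have hsplit : apAtom μ (ξ₀, φ₀) - apAtom μ (ξ₀, φ₀) * apAtom μ (ξ, φ) =
      crossCoeff μ Φ' (F' - F) + crossCoeff μ (Φ' - Φ) F := by
    rw [hprod, hone]
    ext x
    rw [Pi.sub_apply, Pi.add_apply, crossCoeff, crossCoeff, crossCoeff, crossCoeff,
      ← integral_sub (integrable_crossCoeff hΦ'm hφ₀m hΦ'k hF' x)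
        (integrable_crossCoeff hΦm hφ₀m hΦk hF x),
      ← integral_add (integrable_crossCoeff hΦ'm hφ₀m hΦ'k hD x)
        (integrable_crossCoeff hΔm hk hΔk hF x)]
    refine integral_congr_ae (Filter.Eventually.of_forall fun y => ?_)
    change Φ' y (F' _) - Φ y (F _) = Φ' y (F' _ - F _) + (Φ' y - Φ y) (F _)
    rw [map_sub, sub_apply]
    ring
  rw [hsplit]
  refine (apENorm_add_le _ _).trans ?_
  have e1 := apENorm_crossCoeff_le hp hp_top hE hp' hD hΦ'm hφ₀m hΦ'k
  have e2 := apENorm_crossCoeff_le hp hp_top hE hp' hF hΔm hk hΔk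
  have e3 : eLpNorm (fun y => ‖φ₀ y‖) p μ = ‖φ₀‖ₑ := by rw [eLpNorm_norm, Lp.enorm_def]
  rw [e3] at e1
  calc _ ≤ (ENNReal.ofReal δ * ‖ξ₀‖ₑ) * ‖φ₀‖ₑ + ‖ξ₀‖ₑ * (ENNReal.ofReal δ * ‖φ₀‖ₑ) :=
        add_le_add (e1.trans (mul_le_mul' hDn le_rfl)) (e2.trans (mul_le_mul' hFn hkn))
    _ = _ := by ring

lemma apENorm_neg_le (f : G → ℂ) : apENorm p p' μ (-f) ≤ apENorm p p' μ f := by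
  refine le_of_forall_gt fun r hr => ?_
  obtain ⟨s, hs, hsr⟩ := exists_expansion_of_atomicNorm_lt hr
  refine lt_of_le_of_lt (atomicNorm_le_tsum (fun n => (-(s n).1, (s n).2)) fun x => ?_) ?_
  · refine (hs x).neg.congr_fun fun n => ?_
    rw [apAtom_eq_lpFunctional, apAtom_eq_lpFunctional, map_neg, map_neg]
  · refine lt_of_eq_of_lt (tsum_congr fun n => ?_) hsr
    rw [apWeight, apWeight, nnnorm_neg]

lemma apENorm_apAtom_le (i : Lp ℂ p' μ × Lp ℂ p μ) :
    apENorm p p' μ (apAtom μ i) ≤ ‖i.1‖ₑ * ‖i.2‖ₑ := by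
  refine (atomicNorm_atom_le (hasZeroAtom_apAtom μ) i).trans_eq ?_
  rw [apWeight, ENNReal.coe_mul, enorm_eq_nnnorm, enorm_eq_nnnorm]

variable {ι : Type*} {l : Filter ι} {e : ι → G → ℂ}

lemma tendsto_apENorm_sub_mul_add {f g : G → ℂ}
    (hf : Filter.Tendsto (fun i => apENorm p p' μ (f - f * e i)) l (𝓝 0))
    (hg : Filter.Tendsto (fun i => apENorm p p' μ (g - g * e i)) l (𝓝 0)) :
    Filter.Tendsto (fun i => apENorm p p' μ ((f + g) - (f + g) * e i)) l (𝓝 0) := by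
  refine tendsto_of_tendsto_of_tendsto_of_le_of_le tendsto_const_nhds
    (by simpa using hf.add hg) (fun i => zero_le) fun i => ?_
  have h : (f + g) - (f + g) * e i = (f - f * e i) + (g - g * e i) := by ring
  change apENorm p p' μ ((f + g) - (f + g) * e i) ≤ _
  rw [h]
  exact apENorm_add_le _ _

/-- The functions `f` with `f eᵢ → f` form a closed set in `A_p(G)`, as the functions `eᵢ` act by
contractions. -/
lemma tendsto_apENorm_sub_mul_of_approx (hp : 1 < p) (hp_top : p < ∞) (hp' : p' ≠ ∞)
    (he : ∀ i, apENorm p p' μ (e i) ≤ 1) {f : G → ℂ}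
    (hf : ∀ ε : ℝ≥0∞, 0 < ε → ∃ g, apENorm p p' μ (f - g) ≤ ε ∧
      Filter.Tendsto (fun i => apENorm p p' μ (g - g * e i)) l (𝓝 0)) :
    Filter.Tendsto (fun i => apENorm p p' μ (f - f * e i)) l (𝓝 0) := by
  rw [ENNReal.tendsto_nhds_zero]
  intro ε hε
  have hε3 : 0 < min ε 1 / 3 := ENNReal.div_pos (lt_min hε one_pos).ne' (by simp)
  obtain ⟨g, hfg, hg⟩ := hf _ hε3
  filter_upwards [ENNReal.tendsto_nhds_zero.1 hg _ hε3] with i hi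
  have h : f - f * e i = ((f - g) + -((f - g) * e i)) + (g - g * e i) := by ring
  have hne : apENorm p p' μ (f - g) ≠ ∞ := by
    refine (hfg.trans_lt (ENNReal.div_lt_top ?_ (by simp))).ne
    exact ((min_le_right _ _).trans_lt ENNReal.one_lt_top).ne
  have hei : bpENorm p' μ (e i) ≤ 1 := (bpENorm_le_apENorm (p := p) hp' _).trans (he i)
  have hmul : apENorm p p' μ ((f - g) * e i) ≤ min ε 1 / 3 := by
    refine (apENorm_mul_le hp hp_top hp' hne (hei.trans_lt ENNReal.one_lt_top).ne).trans ?_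
    exact (mul_le_mul' hfg hei).trans_eq (mul_one _)
  rw [h]
  calc _ ≤ (apENorm p p' μ (f - g) + apENorm p p' μ (-((f - g) * e i))) +
        apENorm p p' μ (g - g * e i) :=
        (apENorm_add_le _ _).trans (add_le_add (apENorm_add_le _ _) le_rfl)
    _ ≤ (min ε 1 / 3 + min ε 1 / 3) + min ε 1 / 3 :=
        add_le_add (add_le_add hfg ((apENorm_neg_le _).trans hmul)) hi
    _ = min ε 1 := ENNReal.add_thirds _
    _ ≤ ε := min_le_left _ _

/-- For an amenable group, `A_p(G)` has an approximate unit bounded by `1`. -/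
theorem exists_approximateUnit (hp : 1 < p) (hp_top : p < ∞) (hp' : p' ≠ ∞)
    (hG : IsAmenableGroup G) : ∃ (ι : Type u) (l : Filter ι) (e : ι → G → ℂ), l.NeBot ∧
      (∀ i, apENorm p p' μ (e i) ≤ 1) ∧ ∀ f, apENorm p p' μ f ≠ ∞ →
        Filter.Tendsto (fun i => apENorm p p' μ (f - f * e i)) l (𝓝 0) := by
  have hex : ∀ i : TopologicalSpace.Compacts G × ℕ, ∃ (ξ : Lp ℂ p' μ) (φ : Lp ℂ p μ),
      ‖ξ‖ₑ = 1 ∧ ‖φ‖ₑ = 1 ∧ lpFunctional φ ξ = 1 ∧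
      (∀ y ∈ (i.1 : Set G)⁻¹, ‖leftTranslation μ ℂ p' y ξ - ξ‖ ≤ (i.2 + 1 : ℝ)⁻¹) ∧
      ∀ y ∈ (i.1 : Set G)⁻¹, ‖leftTranslation μ ℂ p y φ - φ‖ ≤ (i.2 + 1 : ℝ)⁻¹ := fun i =>
    exists_almostInvariant_pair hp hp_top.ne hp' hG i.1.isCompact.inv (by positivity)
  choose ξ φ hξ hφ hone hξi hφi using hex
  let e : TopologicalSpace.Compacts G × ℕ → G → ℂ := fun i => apAtom μ (ξ i, φ i)
  have he : ∀ i, apENorm p p' μ (e i) ≤ 1 := fun i => by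
    refine (apENorm_apAtom_le _).trans_eq ?_
    rw [hξ, hφ, one_mul]
  refine ⟨_, Filter.atTop, e, inferInstance, he, ?_⟩
  have hcompact : ∀ ξ₀ ∈ compactlySupportedLp p' μ, ∀ φ₀ ∈ compactlySupportedLp p μ,
      Filter.Tendsto (fun i => apENorm p p' μ (apAtom μ (ξ₀, φ₀) - apAtom μ (ξ₀, φ₀) * e i))
        Filter.atTop (𝓝 0) := by
    rintro ξ₀ ⟨K, hK, hξK⟩ φ₀ ⟨L, hL, hφL⟩
    have hlim : Filter.Tendsto (fun n : ℕ => 2 * ENNReal.ofReal (n + 1 : ℝ)⁻¹ * (‖ξ₀‖ₑ * ‖φ₀‖ₑ))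
        Filter.atTop (𝓝 0) := by
      have h1 : Filter.Tendsto (fun n : ℕ => ENNReal.ofReal (n + 1 : ℝ)⁻¹) Filter.atTop (𝓝 0) := by
        have := ENNReal.tendsto_ofReal (tendsto_one_div_add_atTop_nhds_zero_nat (𝕜 := ℝ))
        simpa using this
      have h2 := ENNReal.Tendsto.const_mul (a := 2) h1 (Or.inr (by simp))
      have h3 := ENNReal.Tendsto.mul_const (b := ‖ξ₀‖ₑ * ‖φ₀‖ₑ) h2
        (Or.inr (ENNReal.mul_lt_top enorm_lt_top enorm_lt_top).ne)
      simpa using h3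
    have hsnd : Filter.Tendsto (Prod.snd : TopologicalSpace.Compacts G × ℕ → ℕ) Filter.atTop
        Filter.atTop := by
      rw [← Filter.prod_atTop_atTop_eq]
      exact Filter.tendsto_snd
    refine tendsto_of_tendsto_of_tendsto_of_le_of_le' tendsto_const_nhds (hlim.comp hsnd)
      (Filter.Eventually.of_forall fun i => zero_le) ?_
    filter_upwards [Filter.eventually_ge_atTop
      ((⟨K ∪ L, hK.union hL⟩, 0) : TopologicalSpace.Compacts G × ℕ)] with i hi
    have hKL : K ∪ L ⊆ (i.1 : Set G) := hi.1
    refine apENorm_apAtom_sub_mul_le hp hp_top hp' (K := K ∪ L) ?_ ?_ (hK.union hL) (hξ i) (hφ i)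
      (hone i) (fun y hy => hξi i _ (Set.inv_mem_inv.2 (hKL hy)))
      fun y hy => hφi i _ (Set.inv_mem_inv.2 (hKL hy))
    · exact hξK.mono fun y hy h => hy fun h' => h (Or.inl h')
    · exact hφL.mono fun y hy h => hy fun h' => h (Or.inr h')
  -- one vector of an atom at a time is approximated by vectors with compact support
  have happrox : ∀ {V : Type u} [NormedAddCommGroup V] {D : AddSubgroup V}
      (_ : Dense (D : Set V)) (v : V) (c : ℝ≥0∞) (_ : c ≠ ∞) (ε : ℝ≥0∞) (_ : 0 < ε),
      ∃ d ∈ D, ‖v - d‖ₑ * c ≤ ε := by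
    intro V _ D hD v c hc ε hε
    rcases eq_or_ne c 0 with rfl | hc0
    · exact ⟨0, D.zero_mem, by simp⟩
    · obtain ⟨d, hd, hvd⟩ := EMetric.mem_closure_iff.1 (hD v) (ε / c) (ENNReal.div_pos hε.ne' hc)
      rw [edist_eq_enorm_sub] at hvd
      exact ⟨d, hd, (ENNReal.le_div_iff_mul_le (Or.inl hc0) (Or.inl hc)).1 hvd.le⟩
  have hatom : ∀ i : Lp ℂ p' μ × Lp ℂ p μ, Filter.Tendsto
      (fun j => apENorm p p' μ (apAtom μ i - apAtom μ i * e j))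
      Filter.atTop (𝓝 0) := by
    rintro ⟨ξ₀, φ₀⟩
    refine tendsto_apENorm_sub_mul_of_approx hp hp_top hp' he fun ε hε => ?_
    obtain ⟨a, ha, haε⟩ := happrox (dense_compactlySupportedLp hp' μ) ξ₀ ‖φ₀‖ₑ enorm_ne_top ε hε
    refine ⟨apAtom μ (a, φ₀), ?_, ?_⟩
    · have h : apAtom μ (ξ₀, φ₀) - apAtom μ (a, φ₀) = apAtom μ (ξ₀ - a, φ₀) := by
        ext x
        simp only [Pi.sub_apply, apAtom_eq_lpFunctional, map_sub]
      rw [h]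
      exact (apENorm_apAtom_le _).trans haε
    refine tendsto_apENorm_sub_mul_of_approx hp hp_top hp' he fun ε hε => ?_
    obtain ⟨b, hb, hbε⟩ := happrox (dense_compactlySupportedLp hp_top.ne μ) φ₀ ‖a‖ₑ enorm_ne_top
      ε hε
    refine ⟨apAtom μ (a, b), ?_, hcompact a ha b hb⟩
    have h : apAtom μ (a, φ₀) - apAtom μ (a, b) = apAtom μ (a, φ₀ - b) := by
      ext x
      simp only [Pi.sub_apply, apAtom_eq_lpFunctional, lpFunctional_sub, sub_apply]
    rw [h]
    exact ((apENorm_apAtom_le _).trans_eq (mul_comm _ _)).trans hbε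
  intro f hf
  obtain ⟨s, hs, hsf⟩ := exists_expansion_of_atomicNorm_lt hf.lt_top
  refine tendsto_apENorm_sub_mul_of_approx hp hp_top hp' he fun ε hε => ?_
  obtain ⟨N, hN⟩ := (ENNReal.tendsto_nhds_zero.1 (ENNReal.tendsto_sum_nat_add _ hsf.ne) ε hε).exists
  refine ⟨∑ n ∈ Finset.range N, apAtom μ (s n), ?_, ?_⟩
  · refine (atomicNorm_le_tsum (fun n => s (n + N)) fun x => ?_).trans hN
    rw [Pi.sub_apply, Finset.sum_apply]
    exact (hasSum_nat_add_iff' N).2 (hs x)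
  · clear hN
    induction N with
    | zero =>
      refine tendsto_const_nhds.congr fun i => ?_
      rw [Finset.range_zero, Finset.sum_empty, zero_mul, sub_zero]
      exact (atomicNorm_zero (hasZeroAtom_apAtom μ)).symm
    | succ n ih =>
      simp_rw [Finset.sum_range_succ]
      exact tendsto_apENorm_sub_mul_add ih (hatom _)

/-- For an amenable group, the norm of `A_p(G)` is bounded by the multiplier norm. -/
theorem apENorm_le_of_forall_apENorm_mul_le (hp : 1 < p) (hp_top : p < ∞) (hp' : p' ≠ ∞)
    (hG : IsAmenableGroup G) {f : G → ℂ} (hf : apENorm p p' μ f ≠ ∞) {C : ℝ≥0∞}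
    (hC : ∀ g, apENorm p p' μ g ≤ 1 → apENorm p p' μ (f * g) ≤ C) : apENorm p p' μ f ≤ C := by
  obtain ⟨ι, l, e, hl, he, hlim⟩ := exists_approximateUnit (μ := μ) hp hp_top hp' hG
  have h : Filter.Tendsto (fun i => apENorm p p' μ (f - f * e i) + C) l (𝓝 C) := by
    simpa using (hlim f hf).add_const C
  refine ge_of_tendsto' h fun i => ?_
  calc apENorm p p' μ f = apENorm p p' μ ((f - f * e i) + f * e i) := by rw [sub_add_cancel]
    _ ≤ _ := (apENorm_add_le _ _).trans (add_le_add le_rfl (hC _ (he i)))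

end ApproximateUnit

theorem mainTheorem5 {G : Type u} [Group G] [TopologicalSpace G] [IsTopologicalGroup G]
    [LocallyCompactSpace G] [T2Space G] [MeasurableSpace G] [BorelSpace G]
    (μ : Measure G) [μ.IsHaarMeasure] [μ.Regular]
    (p p' : ℝ≥0∞) [Fact (1 ≤ p)] [Fact (1 ≤ p')] (hp : 1 < p) (hp_top : p < ∞)
    (hpp' : p.HolderConjugate p') :
    (∀ f ∈ ApSpace p p' μ, ∀ g ∈ BpSpace p' G,
      f * g ∈ ApSpace p p' μ ∧ ApNorm p p' μ (f * g) ≤ ApNorm p p' μ f * BpNorm p' μ g) ∧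
    (∀ f ∈ BpSpace p' G,
      f ∈ ApMultipliers p p' μ ∧ ApMultiplierNorm p p' μ f ≤ BpNorm p' μ f) ∧
    (∀ f ∈ ApSpace p p' μ, f ∈ BpSpace p' G ∧
      ApMultiplierNorm p p' μ f ≤ BpNorm p' μ f ∧ BpNorm p' μ f ≤ ApNorm p p' μ f) ∧
    (IsAmenableGroup G → ∀ f ∈ ApSpace p p' μ,
      ApMultiplierNorm p p' μ f = BpNorm p' μ f ∧ BpNorm p' μ f = ApNorm p p' μ f) := by
  have := hpp'
  have hp' : p' ≠ ∞ := (ENNReal.HolderConjugate.lt_top_iff_one_lt p' p).2 hp |>.ne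
  have hmul : ∀ f ∈ ApSpace p p' μ, ∀ g ∈ BpSpace p' G,
      f * g ∈ ApSpace p p' μ ∧ ApNorm p p' μ (f * g) ≤ ApNorm p p' μ f * BpNorm p' μ g := by
    intro f hf g hg
    rw [mem_ApSpace_iff] at hf
    have hg' : bpENorm p' μ g ≠ ∞ := bpENorm_ne_top hg
    have h := apENorm_mul_le hp hp_top hp' hf hg'
    rw [mem_ApSpace_iff, ApNorm_eq, ApNorm_eq, BpNorm_eq, ← ENNReal.toReal_mul]
    exact ⟨(h.trans_lt (ENNReal.mul_lt_top hf.lt_top hg'.lt_top)).ne,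
      ENNReal.toReal_mono (ENNReal.mul_ne_top hf hg') h⟩
  have hB : ∀ f ∈ BpSpace p' G,
      f ∈ ApMultipliers p p' μ ∧ ApMultiplierNorm p p' μ f ≤ BpNorm p' μ f := by
    intro f hf
    refine ⟨⟨?_, ?_, fun g hg => mul_comm f g ▸ (hmul g hg f hf).1⟩,
      csInf_le ⟨0, fun C hC => hC.1⟩ ⟨?_, fun g hg => ?_⟩⟩
    · obtain ⟨π, -, ξ, φ, h⟩ := hf
      rw [funext h]
      exact φ.continuous.comp (π.continuous_hom ξ)
    · obtain ⟨π, -, ξ, φ, h⟩ := hf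
      refine ⟨‖φ‖ * ‖ξ‖, fun x => ?_⟩
      rw [h, ← (π.hom x).norm_map ξ]
      exact φ.le_opNorm _
    · rw [BpNorm_eq]
      exact ENNReal.toReal_nonneg
    · rw [mul_comm f g, mul_comm (BpNorm p' μ f)]
      exact (hmul g hg f hf).2
  have hA : ∀ f ∈ ApSpace p p' μ, f ∈ BpSpace p' G ∧
      ApMultiplierNorm p p' μ f ≤ BpNorm p' μ f ∧ BpNorm p' μ f ≤ ApNorm p p' μ f := by
    intro f hf
    rw [mem_ApSpace_iff] at hf
    have hfB : f ∈ BpSpace p' G := mem_BpSpace_of_apENorm_ne_top hp hp_top hp' hf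
    refine ⟨hfB, (hB f hfB).2, ?_⟩
    rw [BpNorm_eq, ApNorm_eq]
    exact ENNReal.toReal_mono hf (bpENorm_le_apENorm hp' f)
  refine ⟨hmul, hB, hA, fun hG f hf => ?_⟩
  obtain ⟨hfB, h1, h2⟩ := hA f hf
  have h3 : ApNorm p p' μ f ≤ ApMultiplierNorm p p' μ f := by
    refine le_csInf ⟨BpNorm p' μ f, ?_, fun g hg => ?_⟩ ?_
    · rw [BpNorm_eq]
      exact ENNReal.toReal_nonneg
    · rw [mul_comm f g, mul_comm (BpNorm p' μ f)]
      exact (hmul g hg f hfB).2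
    rintro C ⟨hC0, hC⟩
    rw [ApNorm_eq]
    refine ENNReal.toReal_le_of_le_ofReal hC0 ?_
    refine apENorm_le_of_forall_apENorm_mul_le hp hp_top hp' hG ((mem_ApSpace_iff μ).1 hf)
      fun g hg => ?_
    have hgA : g ∈ ApSpace p p' μ := (mem_ApSpace_iff μ).2 (hg.trans_lt ENNReal.one_lt_top).ne
    have hfg : apENorm p p' μ (f * g) ≠ ∞ :=
      (mem_ApSpace_iff μ).1 (mul_comm f g ▸ (hmul g hgA f hfB).1)
    have h := hC g hgA
    rw [ApNorm_eq, ApNorm_eq] at h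
    rw [← ENNReal.ofReal_toReal hfg]
    refine ENNReal.ofReal_le_ofReal (h.trans ?_)
    refine mul_le_of_le_one_right hC0 ?_
    rw [← ENNReal.toReal_one]
    exact ENNReal.toReal_mono ENNReal.one_ne_top hg
  exact ⟨le_antisymm h1 (h2.trans h3), le_antisymm h2 (h3.trans h1)⟩
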